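/- For $\delta\in\mathbb R$ let $w_\delta(x)=(1+|x|)^{-\delta}$ on $\mathbb R^3$ and $L^p_{w_\delta}=L^p(\mathbb R^3,w_\delta\,dx)$. For $1<p<\infty$ and $0<\delta<3$, let $R_j=\partial_j/\sqrt{-\Delta}$ $(j=1,2,3)$ denote the Riesz transform on $L^p_{w_\delta}$, i.e. the unique bounded operator on $L^p_{w_\delta}$ which coincides on Schwartz functions with the Fourier multiplier of symbol $i\xi_j/|\xi|$; on functions of $(t,x)$ it acts in the variable $x$. Let $0<\gamma<\frac52$ and $0<T<+\infty$. Let $\mathbb F(t,x)=(F_{i,j}(t,x))_{1\le i,j\le3}$ be a tensor with $\mathbb F\in L^2((0,T),L^2_{w_\gamma})$, and let $\mathbf b$ be a time-dependent vector field on $\mathbb R^3$ with $\nabla\cdot\mathbf b=0$ and $\mathbf b\in L^3((0,T),L^3_{w_{3\gamma/2}})$. Let $\mathbf u$ be a vector field with $\mathbf u\in L^\infty((0,T),L^2_{w_\gamma})$ and $\nabla\mathbf u\in L^2((0,T),L^2_{w_\gamma})$, and let $q\in\mathcal D'((0,T)\times\mathbb R^3)$, such that, in the sense of distributions on $(0,T)\times\mathbb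 R^3$, $$\partial_t\mathbf u=\Delta\mathbf u-(\mathbf b\cdot\nabla)\mathbf u-\nabla q+\nabla\cdot\mathbb F,\qquad \nabla\cdot\mathbf u=0,$$ where $(\nabla\cdot\mathbb F)_j=\sum_i\partial_iF_{i,j}$. Then the operators $R_j$ exist on $L^{6/5}_{w_{6\gamma/5}}$ and on $L^2_{w_\gamma}$, $$\sum_{i=1}^3\sum_{j=1}^3R_iR_j(b_iu_j)\in L^3((0,T),L^{6/5}_{w_{6\gamma/5}}),\qquad \sum_{i=1}^3\sum_{j=1}^3R_iR_jF_{i,j}\in L^2((0,T),L^2_{w_\gamma}),$$ each term of these sums lies in the same space as the sum, and in the sense of distributions on $(0,T)\times\mathbb R^3$ $$\nabla q=\nabla\Big(\sum_{i=1}^3\sum_{j=1}^3R_iR_j(b_iu_j-F_{i,j})\Big).$$ -/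

import Mathlib

open MeasureTheory TopologicalSpace Set
open scoped ENNReal SchwartzMap Distributions LineDeriv FourierTransform

namespace WeightedNS

/-- The Euclidean space `ℝ³`. -/
abbrev R3 : Type := EuclideanSpace ℝ (Fin 3)

/-! ### Weighted Lebesgue spaces -/

/-- The weight `w_δ(x) = (1 + |x|)^(-δ)`. -/
noncomputable def weight (δ : ℝ) (x : R3) : ℝ := (1 + ‖x‖) ^ (-δ)

/-- The measure `w_δ(x) dx` on `ℝ³`, so that `L^p_{w_δ} = L^p(w_δ dx)` is
`Lp ℝ p (weightMeasure δ)`. -/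
noncomputable def weightMeasure (δ : ℝ) : Measure R3 :=
  volume.withDensity fun x => ENNReal.ofReal (weight δ x)

theorem continuous_weight (δ : ℝ) : Continuous (weight δ) := by
  refine (continuous_const.add continuous_norm).rpow_const fun x => Or.inl ?_
  have := norm_nonneg x
  exact (by linarith : (0:ℝ) < 1 + ‖x‖).ne'

/-- Schwartz functions belong to `L^p_{w_δ}`: the measure `w_δ dx` has temperate growth. -/
instance weightMeasure_hasTemperateGrowth (δ : ℝ) : (weightMeasure δ).HasTemperateGrowth := by
  obtain ⟨n, hn⟩ := exists_nat_ge (4 - δ)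
  refine ⟨n, ?_⟩
  unfold weightMeasure
  rw [integrable_withDensity_iff_integrable_smul₀'
    ((continuous_weight δ).measurable.ennreal_ofReal.aemeasurable) (by simp)]
  have h4 : Integrable (fun x : R3 => (1 + ‖x‖) ^ (-(4 : ℝ))) :=
    integrable_one_add_norm (by simp; norm_num)
  have hpos : ∀ x : R3, 0 < 1 + ‖x‖ := fun x => by positivity
  refine h4.mono' ?_ (Filter.Eventually.of_forall fun x => ?_)
  · refine Measurable.aestronglyMeasurable ?_
    have := (continuous_weight δ).measurable
    fun_prop
  · have hw : 0 ≤ weight δ x := (Real.rpow_pos_of_pos (hpos x) _).le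
    rw [ENNReal.toReal_ofReal hw, smul_eq_mul, Real.norm_of_nonneg
      (mul_nonneg hw (Real.rpow_pos_of_pos (hpos x) _).le), weight, ← Real.rpow_add (hpos x)]
    exact Real.rpow_le_rpow_of_exponent_le (by simp) (by linarith)

instance weightMeasure_isFiniteMeasureOnCompacts (δ : ℝ) :
    IsFiniteMeasureOnCompacts (weightMeasure δ) := by
  have : IsLocallyFiniteMeasure (weightMeasure δ) :=
    IsLocallyFiniteMeasure.withDensity_ofReal (continuous_weight δ)
  infer_instance

instance fact_one_le_six_fifths : Fact ((1 : ℝ≥0∞) ≤ 6 / 5) :=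
  ⟨by rw [ENNReal.le_div_iff_mul_le (by simp) (by simp)]; norm_num⟩

/-- The space-time slab `(0,T) × ℝ³`. -/
def slab (T : ℝ) : Opens (ℝ × R3) := ⟨Ioo 0 T ×ˢ univ, isOpen_Ioo.prod isOpen_univ⟩

/-- `f ∈ L^r((0,T), L^p_{w_δ})`. -/
def MemLL {V : Type*} [NormedAddCommGroup V] (r p : ℝ≥0∞) (δ T : ℝ) (f : ℝ → R3 → V) : Prop :=
  AEStronglyMeasurable (fun z : ℝ × R3 => f z.1 z.2) (volume.restrict (slab T : Set (ℝ × R3))) ∧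
    eLpNorm (fun t => eLpNorm (f t) p (weightMeasure δ)) r (volume.restrict (Ioo 0 T)) < ⊤

/-! ### Distributions on `(0,T) × ℝ³` -/

/-- The distribution on `(0,T) × ℝ³` given by a function `f` which is locally integrable there
(and `0` if `f` is not locally integrable). -/
noncomputable def toDist (T : ℝ) (f : ℝ → R3 → ℝ) : 𝓓'(slab T, ℝ) :=
  (TestFunction.integralAgainstBilinCLM (ContinuousLinearMap.mul ℝ ℝ) volume
    (fun z : ℝ × R3 => f z.1 z.2) : 𝓓(slab T, ℝ) →L[ℝ] ℝ)

/-- The direction of the time variable `t`. -/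
def dt : ℝ × R3 := (1, 0)

/-- The direction of the space variable `x_i`. -/
noncomputable def dx (i : Fin 3) : ℝ × R3 := (0, EuclideanSpace.single i 1)

/-- `∇ · v = 0` in `𝓓'((0,T) × ℝ³)`. -/
def DivFree (T : ℝ) (v : ℝ → R3 → R3) : Prop :=
  ∑ i, ∂_{dx i} (toDist T fun t x => v t x i) = 0

/-- `G t x i j` is the partial derivative `∂_i u_j(t,x)`, in the sense of distributions. -/
def IsWeakGradient (T : ℝ) (u : ℝ → R3 → R3) (G : ℝ → R3 → Fin 3 → Fin 3 → ℝ) : Prop :=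
  ∀ i j, ∂_{dx i} (toDist T fun t x => u t x j) = toDist T fun t x => G t x i j

/-- The equation `∂_t u = Δ u - (b · ∇) u - ∇ q + ∇ · F` in `𝓓'((0,T) × ℝ³)`, where
`G t x i j = ∂_i u_j(t,x)`, so that `((b · ∇) u)_j = ∑ i, b_i G_{i,j}`, and where
`(∇ · F)_j = ∑ i, ∂_i F_{i,j}`. -/
def AdvectionDiffusion (T : ℝ) (b u : ℝ → R3 → R3) (G F : ℝ → R3 → Fin 3 → Fin 3 → ℝ)
    (q : 𝓓'(slab T, ℝ)) : Prop :=
  ∀ j, ∂_{dt} (toDist T fun t x => u t x j) =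
    ∑ i, ∂_{dx i} (∂_{dx i} (toDist T fun t x => u t x j))
      - toDist T (fun t x => ∑ i, b t x i * G t x i j)
      - ∂_{dx j} q
      + ∑ i, ∂_{dx i} (toDist T fun t x => F t x i j)

/-! ### Riesz transforms -/

/-- The Riesz transform `R_j = ∂_j / √(-Δ)` of a Schwartz function: the Fourier multiplier
`i ξ_j / |ξ|`. Since `f` is real and the multiplier is odd and imaginary, the inverse Fourier
integral is real. -/
noncomputable def rieszSchwartz (j : Fin 3) (f : 𝓢(R3, ℝ)) (x : R3) : ℝ :=
  (𝓕⁻ (fun ξ : R3 => Complex.I * ((ξ j / ‖ξ‖ : ℝ) : ℂ) * 𝓕 (fun y : R3 => (f y : ℂ)) ξ) x).re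

/-- `R` is the Riesz transform `R_j` on `L^p_{w_δ}`: the bounded operator on `L^p_{w_δ}` which
coincides with `∂_j / √(-Δ)` on Schwartz functions. -/
def IsRieszTransform {p : ℝ≥0∞} [Fact (1 ≤ p)] {δ : ℝ} (j : Fin 3)
    (R : Lp ℝ p (weightMeasure δ) →L[ℝ] Lp ℝ p (weightMeasure δ)) : Prop :=
  ∀ f : 𝓢(R3, ℝ), R (f.toLp p (weightMeasure δ)) =ᵐ[weightMeasure δ] rieszSchwartz j f

/-- There is at most one such operator, as Schwartz functions are dense in `L^p_{w_δ}`. -/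
theorem IsRieszTransform.unique {p : ℝ≥0∞} [Fact (1 ≤ p)] (hp : p ≠ ⊤) {δ : ℝ} {j : Fin 3}
    {R R' : Lp ℝ p (weightMeasure δ) →L[ℝ] Lp ℝ p (weightMeasure δ)}
    (h : IsRieszTransform j R) (h' : IsRieszTransform j R') : R = R' := by
  have hd := SchwartzMap.denseRange_toLpCLM (E := R3) (F := ℝ) hp (μ := weightMeasure δ)
  refine ContinuousLinearMap.ext fun g => congrFun (hd.equalizer R.continuous R'.continuous ?_) g
  funext f
  exact Lp.ext ((h f).trans (h' f).symm)

end WeightedNS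

/-! Taking the divergence of the equation removes `∂_t u` and `Δu`, and `∇·b = 0` turns the
transport term into `∑ ∂_i(b_i u_j)`. Hence `Δq = ∑ ∂_i ∂_j (F_{ij} - b_i u_j)`, and `R_i R_j Δ =
-∂_i ∂_j` gives the candidate `p = ∑ R_i R_j (b_i u_j - F_{ij})` the same Laplacian. Each `∂_k(q -
p)` is therefore harmonic in `x`, and a Liouville argument makes it vanish. Three things have to be
supplied.

(1) Riesz transforms on the weighted spaces. Everything is phrased with the bilinear form `mform m f
g = ∫ m f̂ ĝ(-·)` on Schwartz functions. The `L²` bound is Plancherel. For `L^6` (and `L^{6/5}` by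
antisymmetry) let `H_θ` be the Hilbert transform in direction `θ`. Up to a smooth cut-off, `f + i
H_θ f` has its spectrum in an open half-space, so the integral of its sixth power is zero. The real
part of that identity bounds `‖H_θ f‖_6` by `‖f‖_6`. Averaging over `θ` in the unit ball (method of
rotations) yields `R_j`. The weight enters by perturbation: with `⟨x⟩ = (1+|x|²)^{1/2}` and `s =
δ/p`, conjugating `R_j` by `⟨x⟩^{-s}` changes it by an operator with kernel at most `2 |x-y|^{-3}
|(⟨y⟩/⟨x⟩)^s - 1|`. This kernel is no longer singular enough to need cancellation, and Schur's test
with powers of `⟨y⟩/⟨x⟩` bounds it (`exists_lintegral_commKernel_le`). To avoid principal values,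
the symbol is written as a superposition of derivatives of Gaussians. On the `L^{6/5}` space `s =
γ`, and the test closes because `γ < 5/2`, that is `6γ/5 < 3`. Converse Hölder and density of
Schwartz functions then give bounded operators, and the identity for `R_i R_j Δ` passes to the
limit.

(2) The product rule `∑ ∂_i(b_i u_j) = ∑ b_i ∂_i u_j` with `b`, `u`, `∇u` only locally square
integrable (`sum_lineDeriv_mul_eq`). It is proved by mollifying `u` and `∇u` alone and using
continuity of translations in `L²`.

(3) Liouville (`Averaging.eq_zero_of_laplacian_eq_zero`). A function in `L^r((0,T), L^p_{w_δ})` with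
`δ < 3` has averages over `(0,T) × B_R` tending to zero, and so do its distributional derivatives,
all derivatives being put on the test function. The equation writes `∂_k q` as a sum of such
derivatives, although nothing of the kind is known for `q` itself. A harmonic object equals its ball
averages, by the mean value property, so `∂_k(q - p) = 0`. -/

namespace WeightedNS

/-! ### Fourier multiplier forms on real Schwartz functions -/

/-- The complexification of a real Schwartz function. -/
noncomputable def fc (f : 𝓢(R3, ℝ)) : 𝓢(R3, ℂ) := f.postcompCLM Complex.ofRealCLM

@[simp] theorem fc_apply (f : 𝓢(R3, ℝ)) (x : R3) : fc f x = (f x : ℂ) := rfl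

/-- The symbol `i ξ_j / |ξ|`. -/
noncomputable def rsym (j : Fin 3) (ξ : R3) : ℂ := Complex.I * ((ξ j / ‖ξ‖ : ℝ) : ℂ)

theorem abs_coord_le (ξ : R3) (j : Fin 3) : |ξ j| ≤ ‖ξ‖ := by
  simpa using PiLp.norm_apply_le ξ j

theorem norm_rsym_le (j : Fin 3) (ξ : R3) : ‖rsym j ξ‖ ≤ 1 := by
  rw [rsym, norm_mul, Complex.norm_I, one_mul, Complex.norm_real, Real.norm_eq_abs, abs_div,
    abs_norm]
  exact div_le_one_of_le₀ (abs_coord_le ξ j) (norm_nonneg _)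

theorem continuous_coord (j : Fin 3) : Continuous fun ξ : R3 => ξ j :=
  (EuclideanSpace.proj (𝕜 := ℝ) j).continuous

theorem measurable_coord (j : Fin 3) : Measurable fun ξ : R3 => ξ j :=
  (continuous_coord j).measurable

theorem measurable_rsym (j : Fin 3) : Measurable (rsym j) := by
  unfold rsym
  have := measurable_coord j
  fun_prop

theorem rsym_neg (j : Fin 3) (ξ : R3) : rsym j (-ξ) = -rsym j ξ := by
  simp [rsym, neg_div]

/-- The bilinear form `(f, g) ↦ ∫ m(ξ) f̂(ξ) ĝ(-ξ) dξ` of the Fourier multiplier `m`. -/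
noncomputable def mform (m : R3 → ℂ) (f g : 𝓢(R3, ℝ)) : ℂ :=
  ∫ ξ, m ξ * 𝓕 (fc f) ξ * 𝓕⁻ (fc g) ξ

theorem rieszSchwartz_eq (j : Fin 3) (f : 𝓢(R3, ℝ)) (x : R3) :
    rieszSchwartz j f x = (𝓕⁻ (fun ξ => rsym j ξ * 𝓕 (fc f) ξ) x).re := rfl

theorem integrable_mul_schwartz {m : R3 → ℂ} (hm : Measurable m) (hm1 : ∀ ξ, ‖m ξ‖ ≤ 1)
    (f : 𝓢(R3, ℂ)) : Integrable (fun ξ => m ξ * f ξ) :=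
  f.integrable.bdd_mul hm.aestronglyMeasurable (Filter.Eventually.of_forall hm1)

/-- Self-duality of the Fourier integral. Using the negated inner product as pairing produces the
inverse transform on both sides. -/
theorem integral_fourierInv_mul {h k : R3 → ℂ} (hh : Integrable h) (hk : Integrable k) :
    ∫ x, 𝓕⁻ h x * k x = ∫ ξ, h ξ * 𝓕⁻ k ξ := by
  have h1 := VectorFourier.integral_bilin_fourierIntegral_eq_flip (μ := volume) (ν := volume)
    (ContinuousLinearMap.mul ℂ ℂ) (L := -innerₗ R3)
    Real.continuous_fourierChar (by
      simp only [LinearMap.neg_apply, innerₗ_apply_apply]; fun_prop) hh hk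
  simp only [ContinuousLinearMap.mul_apply'] at h1
  convert! h1 using 4
  simp only [Real.fourierInv_eq, VectorFourier.fourierIntegral]
  congr 1; ext v
  simp [real_inner_comm]

theorem continuous_fourierInv {h : R3 → ℂ} (hh : Integrable h) : Continuous (𝓕⁻ h) := by
  have : 𝓕⁻ h = fun x => 𝓕 h (-x) := by
    ext x; exact Real.fourierInv_eq_fourier_neg h x
  rw [this]
  exact (VectorFourier.fourierIntegral_continuous Real.continuous_fourierChar
    (by exact continuous_inner) hh).comp continuous_neg

theorem norm_fourierInv_le (h : R3 → ℂ) (x : R3) : ‖𝓕⁻ h x‖ ≤ ∫ ξ, ‖h ξ‖ := by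
  rw [Real.fourierInv_eq]
  refine (norm_integral_le_integral_norm _).trans (le_of_eq ?_)
  simp

theorem integrable_rsym_fourier (j : Fin 3) (f : 𝓢(R3, ℝ)) :
    Integrable (fun ξ => rsym j ξ * 𝓕 (fc f) ξ) :=
  integrable_mul_schwartz (measurable_rsym j) (norm_rsym_le j) _

theorem continuous_rieszSchwartz (j : Fin 3) (f : 𝓢(R3, ℝ)) : Continuous (rieszSchwartz j f) :=
  Complex.continuous_re.comp (continuous_fourierInv (integrable_rsym_fourier j f))

theorem integral_re_fourierInv_mul {h : R3 → ℂ} (hh : Integrable h) (g : 𝓢(R3, ℝ)) :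
    ∫ x, (𝓕⁻ h x).re * g x = (∫ ξ, h ξ * 𝓕⁻ (fc g) ξ).re := by
  have h1 := integral_fourierInv_mul hh (fc g).integrable
  rw [← SchwartzMap.fourierInv_coe] at h1
  rw [← h1]
  have hi : Integrable fun x => 𝓕⁻ h x * fc g x :=
    (fc g).integrable.bdd_mul (continuous_fourierInv hh).aestronglyMeasurable
      (Filter.Eventually.of_forall (norm_fourierInv_le h))
  have := integral_re hi
  simp only [RCLike.re_eq_complex_re] at this
  rw [← this]
  congr 1; ext x
  simp

theorem integral_rieszSchwartz_mul (j : Fin 3) (f g : 𝓢(R3, ℝ)) :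
    ∫ x, rieszSchwartz j f x * g x = (mform (rsym j) f g).re :=
  integral_re_fourierInv_mul (integrable_rsym_fourier j f) g

theorem fourier_neg_apply (f : 𝓢(R3, ℂ)) (ξ : R3) : 𝓕 f (-ξ) = 𝓕⁻ f ξ := by
  rw [SchwartzMap.fourierInv_coe, SchwartzMap.fourier_coe, Real.fourierInv_eq_fourier_neg]

theorem fourierInv_neg_apply (f : 𝓢(R3, ℂ)) (ξ : R3) : 𝓕⁻ f (-ξ) = 𝓕 f ξ := by
  rw [← fourier_neg_apply, neg_neg]

/-- The substitution `ξ ↦ -ξ` exchanges `𝓕` and `𝓕⁻`, hence the roles of `f` and `g`, and the symbol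
is odd. -/
theorem mform_rsym_symm (j : Fin 3) (f g : 𝓢(R3, ℝ)) :
    mform (rsym j) f g = -mform (rsym j) g f := by
  unfold mform
  rw [← integral_neg, ← integral_neg_eq_self]
  congr 1; ext ξ
  rw [rsym_neg, fourier_neg_apply, fourierInv_neg_apply]
  ring

/-- The Riesz transforms are antisymmetric. -/
theorem integral_rieszSchwartz_mul_eq_neg (j : Fin 3) (f g : 𝓢(R3, ℝ)) :
    ∫ x, rieszSchwartz j f x * g x = -∫ x, f x * rieszSchwartz j g x := by
  simp_rw [mul_comm (f _)]
  rw [integral_rieszSchwartz_mul, integral_rieszSchwartz_mul, mform_rsym_symm, Complex.neg_re]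

theorem rieszSchwartz_add (j : Fin 3) (f g : 𝓢(R3, ℝ)) (x : R3) :
    rieszSchwartz j (f + g) x = rieszSchwartz j f x + rieszSchwartz j g x := by
  have h1 : fc (f + g) = fc f + fc g := by ext x; simp
  rw [rieszSchwartz_eq, rieszSchwartz_eq, rieszSchwartz_eq, ← Complex.add_re, h1,
    FourierTransform.fourier_add]
  have hi : ∀ f : 𝓢(R3, ℝ), Integrable fun ξ : R3 =>
      Real.fourierChar (inner ℝ ξ x) • (rsym j ξ * 𝓕 (fc f) ξ) := fun f => by
    simpa using (Real.fourierIntegral_convergent_iff (-x)).2 (integrable_rsym_fourier j f)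
  simp only [Real.fourierInv_eq]
  rw [← integral_add (hi f) (hi g)]
  congr 2; ext ξ
  rw [← smul_add, ← mul_add]
  rfl

theorem rieszSchwartz_smul (j : Fin 3) (c : ℝ) (f : 𝓢(R3, ℝ)) (x : R3) :
    rieszSchwartz j (c • f) x = c * rieszSchwartz j f x := by
  have h1 : fc (c • f) = (c : ℂ) • fc f := by ext x; simp
  rw [rieszSchwartz_eq, rieszSchwartz_eq, h1, FourierTransform.fourier_smul]
  simp only [Real.fourierInv_eq, smul_apply, smul_eq_mul, Circle.smul_def]
  rw [← Complex.re_ofReal_mul, ← integral_const_mul]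
  congr 2; ext ξ
  ring

/-- The `L^p` norm of a real function as a real number. -/
noncomputable def nrm (p : ℝ) (f : R3 → ℝ) : ℝ := (∫ x, |f x| ^ p) ^ (1 / p)

theorem integral_norm_sq_fourier_fc (f : 𝓢(R3, ℝ)) :
    ∫ ξ, ‖𝓕 (fc f) ξ‖ ^ (2 : ℝ) = ∫ x, |f x| ^ (2 : ℝ) := by
  have := SchwartzMap.integral_norm_sq_fourier (fc f)
  simpa using this

theorem integral_norm_sq_fourierInv_fc (f : 𝓢(R3, ℝ)) :
    ∫ ξ, ‖𝓕⁻ (fc f) ξ‖ ^ (2 : ℝ) = ∫ x, |f x| ^ (2 : ℝ) := by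
  rw [← integral_norm_sq_fourier_fc, ← integral_neg_eq_self]
  simp_rw [fourierInv_neg_apply]

/-- Cauchy–Schwarz on the Fourier side followed by Plancherel; only the bound on the symbol matters.
-/
theorem norm_mform_le {m : R3 → ℂ} (hm1 : ∀ ξ, ‖m ξ‖ ≤ 1)
    (f g : 𝓢(R3, ℝ)) : ‖mform m f g‖ ≤ nrm 2 f * nrm 2 g := by
  have hf : MemLp (𝓕 (fc f) : 𝓢(R3, ℂ)) (ENNReal.ofReal 2) volume := (𝓕 (fc f)).memLp _ _
  have hg : MemLp (𝓕⁻ (fc g) : 𝓢(R3, ℂ)) (ENNReal.ofReal 2) volume := (𝓕⁻ (fc g)).memLp _ _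
  have h2 : (2 : ℝ).HolderConjugate 2 := Real.HolderConjugate.two_two
  have h1 := integral_mul_norm_le_Lp_mul_Lq h2 hf hg
  rw [integral_norm_sq_fourier_fc, integral_norm_sq_fourierInv_fc] at h1
  refine ((norm_integral_le_integral_norm _).trans ?_).trans h1
  refine integral_mono_of_nonneg (Filter.Eventually.of_forall fun _ => norm_nonneg _) ?_
    (Filter.Eventually.of_forall fun ξ => ?_)
  · exact ((𝓕⁻ (fc g)).integrable.norm.bdd_mul (c := SchwartzMap.seminorm ℝ 0 0 (𝓕 (fc f)))
      (𝓕 (fc f)).continuous.norm.aestronglyMeasurable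
      (Filter.Eventually.of_forall fun x => by
        simpa using SchwartzMap.norm_le_seminorm ℝ (𝓕 (fc f)) x))
  · simp only [norm_mul]
    gcongr
    exact mul_le_of_le_one_left (norm_nonneg _) (hm1 ξ)

/-! ### The Hilbert transform in a direction -/

theorem integrable_schwartz_pow (f : 𝓢(R3, ℂ)) {n : ℕ} (hn : 1 ≤ n) :
    Integrable fun x => f x ^ n := by
  obtain ⟨k, rfl⟩ := Nat.exists_eq_add_of_le' hn
  simp_rw [pow_succ]
  refine f.integrable.bdd_mul (c := (SchwartzMap.seminorm ℝ 0 0 f) ^ k)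
    (f.continuous.pow k).aestronglyMeasurable (Filter.Eventually.of_forall fun x => ?_)
  rw [norm_pow]
  exact pow_le_pow_left₀ (norm_nonneg _) (SchwartzMap.norm_le_seminorm ℝ f x) k

/-- Powers of a function whose Fourier transform lives in an open half-space have the same
property. -/
theorem integral_char_mul_fourierInv_pow_eq_zero (θ : R3) (ψ : 𝓢(R3, ℂ))
    (hψ : ∀ ξ, inner ℝ θ ξ ≤ 0 → ψ ξ = 0) {n : ℕ} (hn : 1 ≤ n) (η : R3) (hη : 0 ≤ inner ℝ θ η) :
    ∫ x, Real.fourierChar (inner ℝ x η) • (𝓕⁻ ψ x) ^ n = 0 := by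
  induction n, hn using Nat.le_induction generalizing η with
  | base =>
    have h1 : 𝓕 (𝓕⁻ ψ) (-η) = ψ (-η) := by rw [FourierTransform.fourier_fourierInv_eq]
    rw [SchwartzMap.fourier_coe, Real.fourier_eq, hψ _ (by simpa using hη)] at h1
    simpa using h1
  | succ n hn ih =>
    have hi : Integrable fun x => Real.fourierChar (inner ℝ x η) • (𝓕⁻ ψ x) ^ n := by
      have := (Real.fourierIntegral_convergent_iff (-η)).2 (integrable_schwartz_pow (𝓕⁻ ψ) hn)
      simpa using this
    -- One of the `n + 1` factors is moved across by duality, which leaves `∫ ψ(ξ)` times the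
    -- integral of the `n`-th power at frequency `ξ + η`. Either `ψ ξ = 0`, or `⟨θ, ξ + η⟩ ≥ 0` and
    -- the induction hypothesis applies. This is why a general frequency `η` is carried along.
    have h1 := integral_fourierInv_mul ψ.integrable hi
    rw [← SchwartzMap.fourierInv_coe] at h1
    have h2 : ∀ ξ, ψ ξ * 𝓕⁻ (fun x => Real.fourierChar (inner ℝ x η) • (𝓕⁻ ψ x) ^ n) ξ = 0 := by
      intro ξ
      by_cases hξ : inner ℝ θ ξ ≤ 0
      · rw [hψ ξ hξ, zero_mul]
      · have := ih (ξ + η) (by rw [inner_add_right]; linarith)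
        rw [Real.fourierInv_eq]
        simp_rw [smul_smul, ← AddChar.map_add_eq_mul, ← inner_add_right]
        rw [this, mul_zero]
    simp_rw [h2, integral_zero] at h1
    rw [← h1]
    congr 1; ext x
    simp only [Circle.smul_def, smul_eq_mul]
    ring

theorem fourier_fc_neg (f : 𝓢(R3, ℝ)) (ξ : R3) :
    𝓕 (fc f) (-ξ) = (starRingEnd ℂ) (𝓕 (fc f) ξ) := by
  rw [SchwartzMap.fourier_coe, Real.fourier_eq, Real.fourier_eq, ← integral_conj]
  congr 1; ext x
  simp only [Circle.smul_def, smul_eq_mul, map_mul, fc_apply, Complex.conj_ofReal,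
    inner_neg_right, neg_neg]
  rw [AddChar.map_neg_eq_inv, Circle.coe_inv_eq_conj, Complex.conj_conj]

/-- A multiplier with `m(-ξ) = conj m(ξ)` maps real functions to real functions. -/
theorem fourierInv_mul_fourier_im_eq_zero {m : R3 → ℂ}
    (hm : ∀ ξ, m (-ξ) = (starRingEnd ℂ) (m ξ)) (f : 𝓢(R3, ℝ)) (x : R3) :
    (𝓕⁻ (fun ξ => m ξ * 𝓕 (fc f) ξ) x).im = 0 := by
  rw [← Complex.conj_eq_iff_im, Real.fourierInv_eq, ← integral_conj, ← integral_neg_eq_self]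
  congr 1; ext ξ
  simp only [Circle.smul_def, smul_eq_mul, map_mul, hm, fourier_fc_neg, inner_neg_left,
    Complex.conj_conj]
  rw [AddChar.map_neg_eq_inv, Circle.coe_inv_eq_conj, Complex.conj_conj]

/-- A smooth cut-off of the half-line `(0,∞)`. -/
structure IsCutoff (σ : ℝ → ℝ) : Prop where
  temperate : σ.HasTemperateGrowth
  nonneg : ∀ t, 0 ≤ σ t
  le_one : ∀ t, σ t ≤ 1
  zero : ∀ t ≤ 0, σ t = 0

/-- The even symbol `σ(θ·ξ) + σ(-θ·ξ)`. -/
noncomputable def evenSym (σ : ℝ → ℝ) (θ ξ : R3) : ℂ :=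
  ((σ (inner ℝ θ ξ) + σ (-inner ℝ θ ξ) : ℝ) : ℂ)

/-- The odd symbol `-i (σ(θ·ξ) - σ(-θ·ξ))`. -/
noncomputable def oddSym (σ : ℝ → ℝ) (θ ξ : R3) : ℂ :=
  -Complex.I * ((σ (inner ℝ θ ξ) - σ (-inner ℝ θ ξ) : ℝ) : ℂ)

theorem evenSym_neg (σ : ℝ → ℝ) (θ ξ : R3) :
    evenSym σ θ (-ξ) = (starRingEnd ℂ) (evenSym σ θ ξ) := by
  simp [evenSym, add_comm]

theorem oddSym_neg (σ : ℝ → ℝ) (θ ξ : R3) :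
    oddSym σ θ (-ξ) = (starRingEnd ℂ) (oddSym σ θ ξ) := by
  simp [oddSym]; ring

theorem IsCutoff.temperate_inner {σ : ℝ → ℝ} (hσ : IsCutoff σ) (θ : R3) :
    (fun ξ : R3 => ((σ (inner ℝ θ ξ) : ℝ) : ℂ)).HasTemperateGrowth := by
  have h1 : (fun ξ : R3 => σ (inner ℝ θ ξ)).HasTemperateGrowth :=
    hσ.temperate.comp (Function.hasTemperateGrowth_inner_right θ)
  exact Function.HasTemperateGrowth.comp Complex.ofRealCLM.hasTemperateGrowth h1

theorem IsCutoff.temperate_neg_inner {σ : ℝ → ℝ} (hσ : IsCutoff σ) (θ : R3) :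
    (fun ξ : R3 => ((σ (-inner ℝ θ ξ) : ℝ) : ℂ)).HasTemperateGrowth := by
  simpa using hσ.temperate_inner (-θ)

theorem IsCutoff.temperate_evenSym {σ : ℝ → ℝ} (hσ : IsCutoff σ) (θ : R3) :
    (evenSym σ θ).HasTemperateGrowth := by
  convert! (hσ.temperate_inner θ).add (hσ.temperate_neg_inner θ) using 1
  ext ξ; simp [evenSym]

theorem IsCutoff.temperate_oddSym {σ : ℝ → ℝ} (hσ : IsCutoff σ) (θ : R3) :
    (oddSym σ θ).HasTemperateGrowth := by
  convert! (Function.HasTemperateGrowth.const (E := R3) (-Complex.I)).mul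
    ((hσ.temperate_inner θ).sub (hσ.temperate_neg_inner θ)) using 1
  ext ξ; simp [oddSym]

/-- The Schwartz function with Fourier transform `m f̂`. -/
noncomputable def multiplier (m : R3 → ℂ) (f : 𝓢(R3, ℝ)) : 𝓢(R3, ℂ) :=
  𝓕⁻ (SchwartzMap.smulLeftCLM ℂ m (𝓕 (fc f)))

theorem multiplier_apply {m : R3 → ℂ} (hm : m.HasTemperateGrowth) (f : 𝓢(R3, ℝ)) (x : R3) :
    multiplier m f x = 𝓕⁻ (fun ξ => m ξ * 𝓕 (fc f) ξ) x := by
  have h : (fun ξ => m ξ * 𝓕 (fc f) ξ) = SchwartzMap.smulLeftCLM ℂ m (𝓕 (fc f)) := by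
    ext ξ
    rw [SchwartzMap.smulLeftCLM_apply_apply hm, smul_eq_mul]
  rw [h, multiplier, SchwartzMap.fourierInv_coe]

/-- The real Schwartz function with Fourier transform `m f̂`. -/
noncomputable def reMultiplier (m : R3 → ℂ) (f : 𝓢(R3, ℝ)) : 𝓢(R3, ℝ) :=
  (multiplier m f).postcompCLM Complex.reCLM

theorem multiplier_eq_ofReal {m : R3 → ℂ} (hm : m.HasTemperateGrowth)
    (hm' : ∀ ξ, m (-ξ) = (starRingEnd ℂ) (m ξ)) (f : 𝓢(R3, ℝ)) (x : R3) :
    multiplier m f x = (reMultiplier m f x : ℂ) := by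
  have : (multiplier m f x).im = 0 := by
    rw [multiplier_apply hm]; exact fourierInv_mul_fourier_im_eq_zero hm' f x
  apply Complex.ext
  · simp [reMultiplier]
  · simp [this]

/-- The combination even symbol plus `i` times odd symbol equals `2σ(⟨θ,ξ⟩)`, which vanishes on a
half-space. The function inside is thus an analytic signal in direction `θ`, and every positive
power of it has integral zero. The smooth cut-off keeps all functions Schwartz. -/
theorem integral_re_add_I_mul_pow_six (σ : ℝ → ℝ) (hσ : IsCutoff σ) (θ : R3) (f : 𝓢(R3, ℝ)) :
    ∫ x, (((reMultiplier (evenSym σ θ) f x : ℂ) +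
      Complex.I * reMultiplier (oddSym σ θ) f x) ^ 6).re = 0 := by
  set ψ : 𝓢(R3, ℂ) := (2 : ℂ) • SchwartzMap.smulLeftCLM ℂ
    (fun ξ : R3 => ((σ (inner ℝ θ ξ) : ℝ) : ℂ)) (𝓕 (fc f)) with hψ
  have hψ0 : ∀ ξ, inner ℝ θ ξ ≤ 0 → ψ ξ = 0 := by
    intro ξ hξ
    rw [hψ, smul_apply, SchwartzMap.smulLeftCLM_apply_apply (hσ.temperate_inner θ),
      hσ.zero _ hξ]
    simp
  have h0 := integral_char_mul_fourierInv_pow_eq_zero θ ψ hψ0 (n := 6) (by norm_num) 0 (by simp)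
  simp only [inner_zero_right, AddChar.map_zero_eq_one, one_smul] at h0
  have h1 : ∀ x, 𝓕⁻ ψ x = (reMultiplier (evenSym σ θ) f x : ℂ) +
      Complex.I * reMultiplier (oddSym σ θ) f x := by
    intro x
    rw [← multiplier_eq_ofReal (hσ.temperate_evenSym θ) (evenSym_neg σ θ),
      ← multiplier_eq_ofReal (hσ.temperate_oddSym θ) (oddSym_neg σ θ)]
    unfold multiplier
    have : ψ = SchwartzMap.smulLeftCLM ℂ (evenSym σ θ) (𝓕 (fc f)) +
        Complex.I • SchwartzMap.smulLeftCLM ℂ (oddSym σ θ) (𝓕 (fc f)) := by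
      ext ξ
      rw [hψ, add_apply, smul_apply, smul_apply,
        SchwartzMap.smulLeftCLM_apply_apply (hσ.temperate_inner θ),
        SchwartzMap.smulLeftCLM_apply_apply (hσ.temperate_evenSym θ),
        SchwartzMap.smulLeftCLM_apply_apply (hσ.temperate_oddSym θ)]
      simp only [evenSym, oddSym, smul_eq_mul, Complex.ofReal_add, Complex.ofReal_sub]
      linear_combination (((σ (inner ℝ θ ξ) : ℂ) - σ (-inner ℝ θ ξ)) * 𝓕 (fc f) ξ) *
        Complex.I_sq
    rw [this, FourierTransform.fourierInv_add, FourierTransform.fourierInv_smul]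
    rfl
  have h2 := integral_re (integrable_schwartz_pow (𝓕⁻ ψ) (n := 6) (by norm_num))
  simp only [h1] at h0 h2
  rw [h0] at h2
  simpa using h2

theorem re_add_I_mul_pow_six (a b : ℝ) : (((a : ℂ) + Complex.I * b) ^ 6).re =
    a ^ 6 - 15 * a ^ 4 * b ^ 2 + 15 * a ^ 2 * b ^ 4 - b ^ 6 := by
  have : ((a : ℂ) + Complex.I * b) ^ 6 =
      ((a ^ 6 - 15 * a ^ 4 * b ^ 2 + 15 * a ^ 2 * b ^ 4 - b ^ 6 : ℝ) : ℂ) +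
      ((6 * a ^ 5 * b - 20 * a ^ 3 * b ^ 3 + 6 * a * b ^ 5 : ℝ) : ℂ) * Complex.I := by
    push_cast
    have h2 : Complex.I ^ 2 = -1 := Complex.I_sq
    have h3 : Complex.I ^ 3 = -Complex.I := by rw [pow_succ, h2]; ring
    have h4 : Complex.I ^ 4 = 1 := by rw [pow_succ, h3]; ring_nf; rw [h2]; ring
    have h5 : Complex.I ^ 5 = Complex.I := by rw [pow_succ, h4]; ring
    have h6 : Complex.I ^ 6 = -1 := by rw [pow_succ, h5]; ring_nf; rw [h2]
    ring_nf
    rw [h2, h3, h4, h5, h6]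
    ring
  rw [this, Complex.add_re, Complex.ofReal_re, Complex.re_ofReal_mul, Complex.I_re]
  ring

/-- After cancellation, with `s = a²` and `t = b²`, the point is to absorb `30 s t²`: into `t³` if
`t ≥ 30 s`, and into `30 · 30² s³ = 27000 s³` otherwise. The extra `2` in `27002` compensates `-2
a⁶`. -/
theorem pow_six_le (a b : ℝ) :
    b ^ 6 ≤ 27002 * a ^ 6 - 2 * (a ^ 6 - 15 * a ^ 4 * b ^ 2 + 15 * a ^ 2 * b ^ 4 - b ^ 6) := by
  have ha := sq_nonneg a
  have hb := sq_nonneg b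
  have e1 : a ^ 6 = (a ^ 2) ^ 3 := by ring
  have e2 : b ^ 6 = (b ^ 2) ^ 3 := by ring
  have e3 : a ^ 4 = (a ^ 2) ^ 2 := by ring
  have e4 : b ^ 4 = (b ^ 2) ^ 2 := by ring
  rw [e1, e2, e3, e4]
  generalize a ^ 2 = s at *
  generalize b ^ 2 = t at *
  have h0 : 0 ≤ s ^ 2 * t := by positivity
  suffices 30 * (s * t ^ 2) ≤ t ^ 3 + 27000 * s ^ 3 by nlinarith
  rcases le_total t (30 * s) with h | h
  · have : s * t ^ 2 ≤ s * (30 * s) ^ 2 := by gcongr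
    nlinarith [pow_nonneg hb 3]
  · have : t ^ 2 * (30 * s) ≤ t ^ 2 * t := by gcongr
    nlinarith [pow_nonneg ha 3]

theorem integrable_real_schwartz_pow (f : 𝓢(R3, ℝ)) {n : ℕ} (hn : 1 ≤ n) :
    Integrable fun x => f x ^ n := by
  have := (integrable_schwartz_pow (fc f) hn).re
  simpa [← Complex.ofReal_pow] using this

theorem integral_pow_six_reMultiplier_le (σ : ℝ → ℝ) (hσ : IsCutoff σ) (θ : R3)
    (f : 𝓢(R3, ℝ)) : ∫ x, reMultiplier (oddSym σ θ) f x ^ 6 ≤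
      27002 * ∫ x, reMultiplier (evenSym σ θ) f x ^ 6 := by
  set a := reMultiplier (evenSym σ θ) f
  set b := reMultiplier (oddSym σ θ) f
  have h0 := integral_re_add_I_mul_pow_six σ hσ θ f
  simp only [re_add_I_mul_pow_six] at h0
  have hi : Integrable fun x => a x ^ 6 - 15 * a x ^ 4 * b x ^ 2 + 15 * a x ^ 2 * b x ^ 4 -
      b x ^ 6 := by
    have e : ∀ x, a x ^ 6 - 15 * a x ^ 4 * b x ^ 2 + 15 * a x ^ 2 * b x ^ 4 - b x ^ 6 =
      (((a x : ℂ) + Complex.I * b x) ^ 6).re := fun x => (re_add_I_mul_pow_six _ _).symm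
    simp_rw [e]
    exact (integrable_schwartz_pow (fc a + Complex.I • fc b) (n := 6) (by norm_num)).re
  have h1 : ∫ x, b x ^ 6 ≤ ∫ x, (27002 * a x ^ 6 - 2 * (a x ^ 6 - 15 * a x ^ 4 * b x ^ 2 +
      15 * a x ^ 2 * b x ^ 4 - b x ^ 6)) :=
    integral_mono (integrable_real_schwartz_pow b (by norm_num))
      (((integrable_real_schwartz_pow a (by norm_num)).const_mul _).sub (hi.const_mul _))
      fun x => pow_six_le _ _
  rw [integral_sub ((integrable_real_schwartz_pow a (by norm_num)).const_mul _)
    (hi.const_mul _), integral_const_mul, integral_const_mul, h0] at h1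
  simpa using h1

theorem nrm_six (f : R3 → ℝ) : nrm 6 f = (∫ x, f x ^ 6) ^ (1 / 6 : ℝ) := by
  unfold nrm
  congr 2; ext x
  rw [show (6 : ℝ) = ((6 : ℕ) : ℝ) by norm_num, Real.rpow_natCast]
  exact Even.pow_abs (by decide) _

theorem nrm_nonneg (p : ℝ) (f : R3 → ℝ) : 0 ≤ nrm p f :=
  Real.rpow_nonneg (integral_nonneg fun _ => Real.rpow_nonneg (abs_nonneg _) _) _

theorem abs_integral_mul_le {p q : ℝ} (hpq : p.HolderConjugate q) (f g : 𝓢(R3, ℝ)) :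
    |∫ x, f x * g x| ≤ nrm p f * nrm q g := by
  have hf : MemLp f (ENNReal.ofReal p) volume := f.memLp _ _
  have hg : MemLp g (ENNReal.ofReal q) volume := g.memLp _ _
  have h1 := integral_mul_norm_le_Lp_mul_Lq hpq hf hg
  simp only [Real.norm_eq_abs] at h1
  refine le_trans ?_ h1
  refine (norm_integral_le_integral_norm (fun x => f x * g x)).trans (le_of_eq ?_)
  simp

theorem nrm_six_reMultiplier_le (σ : ℝ → ℝ) (hσ : IsCutoff σ) (θ : R3) (f : 𝓢(R3, ℝ)) :
    nrm 6 (reMultiplier (oddSym σ θ) f) ≤ 6 * nrm 6 (reMultiplier (evenSym σ θ) f) := by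
  rw [nrm_six, nrm_six]
  have h0 : (0 : ℝ) ≤ ∫ x, reMultiplier (evenSym σ θ) f x ^ 6 :=
    integral_nonneg fun x => Even.pow_nonneg (by decide) _
  have h1 : (0 : ℝ) ≤ ∫ x, reMultiplier (oddSym σ θ) f x ^ 6 :=
    integral_nonneg fun x => Even.pow_nonneg (by decide) _
  have e : (6 : ℝ) = ((6 : ℝ) ^ (6 : ℝ)) ^ (1 / 6 : ℝ) := by
    rw [← Real.rpow_mul (by norm_num)]; norm_num
  have e2 : (6 : ℝ) * (∫ x, reMultiplier (evenSym σ θ) f x ^ 6) ^ (1 / 6 : ℝ) =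
      ((6 : ℝ) ^ (6 : ℝ) * ∫ x, reMultiplier (evenSym σ θ) f x ^ 6) ^ (1 / 6 : ℝ) := by
    rw [Real.mul_rpow (by positivity) h0, ← e]
  rw [e2]
  refine Real.rpow_le_rpow h1 ((integral_pow_six_reMultiplier_le σ hσ θ f).trans ?_) (by norm_num)
  gcongr
  -- The constant `6` works because `27002 ≤ 6 ^ 6 = 46656`.
  rw [show (6 : ℝ) ^ (6 : ℝ) = (6 : ℝ) ^ 6 by exact_mod_cast Real.rpow_natCast 6 6]
  norm_num

theorem mform_oddSym (σ : ℝ → ℝ) (hσ : IsCutoff σ) (θ : R3) (f g : 𝓢(R3, ℝ)) :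
    mform (oddSym σ θ) f g = ((∫ x, reMultiplier (oddSym σ θ) f x * g x : ℝ) : ℂ) := by
  have h := SchwartzMap.integral_fourierInv_mul_eq
    (SchwartzMap.smulLeftCLM ℂ (oddSym σ θ) (𝓕 (fc f))) (fc g)
  unfold mform
  simp only [SchwartzMap.smulLeftCLM_apply_apply (hσ.temperate_oddSym θ), smul_eq_mul] at h
  rw [← h, ← integral_complex_ofReal]
  congr 1; ext x
  have := multiplier_eq_ofReal (hσ.temperate_oddSym θ) (oddSym_neg σ θ) f x
  rw [Complex.ofReal_mul, ← this]
  rfl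

theorem norm_mform_oddSym_le {q : ℝ} (hq : (6 : ℝ).HolderConjugate q) (σ : ℝ → ℝ)
    (hσ : IsCutoff σ) (θ : R3) (f g : 𝓢(R3, ℝ)) :
    ‖mform (oddSym σ θ) f g‖ ≤ 6 * nrm 6 (reMultiplier (evenSym σ θ) f) * nrm q g := by
  rw [mform_oddSym σ hσ, Complex.norm_real]
  exact (abs_integral_mul_le hq _ _).trans
    (mul_le_mul_of_nonneg_right (nrm_six_reMultiplier_le σ hσ θ f) (nrm_nonneg _ _))

/-- A sequence of smooth cut-offs increasing to the indicator function of `(0,∞)`. -/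
noncomputable def cutoff (n : ℕ) (t : ℝ) : ℝ := Real.smoothTransition (n * t)

theorem isCutoff_cutoff (n : ℕ) : IsCutoff (cutoff n) where
  temperate := by
    have hs : ContDiff ℝ ((⊤ : ℕ∞) : WithTop ℕ∞) Real.smoothTransition :=
      Real.smoothTransition.contDiff
    have h1 : Function.HasTemperateGrowth Real.smoothTransition := by
      -- The transition function is bounded without being compactly supported, but its derivative is
      -- supported in `[0,1]`.
      refine Function.HasTemperateGrowth.of_fderiv (k := 0) (C := 1) ?_ (hs.differentiable (by simp)) ?_
      · refine HasCompactSupport.hasTemperateGrowth ?_ (hs.fderiv_right (by simp))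
        refine HasCompactSupport.intro (isCompact_Icc (a := (0 : ℝ)) (b := 1)) fun x hx => ?_
        rw [mem_Icc, not_and_or, not_le, not_le] at hx
        rcases hx with hx | hx
        · have : Real.smoothTransition =ᶠ[nhds x] fun _ => 0 := by
            filter_upwards [Iio_mem_nhds hx] with y hy
            exact Real.smoothTransition.zero_of_nonpos (le_of_lt hy)
          rw [this.fderiv_eq]; simp
        · have : Real.smoothTransition =ᶠ[nhds x] fun _ => 1 := by
            filter_upwards [Ioi_mem_nhds hx] with y hy
            exact Real.smoothTransition.one_of_one_le (le_of_lt hy)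
          rw [this.fderiv_eq]; simp
      · intro x
        rw [pow_zero, mul_one, Real.norm_of_nonneg (Real.smoothTransition.nonneg x)]
        exact Real.smoothTransition.le_one x
    exact Function.HasTemperateGrowth.comp h1
      (((n : ℝ) • ContinuousLinearMap.id ℝ ℝ).hasTemperateGrowth)
  nonneg t := Real.smoothTransition.nonneg _
  le_one t := Real.smoothTransition.le_one _
  zero t ht := Real.smoothTransition.zero_of_nonpos
    (mul_nonpos_of_nonneg_of_nonpos (Nat.cast_nonneg n) ht)

theorem eventually_cutoff_eq_one {t : ℝ} (ht : 0 < t) : ∀ᶠ n in Filter.atTop, cutoff n t = 1 := by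
  obtain ⟨N, hN⟩ := exists_nat_ge (1 / t)
  filter_upwards [Filter.eventually_ge_atTop N] with n hn
  refine Real.smoothTransition.one_of_one_le ?_
  have : (N : ℝ) ≤ n := by exact_mod_cast hn
  rw [div_le_iff₀ ht] at hN
  nlinarith

theorem evenSym_cutoff (n : ℕ) (θ ξ : R3) :
    ∃ r : ℝ, evenSym (cutoff n) θ ξ = r ∧ 0 ≤ r ∧ r ≤ 1 := by
  refine ⟨_, rfl, add_nonneg ((isCutoff_cutoff n).nonneg _) ((isCutoff_cutoff n).nonneg _), ?_⟩
  rcases le_total 0 (inner ℝ θ ξ) with h | h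
  · rw [(isCutoff_cutoff n).zero (-_) (by linarith), add_zero]
    exact (isCutoff_cutoff n).le_one _
  · rw [(isCutoff_cutoff n).zero _ h, zero_add]
    exact (isCutoff_cutoff n).le_one _

theorem norm_oddSym_cutoff_le (n : ℕ) (θ ξ : R3) : ‖oddSym (cutoff n) θ ξ‖ ≤ 1 := by
  rw [oddSym, norm_mul, norm_neg, Complex.norm_I, one_mul, Complex.norm_real, Real.norm_eq_abs,
    abs_le]
  have := (isCutoff_cutoff n).nonneg (inner ℝ θ ξ)
  have := (isCutoff_cutoff n).nonneg (-inner ℝ θ ξ)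
  have := (isCutoff_cutoff n).le_one (inner ℝ θ ξ)
  have := (isCutoff_cutoff n).le_one (-inner ℝ θ ξ)
  constructor <;> linarith

theorem ae_inner_ne_zero {θ : R3} (hθ : θ ≠ 0) : ∀ᵐ ξ : R3, inner ℝ θ ξ ≠ (0 : ℝ) := by
  have h := Measure.addHaar_submodule (volume : Measure R3) (LinearMap.ker (innerₗ R3 θ)) (by
    intro h
    have : θ ∈ LinearMap.ker (innerₗ R3 θ) := by rw [h]; trivial
    rw [LinearMap.mem_ker, innerₗ_apply_apply, inner_self_eq_zero] at this
    exact hθ this)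
  rw [ae_iff]
  convert! h using 2
  ext ξ
  simp

theorem tendsto_evenSym {θ ξ : R3} (h : inner ℝ θ ξ ≠ (0 : ℝ)) :
    Filter.Tendsto (fun n => evenSym (cutoff n) θ ξ) Filter.atTop (nhds 1) := by
  refine tendsto_const_nhds.congr' ?_
  rcases lt_or_gt_of_ne h with h | h
  · filter_upwards [eventually_cutoff_eq_one (neg_pos.2 h)] with n hn
    rw [evenSym, hn, (isCutoff_cutoff n).zero _ h.le]; simp
  · filter_upwards [eventually_cutoff_eq_one h] with n hn
    rw [evenSym, hn, (isCutoff_cutoff n).zero (-_) (by linarith)]; simp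

/-- The symbol `-i sgn(θ·ξ)` of the Hilbert transform in the direction `θ`. -/
noncomputable def hilbertSym (θ ξ : R3) : ℂ := -Complex.I * ((Real.sign (inner ℝ θ ξ) : ℝ) : ℂ)

theorem tendsto_oddSym {θ ξ : R3} (h : inner ℝ θ ξ ≠ (0 : ℝ)) :
    Filter.Tendsto (fun n => oddSym (cutoff n) θ ξ) Filter.atTop (nhds (hilbertSym θ ξ)) := by
  refine tendsto_const_nhds.congr' ?_
  rcases lt_or_gt_of_ne h with h | h
  · filter_upwards [eventually_cutoff_eq_one (neg_pos.2 h)] with n hn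
    rw [oddSym, hn, (isCutoff_cutoff n).zero _ h.le, hilbertSym, Real.sign_of_neg h]; simp
  · filter_upwards [eventually_cutoff_eq_one h] with n hn
    rw [oddSym, hn, (isCutoff_cutoff n).zero (-_) (by linarith), hilbertSym,
      Real.sign_of_pos h]; simp

theorem integrable_fourier_mul_fourierInv (f g : 𝓢(R3, ℝ)) :
    Integrable fun ξ => 𝓕 (fc f) ξ * 𝓕⁻ (fc g) ξ :=
  (𝓕⁻ (fc g)).integrable.bdd_mul (c := SchwartzMap.seminorm ℝ 0 0 (𝓕 (fc f)))
    (𝓕 (fc f)).continuous.aestronglyMeasurable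
    (Filter.Eventually.of_forall fun x => SchwartzMap.norm_le_seminorm ℝ (𝓕 (fc f)) x)

theorem tendsto_mform_oddSym {θ : R3} (hθ : θ ≠ 0) (f g : 𝓢(R3, ℝ)) :
    Filter.Tendsto (fun n => mform (oddSym (cutoff n) θ) f g) Filter.atTop
      (nhds (mform (hilbertSym θ) f g)) := by
  refine tendsto_integral_of_dominated_convergence (fun ξ => ‖𝓕 (fc f) ξ * 𝓕⁻ (fc g) ξ‖)
    (fun n => ?_) (integrable_fourier_mul_fourierInv f g).norm (fun n => ?_) ?_
  · have h1 := ((isCutoff_cutoff n).temperate_oddSym θ).1.continuous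
    exact ((h1.mul (𝓕 (fc f)).continuous).mul (𝓕⁻ (fc g)).continuous).aestronglyMeasurable
  · refine Filter.Eventually.of_forall fun ξ => ?_
    rw [mul_assoc, norm_mul]
    exact mul_le_of_le_one_left (norm_nonneg _) (norm_oddSym_cutoff_le n θ ξ)
  · filter_upwards [ae_inner_ne_zero hθ] with ξ hξ
    exact ((tendsto_oddSym hξ).mul_const _).mul_const _

theorem tendsto_integral_evenSym {θ : R3} (hθ : θ ≠ 0) (f : 𝓢(R3, ℝ)) :
    Filter.Tendsto (fun n => ∫ ξ, ‖evenSym (cutoff n) θ ξ * 𝓕 (fc f) ξ - 𝓕 (fc f) ξ‖)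
      Filter.atTop (nhds 0) := by
  have := tendsto_integral_of_dominated_convergence (μ := (volume : Measure R3))
    (F := fun n ξ => ‖evenSym (cutoff n) θ ξ * 𝓕 (fc f) ξ - 𝓕 (fc f) ξ‖) (f := fun _ => (0 : ℝ))
    (fun ξ => 2 * ‖𝓕 (fc f) ξ‖)
    (fun n => ?_) ((𝓕 (fc f)).integrable.norm.const_mul 2) (fun n => ?_) ?_
  · simpa using this
  · have h1 := ((isCutoff_cutoff n).temperate_evenSym θ).1.continuous
    exact ((h1.mul (𝓕 (fc f)).continuous).sub (𝓕 (fc f)).continuous).norm.aestronglyMeasurable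
  · refine Filter.Eventually.of_forall fun ξ => ?_
    obtain ⟨r, hr, h0, h1⟩ := evenSym_cutoff n θ ξ
    rw [norm_norm, hr]
    refine (norm_sub_le _ _).trans ?_
    rw [norm_mul, Complex.norm_real, Real.norm_of_nonneg h0]
    nlinarith [norm_nonneg (𝓕 (fc f) ξ)]
  · filter_upwards [ae_inner_ne_zero hθ] with ξ hξ
    have := (((tendsto_evenSym hξ).mul_const (𝓕 (fc f) ξ)).sub_const (𝓕 (fc f) ξ)).norm
    simpa using this

theorem integral_reMultiplier_sq_le (n : ℕ) (θ : R3) (f : 𝓢(R3, ℝ)) :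
    ∫ x, reMultiplier (evenSym (cutoff n) θ) f x ^ 2 ≤ ∫ x, f x ^ 2 := by
  have ht := (isCutoff_cutoff n).temperate_evenSym θ
  have h1 := SchwartzMap.integral_norm_sq_fourier (multiplier (evenSym (cutoff n) θ) f)
  have h2 := SchwartzMap.integral_norm_sq_fourier (fc f)
  have e1 : ∀ x, ‖multiplier (evenSym (cutoff n) θ) f x‖ ^ 2 =
      reMultiplier (evenSym (cutoff n) θ) f x ^ 2 := fun x => by
    rw [multiplier_eq_ofReal ht (evenSym_neg _ θ), Complex.norm_real, Real.norm_eq_abs, sq_abs]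
  have e2 : ∀ x, ‖fc f x‖ ^ 2 = f x ^ 2 := fun x => by simp
  simp_rw [e1] at h1
  simp_rw [e2] at h2
  rw [← h1, ← h2, multiplier, FourierTransform.fourier_fourierInv_eq]
  have hi : ∀ g : 𝓢(R3, ℂ), Integrable fun x => ‖g x‖ ^ 2 := fun g => by
    simpa using (integrable_schwartz_pow g (n := 2) (by norm_num)).norm
  refine integral_mono (hi _) (hi _) fun ξ => ?_
  obtain ⟨r, hr, h0, h1⟩ := evenSym_cutoff n θ ξ
  simp only
  rw [SchwartzMap.smulLeftCLM_apply_apply ht, hr, smul_eq_mul, norm_mul, Complex.norm_real,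
    Real.norm_of_nonneg h0]
  gcongr
  exact mul_le_of_le_one_left (norm_nonneg _) h1

/-- Reduces convergence of sixth powers to uniform convergence plus an `L²` bound: one factor of `a⁶
- b⁶` is small, the cubes are bounded by `M³`, and an integrable quadratic factor remains. -/
theorem abs_pow_six_sub_le {a b M ε : ℝ} (ha : |a| ≤ M) (hb : |b| ≤ M) (h : |a - b| ≤ ε) :
    |a ^ 6 - b ^ 6| ≤ ε * (6 * M ^ 3 * (a ^ 2 + b ^ 2)) := by
  have e : a ^ 6 - b ^ 6 = (a - b) * ((a ^ 3 + b ^ 3) * (a ^ 2 + a * b + b ^ 2)) := by ring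
  have hM : 0 ≤ M := (abs_nonneg _).trans ha
  have h1 : |a ^ 3 + b ^ 3| ≤ 2 * M ^ 3 := by
    refine (abs_add_le _ _).trans ?_
    rw [abs_pow, abs_pow, two_mul]
    gcongr
  have h2 : |a ^ 2 + a * b + b ^ 2| ≤ 2 * (a ^ 2 + b ^ 2) := by
    rw [abs_le]; constructor <;> nlinarith [sq_nonneg (a - b), sq_nonneg (a + b)]
  have h3 : 0 ≤ M ^ 3 * (a ^ 2 + b ^ 2) := by positivity
  rw [e, abs_mul, abs_mul]
  calc |a - b| * (|a ^ 3 + b ^ 3| * |a ^ 2 + a * b + b ^ 2|)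
      ≤ ε * ((2 * M ^ 3) * (2 * (a ^ 2 + b ^ 2))) := by
        have : 0 ≤ ε := (abs_nonneg _).trans h
        gcongr
    _ ≤ ε * (6 * M ^ 3 * (a ^ 2 + b ^ 2)) := by
        have : 0 ≤ ε := (abs_nonneg _).trans h
        gcongr ?_ * ?_
        linarith

/-- The even symbols lie in `[0,1]` and tend to `1` almost everywhere, so the transforms converge in
`L¹` and the functions uniformly. Plancherel controls the remaining square. -/
theorem tendsto_integral_pow_six {θ : R3} (hθ : θ ≠ 0) (f : 𝓢(R3, ℝ)) :
    Filter.Tendsto (fun n => ∫ x, reMultiplier (evenSym (cutoff n) θ) f x ^ 6) Filter.atTop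
      (nhds (∫ x, f x ^ 6)) := by
  set M := ∫ ξ, ‖𝓕 (fc f) ξ‖ with hM
  have hf : ∀ x, (f x : ℂ) = 𝓕⁻ (fun ξ => 𝓕 (fc f) ξ) x := fun x => by
    have : 𝓕⁻ (𝓕 (fc f)) x = fc f x := by rw [FourierTransform.fourierInv_fourier_eq]
    rw [SchwartzMap.fourierInv_coe] at this
    exact this.symm
  have hfM : ∀ x, |f x| ≤ M := fun x => by
    have := norm_fourierInv_le (fun ξ => 𝓕 (fc f) ξ) x
    rwa [← hf, Complex.norm_real] at this
  have ht := fun n => (isCutoff_cutoff n).temperate_evenSym θ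
  have ha : ∀ n x, (reMultiplier (evenSym (cutoff n) θ) f x : ℂ) =
      𝓕⁻ (fun ξ => evenSym (cutoff n) θ ξ * 𝓕 (fc f) ξ) x := fun n x => by
    rw [← multiplier_eq_ofReal (ht n) (evenSym_neg _ θ), multiplier_apply (ht n)]
  have hms : ∀ n ξ, ‖evenSym (cutoff n) θ ξ‖ ≤ 1 := fun n ξ => by
    obtain ⟨r, hr, h0, h1⟩ := evenSym_cutoff n θ ξ
    rw [hr, Complex.norm_real, Real.norm_of_nonneg h0]; exact h1
  have hint : ∀ n, Integrable fun ξ => evenSym (cutoff n) θ ξ * 𝓕 (fc f) ξ := fun n =>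
    integrable_mul_schwartz (ht n).1.continuous.measurable (hms n) _
  have haM : ∀ n x, |reMultiplier (evenSym (cutoff n) θ) f x| ≤ M := fun n x => by
    have := norm_fourierInv_le (fun ξ => evenSym (cutoff n) θ ξ * 𝓕 (fc f) ξ) x
    rw [← ha, Complex.norm_real] at this
    refine this.trans (integral_mono (hint n).norm (𝓕 (fc f)).integrable.norm fun ξ => ?_)
    simp only [norm_mul]
    exact mul_le_of_le_one_left (norm_nonneg _) (hms n ξ)
  have hd : ∀ n x, |reMultiplier (evenSym (cutoff n) θ) f x - f x| ≤
      ∫ ξ, ‖evenSym (cutoff n) θ ξ * 𝓕 (fc f) ξ - 𝓕 (fc f) ξ‖ := fun n x => by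
    have h1 := norm_fourierInv_le (fun ξ => evenSym (cutoff n) θ ξ * 𝓕 (fc f) ξ - 𝓕 (fc f) ξ) x
    have h2 : 𝓕⁻ (fun ξ => evenSym (cutoff n) θ ξ * 𝓕 (fc f) ξ - 𝓕 (fc f) ξ) x =
        ((reMultiplier (evenSym (cutoff n) θ) f x - f x : ℝ) : ℂ) := by
      have hi : ∀ h : R3 → ℂ, Integrable h → Integrable fun ξ : R3 =>
          Real.fourierChar (inner ℝ ξ x) • h ξ := fun h hh => by
        simpa using (Real.fourierIntegral_convergent_iff (-x)).2 hh
      rw [Complex.ofReal_sub, ha, hf]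
      simp only [Real.fourierInv_eq, smul_sub]
      exact integral_sub (hi _ (hint n)) (hi _ (𝓕 (fc f)).integrable)
    rwa [h2, Complex.norm_real] at h1
  rw [tendsto_iff_norm_sub_tendsto_zero]
  have h0 := (tendsto_integral_evenSym hθ f).mul_const
    (6 * M ^ 3 * ((∫ x, f x ^ 2) + ∫ x, f x ^ 2))
  rw [zero_mul] at h0
  refine squeeze_zero (fun n => norm_nonneg _) (fun n => ?_) h0
  have hi6 : ∀ g : 𝓢(R3, ℝ), Integrable fun x => g x ^ 6 := fun g =>
    integrable_real_schwartz_pow g (by norm_num)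
  have hi2 : ∀ g : 𝓢(R3, ℝ), Integrable fun x => g x ^ 2 := fun g =>
    integrable_real_schwartz_pow g (by norm_num)
  rw [← integral_sub (hi6 _) (hi6 _)]
  refine (norm_integral_le_integral_norm _).trans ?_
  refine (integral_mono ((hi6 _).sub (hi6 _)).norm
    ((((hi2 _).add (hi2 f)).const_mul (6 * M ^ 3)).const_mul _)
    fun x => abs_pow_six_sub_le (haM n x) (hfM x) (hd n x)).trans ?_
  simp only [Pi.add_apply]
  rw [integral_const_mul, integral_const_mul, integral_add (hi2 _) (hi2 _)]
  have : 0 ≤ M := integral_nonneg fun _ => norm_nonneg _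
  exact mul_le_mul_of_nonneg_left (mul_le_mul_of_nonneg_left
    (add_le_add_left (integral_reMultiplier_sq_le n θ f) _) (by positivity))
    (integral_nonneg fun _ => norm_nonneg _)

/-- As the cut-offs increase, the even multipliers tend to the identity and the odd ones to the
directional Hilbert transform, so the estimate between them passes to the limit. -/
theorem norm_mform_hilbertSym_le {q : ℝ} (hq : (6 : ℝ).HolderConjugate q) {θ : R3} (hθ : θ ≠ 0)
    (f g : 𝓢(R3, ℝ)) : ‖mform (hilbertSym θ) f g‖ ≤ 6 * nrm 6 f * nrm q g := by
  have h1 := (tendsto_mform_oddSym hθ f g).norm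
  have h2 : Filter.Tendsto (fun n => 6 * nrm 6 (reMultiplier (evenSym (cutoff n) θ) f) * nrm q g)
      Filter.atTop (nhds (6 * nrm 6 f * nrm q g)) := by
    simp_rw [nrm_six]
    exact (((tendsto_integral_pow_six hθ f).rpow_const (Or.inr (by norm_num))).const_mul
      6).mul_const _
  exact le_of_tendsto_of_tendsto' h1 h2 fun n =>
    norm_mform_oddSym_le hq _ (isCutoff_cutoff n) θ f g

/-! ### The Riesz transforms as averages of directional Hilbert transforms -/

theorem setIntegral_ball_comp_isometry (ρ : R3 ≃ₗᵢ[ℝ] R3) (h : R3 → ℝ) :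
    ∫ θ in Metric.ball (0 : R3) 1, h (ρ θ) = ∫ θ in Metric.ball (0 : R3) 1, h θ := by
  have := ρ.measurePreserving.setIntegral_preimage_emb
    ρ.toHomeomorph.measurableEmbedding h (Metric.ball (0 : R3) 1)
  rw [← this]
  congr 2
  ext θ
  simp

/-- `∫_{|θ|<1} ⟨θ,u⟩ sgn⟨θ,ξ⟩ dθ`. -/
noncomputable def signMoment (u ξ : R3) : ℝ :=
  ∫ θ in Metric.ball (0 : R3) 1, inner ℝ θ u * Real.sign (inner ℝ θ ξ)

theorem measurable_sign : Measurable Real.sign := by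
  unfold Real.sign
  exact Measurable.ite measurableSet_Iio measurable_const
    (Measurable.ite measurableSet_Ioi measurable_const measurable_const)

theorem abs_sign_le (t : ℝ) : |Real.sign t| ≤ 1 := by
  rcases Real.sign_apply_eq t with h | h | h <;> simp [h]

theorem integrableOn_signMoment (u ξ : R3) : IntegrableOn
    (fun θ : R3 => inner ℝ θ u * Real.sign (inner ℝ θ ξ)) (Metric.ball (0 : R3) 1) := by
  refine Integrable.mono' (g := fun _ => ‖u‖)
    (integrableOn_const measure_ball_lt_top.ne) ?_ ?_
  · have := measurable_sign.comp ((continuous_id.inner continuous_const :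
      Continuous fun θ : R3 => (inner ℝ θ ξ : ℝ)).measurable)
    exact ((continuous_id.inner continuous_const).measurable.mul this).aestronglyMeasurable
  · refine (ae_restrict_iff' measurableSet_ball).2 (Filter.Eventually.of_forall fun θ hθ => ?_)
    rw [mem_ball_zero_iff] at hθ
    rw [norm_mul]
    calc _ ≤ (‖θ‖ * ‖u‖) * 1 := by
          gcongr
          · exact norm_inner_le_norm θ u
          · exact abs_sign_le _
      _ ≤ 1 * ‖u‖ * 1 := by gcongr
      _ = ‖u‖ := by ring

theorem signMoment_add (u v ξ : R3) :
    signMoment (u + v) ξ = signMoment u ξ + signMoment v ξ := by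
  unfold signMoment
  rw [← integral_add (integrableOn_signMoment u ξ) (integrableOn_signMoment v ξ)]
  simp_rw [inner_add_right, add_mul]

theorem signMoment_smul (c : ℝ) (u ξ : R3) : signMoment (c • u) ξ = c * signMoment u ξ := by
  unfold signMoment
  rw [← integral_const_mul]
  simp_rw [inner_smul_right, mul_assoc]

theorem signMoment_isometry (ρ : R3 ≃ₗᵢ[ℝ] R3) (u ξ : R3) :
    signMoment (ρ u) (ρ ξ) = signMoment u ξ := by
  unfold signMoment
  rw [← setIntegral_ball_comp_isometry ρ]
  simp_rw [LinearIsometryEquiv.inner_map_map]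

/-- The reflection in the hyperplane `u^⊥` sends `u` to `-u`, fixes `ξ`, and preserves the moment,
which is therefore its own negative. -/
theorem signMoment_eq_zero {u ξ : R3} (h : inner ℝ u ξ = (0 : ℝ)) : signMoment u ξ = 0 := by
  have h1 := signMoment_isometry (ℝ ∙ u)ᗮ.reflection u ξ
  rw [Submodule.reflection_orthogonalComplement_singleton_eq_neg,
    Submodule.reflection_mem_subspace_eq_self
      ((Submodule.mem_orthogonal_singleton_iff_inner_right).2 h),
    ← neg_one_smul ℝ u, signMoment_smul] at h1
  linarith

/-- The constant `∫_{|θ|<1} |θ_1| dθ`. -/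
noncomputable def signConst : ℝ :=
  signMoment (EuclideanSpace.single 0 1) (EuclideanSpace.single 0 1)

theorem signConst_pos : 0 < signConst := by
  set e : R3 := EuclideanSpace.single 0 1
  have he : e ≠ 0 := by
    intro h
    have : e 0 = 0 := by rw [h]; rfl
    simp [e] at this
  have hpos : ∀ θ : R3, 0 ≤ inner ℝ θ e * Real.sign (inner ℝ θ e) := fun θ => by
    rw [mul_comm]; exact Real.sign_mul_nonneg _
  refine lt_of_le_of_ne (integral_nonneg hpos) fun h => ?_
  have h1 := (integral_eq_zero_iff_of_nonneg hpos (integrableOn_signMoment e e)).1 h.symm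
  have h2 : ∀ᵐ θ ∂(volume.restrict (Metric.ball (0 : R3) 1)), False := by
    filter_upwards [h1, ae_restrict_of_ae (ae_inner_ne_zero he)] with θ h1 h2
    rw [real_inner_comm] at h2
    have : inner ℝ θ e * Real.sign (inner ℝ θ e) = 0 := h1
    rcases mul_eq_zero.1 this with h3 | h3
    · exact h2 h3
    · exact h2 (Real.sign_eq_zero_iff.1 h3)
  rw [Filter.eventually_false_iff_eq_bot, ae_eq_bot, Measure.restrict_eq_zero] at h2
  exact (Metric.measure_ball_pos volume (0 : R3) one_pos).ne' h2

theorem sign_mul_of_pos {c : ℝ} (hc : 0 < c) (t : ℝ) : Real.sign (c * t) = Real.sign t := by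
  rcases lt_trichotomy t 0 with h | rfl | h
  · rw [Real.sign_of_neg h, Real.sign_of_neg (mul_neg_of_pos_of_neg hc h)]
  · simp
  · rw [Real.sign_of_pos h, Real.sign_of_pos (mul_pos hc h)]

/-- The moment is linear in `u` and rotation invariant, and vanishes for `u ⊥ ξ`. Only the component
of `u` along `ξ` survives, and rotating `ξ` to a basis vector identifies the constant. -/
theorem signMoment_eq (u ξ : R3) : signMoment u ξ = signConst * (inner ℝ u ξ / ‖ξ‖) := by
  rcases eq_or_ne ξ 0 with rfl | hξ
  · simp [signMoment]
  have hn : ‖ξ‖ ≠ 0 := norm_ne_zero_iff.2 hξ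
  have hpos : 0 < ‖ξ‖ := norm_pos_iff.2 hξ
  set e : R3 := EuclideanSpace.single 0 1
  have he : ‖e‖ = 1 := by simp [e]
  -- rotate `ξ` to a multiple of the first basis vector
  have h1 : signMoment ξ ξ = ‖ξ‖ * signConst := by
    have hr : (ℝ ∙ (ξ - ‖ξ‖ • e))ᗮ.reflection ξ = ‖ξ‖ • e :=
      Submodule.reflection_sub (by rw [norm_smul, he, mul_one, norm_norm])
    rw [← signMoment_isometry (ℝ ∙ (ξ - ‖ξ‖ • e))ᗮ.reflection ξ ξ, hr, signMoment_smul]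
    congr 1
    unfold signConst signMoment
    congr 1; ext θ
    rw [inner_smul_right, sign_mul_of_pos hpos]
  have h2 : u = (inner ℝ u ξ / ‖ξ‖ ^ 2) • ξ + (u - (inner ℝ u ξ / ‖ξ‖ ^ 2) • ξ) := by abel
  have h3 : inner ℝ (u - (inner ℝ u ξ / ‖ξ‖ ^ 2) • ξ) ξ = (0 : ℝ) := by
    rw [inner_sub_left, inner_smul_left, real_inner_self_eq_norm_sq]
    simp only [conj_trivial]
    field_simp
    ring
  conv_lhs => rw [h2]
  rw [signMoment_add, signMoment_smul, signMoment_eq_zero h3, h1]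
  field_simp
  ring

theorem norm_hilbertSym_le (θ ξ : R3) : ‖hilbertSym θ ξ‖ ≤ 1 := by
  rw [hilbertSym, norm_mul, norm_neg, Complex.norm_I, one_mul, Complex.norm_real]
  exact abs_sign_le _

/-- The method of rotations at the level of symbols. As `signConst` is positive, the identity can be
solved for the Riesz symbol. -/
theorem setIntegral_hilbertSym (j : Fin 3) (ξ : R3) :
    ∫ θ in Metric.ball (0 : R3) 1, ((θ j : ℝ) : ℂ) * hilbertSym θ ξ = -signConst * rsym j ξ := by
  have h := signMoment_eq (EuclideanSpace.single j 1) ξ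
  have e : ∀ θ : R3, ((θ j : ℝ) : ℂ) * hilbertSym θ ξ = -Complex.I *
      ((inner ℝ θ (EuclideanSpace.single j 1) * Real.sign (inner ℝ θ ξ) : ℝ) : ℂ) := fun θ => by
    simp [hilbertSym, EuclideanSpace.inner_single_right]; ring
  simp_rw [e]
  rw [integral_const_mul, integral_complex_ofReal]
  change -Complex.I * ((signMoment _ _ : ℝ) : ℂ) = _
  rw [h, rsym]
  simp [EuclideanSpace.inner_single_left]
  ring

theorem measurable_hilbertSym_uncurry :
    Measurable fun z : R3 × R3 => hilbertSym z.2 z.1 := by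
  unfold hilbertSym
  have h : Continuous fun z : R3 × R3 => (inner ℝ z.2 z.1 : ℝ) :=
    continuous_snd.inner continuous_fst
  exact measurable_const.mul (Complex.measurable_ofReal.comp (measurable_sign.comp h.measurable))

theorem signConst_mul_mform (j : Fin 3) (f g : 𝓢(R3, ℝ)) :
    (-signConst : ℂ) * mform (rsym j) f g =
      ∫ θ in Metric.ball (0 : R3) 1, ((θ j : ℝ) : ℂ) * mform (hilbertSym θ) f g := by
  unfold mform
  simp_rw [← integral_const_mul, ← mul_assoc, ← setIntegral_hilbertSym, ← integral_mul_const]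
  have : IsFiniteMeasure ((volume : Measure R3).restrict (Metric.ball (0 : R3) 1)) :=
    ⟨by rw [Measure.restrict_apply_univ]; exact measure_ball_lt_top⟩
  refine integral_integral_swap ?_
  refine Integrable.mono' (g := fun z => (fun ξ => ‖𝓕 (fc f) ξ * 𝓕⁻ (fc g) ξ‖) z.1 * 1) ?_ ?_ ?_
  · have hi := (integrable_fourier_mul_fourierInv f g).norm
    generalize (fun ξ => ‖𝓕 (fc f) ξ * 𝓕⁻ (fc g) ξ‖) = F at hi ⊢
    exact Integrable.mul_prod hi (integrable_const (1 : ℝ))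
  · have h1 : Measurable fun z : R3 × R3 => hilbertSym z.2 z.1 :=
      measurable_hilbertSym_uncurry
    have h2 : Measurable fun z : R3 × R3 => ((z.2 j : ℝ) : ℂ) :=
      (Complex.measurable_ofReal.comp (measurable_coord j)).comp
        (measurable_snd : Measurable (Prod.snd : R3 × R3 → R3))
    have h3 : Measurable fun z : R3 × R3 => 𝓕 (fc f) z.1 :=
      (𝓕 (fc f)).continuous.measurable.comp measurable_fst
    have h4 : Measurable fun z : R3 × R3 => 𝓕⁻ (fc g) z.1 :=
      (𝓕⁻ (fc g)).continuous.measurable.comp measurable_fst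
    exact (((h2.mul h1).mul h3).mul h4).aestronglyMeasurable
  · have : ∀ᵐ z : R3 × R3 ∂((volume : Measure R3).prod
        (volume.restrict (Metric.ball (0 : R3) 1))), z.2 ∈ Metric.ball (0 : R3) 1 :=
      Measure.quasiMeasurePreserving_snd.ae (ae_restrict_mem measurableSet_ball)
    filter_upwards [this] with z hz
    rw [mem_ball_zero_iff] at hz
    simp only [Function.uncurry, norm_mul, Complex.norm_real, Real.norm_eq_abs]
    have h1 := (abs_coord_le z.2 j).trans hz.le
    have h2 := norm_hilbertSym_le z.2 z.1
    calc _ ≤ 1 * 1 * ‖𝓕 (fc f) z.1‖ * ‖𝓕⁻ (fc g) z.1‖ := by gcongr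
      _ = _ := by ring

/-- `L^6 × L^{6/5}` boundedness of the form of a Riesz transform. -/
theorem exists_norm_mform_rsym_le_six {q : ℝ} (hq : (6 : ℝ).HolderConjugate q) (j : Fin 3) :
    ∃ C, 0 ≤ C ∧ ∀ f g : 𝓢(R3, ℝ), ‖mform (rsym j) f g‖ ≤ C * nrm 6 f * nrm q g := by
  set A := (volume : Measure R3).real (Metric.ball (0 : R3) 1)
  -- `6` bounds each directional form, `A` is the volume of the ball over which `θ` ranges (with
  -- `|θ_j| ≤ 1` there), and `signConst` comes from solving the averaging identity.
  refine ⟨6 * A / signConst, by have := signConst_pos; positivity, fun f g => ?_⟩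
  have h0 := signConst_pos
  have h1 : ‖(-signConst : ℂ) * mform (rsym j) f g‖ ≤ (6 * nrm 6 f * nrm q g) * A := by
    rw [signConst_mul_mform]
    refine norm_setIntegral_le_of_norm_le_const_ae (by simp) ?_
    have h2 : ∀ᵐ θ : R3, θ ≠ 0 := by
      simp [ae_iff]
    filter_upwards [ae_restrict_of_ae h2, ae_restrict_mem measurableSet_ball] with θ hθ hb
    rw [mem_ball_zero_iff] at hb
    rw [norm_mul, Complex.norm_real]
    calc _ ≤ 1 * (6 * nrm 6 f * nrm q g) := by
          gcongr
          · exact (abs_coord_le θ j).trans hb.le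
          · exact norm_mform_hilbertSym_le hq hθ f g
      _ = _ := one_mul _
  rw [norm_mul, norm_neg, Complex.norm_real, Real.norm_of_nonneg h0.le] at h1
  rw [div_mul_eq_mul_div, div_mul_eq_mul_div, le_div_iff₀ h0]
  linarith

/-! ### Schur's test with power weights -/

/-- The smooth substitute `⟨x⟩ = (1 + |x|²)^(1/2)` of `1 + |x|`. -/
noncomputable def jb (x : R3) : ℝ := √(1 + ‖x‖ ^ 2)

theorem one_le_jb (x : R3) : 1 ≤ jb x := by
  rw [jb, Real.one_le_sqrt]
  nlinarith [sq_nonneg ‖x‖]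

theorem jb_pos (x : R3) : 0 < jb x := one_pos.trans_le (one_le_jb x)

theorem jb_sq (x : R3) : jb x ^ 2 = 1 + ‖x‖ ^ 2 := Real.sq_sqrt (by positivity)

theorem norm_le_jb (x : R3) : ‖x‖ ≤ jb x := by
  refine Real.le_sqrt_of_sq_le ?_
  linarith

theorem jb_le_add (x y : R3) : jb x ≤ jb y + ‖x - y‖ := by
  refine Real.sqrt_le_iff.2 ⟨by have := jb_pos y; positivity, ?_⟩
  have h1 : ‖x‖ ≤ ‖y‖ + ‖x - y‖ := by
    simpa using norm_add_le y (x - y)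
  have h2 := norm_le_jb y
  have h3 := jb_sq y
  nlinarith [norm_nonneg x, norm_nonneg y, norm_nonneg (x - y)]

theorem continuous_jb : Continuous jb := by
  unfold jb; fun_prop

theorem measurable_jb : Measurable jb := continuous_jb.measurable

/-- Schur's test. -/
theorem lintegral_kernel_le {p q : ℝ} (hpq : p.HolderConjugate q) {L B : R3 × R3 → ℝ}
    (hL : Measurable L) (hL0 : ∀ z, 0 ≤ L z) (hB : Measurable B) (hB0 : ∀ z, 0 < B z)
    {C₁ C₂ : ℝ≥0∞}
    (h₁ : ∀ y, ∫⁻ x, ENNReal.ofReal (L (x, y) * B (x, y) ^ p) ≤ C₁)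
    (h₂ : ∀ x, ∫⁻ y, ENNReal.ofReal (L (x, y) * (B (x, y))⁻¹ ^ q) ≤ C₂)
    {F G : R3 → ℝ} (hF : Measurable F) (hG : Measurable G) :
    ∫⁻ x, ∫⁻ y, ENNReal.ofReal (L (x, y) * |F y| * |G x|) ≤
      C₁ ^ (1 / p) * C₂ ^ (1 / q) * (∫⁻ x, ENNReal.ofReal (|F x| ^ p)) ^ (1 / p) *
        (∫⁻ x, ENNReal.ofReal (|G x| ^ q)) ^ (1 / q) := by
  have hp := hpq.pos
  have hq := hpq.symm.pos
  have hF2 : Measurable fun z : R3 × R3 => F z.2 := hF.comp measurable_snd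
  have hG1 : Measurable fun z : R3 × R3 => G z.1 := hG.comp measurable_fst
  -- Since `1/p + 1/q = 1`, the integrand factors as `(L^{1/p} B |F|) (L^{1/q} B⁻¹ |G|)`. Hölder on
  -- the product space then leaves `L B^p` and `L B^{-q}`, which are the kernels that `h₁` and `h₂`
  -- integrate.
  set u : R3 × R3 → ℝ≥0∞ := fun z => ENNReal.ofReal (L z ^ (1 / p) * B z * |F z.2|) with hu
  set w : R3 × R3 → ℝ≥0∞ := fun z => ENNReal.ofReal (L z ^ (1 / q) * (B z)⁻¹ * |G z.1|) with hw
  have hum : Measurable u := by fun_prop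
  have hwm : Measurable w := by fun_prop
  have e0 : ∀ z : R3 × R3, ENNReal.ofReal (L z * |F z.2| * |G z.1|) = (u * w) z := by
    intro z
    have := hL0 z
    have hb := (hB0 z).ne'
    rw [Pi.mul_apply, hu, hw, ← ENNReal.ofReal_mul
      (by have := (hB0 z).le; positivity)]
    congr 1
    have : L z = L z ^ (1 / p) * L z ^ (1 / q) := by
      rcases this.eq_or_lt with h | h
      · rw [← h, Real.zero_rpow (by positivity), zero_mul]
      · rw [← Real.rpow_add h, one_div, one_div, hpq.inv_add_inv_eq_one, Real.rpow_one]
    conv_lhs => rw [this]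
    field_simp
  have hLF : Measurable fun z : R3 × R3 => ENNReal.ofReal (L z * |F z.2| * |G z.1|) := by fun_prop
  have eu : ∀ z, u z ^ p = ENNReal.ofReal (L z * B z ^ p) * ENNReal.ofReal (|F z.2| ^ p) := by
    intro z
    have := hL0 z
    have := (hB0 z).le
    rw [hu, ENNReal.ofReal_rpow_of_nonneg (by positivity) hp.le,
      Real.mul_rpow (by positivity) (by positivity), Real.mul_rpow (by positivity) (by positivity),
      ← Real.rpow_mul (by positivity), one_div_mul_cancel hp.ne', Real.rpow_one,
      ENNReal.ofReal_mul (by positivity)]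
  have ew : ∀ z, w z ^ q = ENNReal.ofReal (L z * (B z)⁻¹ ^ q) * ENNReal.ofReal (|G z.1| ^ q) := by
    intro z
    have := hL0 z
    have := (hB0 z).le
    rw [hw, ENNReal.ofReal_rpow_of_nonneg (by positivity) hq.le,
      Real.mul_rpow (by positivity) (by positivity), Real.mul_rpow (by positivity) (by positivity),
      ← Real.rpow_mul (by positivity), one_div_mul_cancel hq.ne', Real.rpow_one,
      ENNReal.ofReal_mul (by positivity)]
  rw [← lintegral_prod (μ := (volume : Measure R3)) (ν := (volume : Measure R3))
    (fun z : R3 × R3 => ENNReal.ofReal (L z * |F z.2| * |G z.1|)) hLF.aemeasurable]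
  simp_rw [e0]
  refine (ENNReal.lintegral_mul_le_Lp_mul_Lq _ hpq hum.aemeasurable hwm.aemeasurable).trans ?_
  simp_rw [eu, ew]
  have i1 : ∫⁻ z, ENNReal.ofReal (L z * B z ^ p) * ENNReal.ofReal (|F z.2| ^ p)
      ∂((volume : Measure R3).prod volume) ≤ C₁ * ∫⁻ x, ENNReal.ofReal (|F x| ^ p) := by
    rw [lintegral_prod_symm _ (by fun_prop), ← lintegral_const_mul _ (by fun_prop)]
    refine lintegral_mono fun y => ?_
    simp only
    rw [lintegral_mul_const _ (by fun_prop)]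
    gcongr
    exact h₁ y
  have i2 : ∫⁻ z, ENNReal.ofReal (L z * (B z)⁻¹ ^ q) * ENNReal.ofReal (|G z.1| ^ q)
      ∂((volume : Measure R3).prod volume) ≤ C₂ * ∫⁻ x, ENNReal.ofReal (|G x| ^ q) := by
    rw [lintegral_prod _ (by fun_prop), ← lintegral_const_mul _ (by fun_prop)]
    refine lintegral_mono fun x => ?_
    simp only
    rw [lintegral_mul_const _ (by fun_prop)]
    gcongr
    exact h₂ x
  calc _ ≤ (C₁ * ∫⁻ x, ENNReal.ofReal (|F x| ^ p)) ^ (1 / p) *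
        (C₂ * ∫⁻ x, ENNReal.ofReal (|G x| ^ q)) ^ (1 / q) := by gcongr
    _ = _ := by
      rw [ENNReal.mul_rpow_of_nonneg _ _ (by positivity),
        ENNReal.mul_rpow_of_nonneg _ _ (by positivity)]
      ring

/-! ### Radial integrals -/

theorem lintegral_fun_norm {f : ℝ → ℝ} (hf0 : ∀ r, 0 ≤ r → 0 ≤ f r)
    (hf : IntegrableOn (fun r => r ^ 2 * f r) (Ioi 0)) :
    ∫⁻ x : R3, ENNReal.ofReal (f ‖x‖) = ENNReal.ofReal
      (3 * (volume : Measure R3).real (Metric.ball 0 1) * ∫ r in Ioi (0 : ℝ), r ^ 2 * f r) := by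
  have hd : Module.finrank ℝ R3 = 3 := by simp
  have hi : Integrable (fun x : R3 => f ‖x‖) := by
    rw [integrable_fun_norm_addHaar, hd]
    simpa using hf
  rw [← ofReal_integral_eq_lintegral_ofReal hi (Filter.Eventually.of_forall fun x => hf0 _ (norm_nonneg x)),
    integral_fun_norm_addHaar, hd]
  simp [mul_assoc]

/-- The constant `|S²|`. -/
noncomputable def sphereConst : ℝ := 3 * (volume : Measure R3).real (Metric.ball 0 1)

theorem sphereConst_nonneg : 0 ≤ sphereConst := by unfold sphereConst; positivity

theorem lintegral_norm_rpow_ball {σ A : ℝ} (hσ : σ < 3) (hA : 0 < A) :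
    ∫⁻ x : R3, ENNReal.ofReal (if ‖x‖ ≤ A then ‖x‖ ^ (-σ) else 0) ≤
      ENNReal.ofReal (sphereConst * (A ^ (3 - σ) / (3 - σ))) := by
  have e : ∀ r ∈ Ioi (0 : ℝ), (Ioc 0 A).indicator (fun r : ℝ => r ^ (2 - σ)) r =
      r ^ 2 * (if r ≤ A then r ^ (-σ) else 0) := by
    intro r hr
    by_cases h : r ≤ A
    · rw [indicator_of_mem (show r ∈ Ioc 0 A from ⟨hr, h⟩), if_pos h, sub_eq_add_neg,
        Real.rpow_add hr]
      norm_num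
    · rw [indicator_of_notMem (by simp [h]), if_neg h, mul_zero]
  have hi : IntegrableOn (fun r : ℝ => r ^ (2 - σ)) (Ioc 0 A) := by
    rw [← intervalIntegrable_iff_integrableOn_Ioc_of_le hA.le]
    exact intervalIntegral.intervalIntegrable_rpow' (by linarith)
  have hI : IntegrableOn ((Ioc 0 A).indicator (fun r : ℝ => r ^ (2 - σ))) (Ioi 0) :=
    ((integrable_indicator_iff measurableSet_Ioc).2 hi).integrableOn
  rw [lintegral_fun_norm (f := fun r => if r ≤ A then r ^ (-σ) else 0)]
  · refine ENNReal.ofReal_le_ofReal ?_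
    rw [← setIntegral_congr_fun measurableSet_Ioi e, setIntegral_indicator measurableSet_Ioc,
      inter_eq_self_of_subset_right Ioc_subset_Ioi_self, ← intervalIntegral.integral_of_le hA.le,
      integral_rpow (Or.inl (by linarith)), Real.zero_rpow (by linarith), sphereConst]
    apply le_of_eq
    ring_nf
  · intro r hr
    positivity
  · exact hI.congr_fun e measurableSet_Ioi

theorem lintegral_norm_rpow_compl_ball {σ A : ℝ} (hσ : 0 < σ) (hA : 0 < A) :
    ∫⁻ x : R3, ENNReal.ofReal (if ‖x‖ ≤ A then 0 else ‖x‖ ^ (-3 - σ)) ≤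
      ENNReal.ofReal (sphereConst * (A ^ (-σ) / σ)) := by
  have e : ∀ r ∈ Ioi (0 : ℝ), (Ioi A).indicator (fun r : ℝ => r ^ (-1 - σ)) r =
      r ^ 2 * (if r ≤ A then 0 else r ^ (-3 - σ)) := by
    intro r hr
    by_cases h : r ≤ A
    · rw [indicator_of_notMem (by simp [h]), if_pos h, mul_zero]
    · rw [indicator_of_mem (by simpa using h), if_neg h, ← Real.rpow_natCast, ← Real.rpow_add hr]
      congr 1; push_cast; ring
  have hi : IntegrableOn (fun r : ℝ => r ^ (-1 - σ)) (Ioi A) :=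
    integrableOn_Ioi_rpow_of_lt (by linarith) hA
  have hI : IntegrableOn ((Ioi A).indicator (fun r : ℝ => r ^ (-1 - σ))) (Ioi 0) :=
    ((integrable_indicator_iff measurableSet_Ioi).2 hi).integrableOn
  rw [lintegral_fun_norm (f := fun r => if r ≤ A then 0 else r ^ (-3 - σ))]
  · refine ENNReal.ofReal_le_ofReal ?_
    rw [← setIntegral_congr_fun measurableSet_Ioi e, setIntegral_indicator measurableSet_Ioi,
      inter_eq_self_of_subset_right (Ioi_subset_Ioi hA.le),
      integral_Ioi_rpow_of_lt (by linarith) hA, sphereConst]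
    apply le_of_eq
    rw [show -1 - σ + 1 = -σ by ring, div_neg, neg_div, neg_neg]
  · intro r hr
    positivity
  · exact hI.congr_fun e measurableSet_Ioi

/-! ### The commutator kernel -/

/-- The kernel `|x-y|⁻³ |(⟨y⟩/⟨x⟩)^s - 1|` dominating the commutator of a Riesz transform with the
weight `⟨x⟩^(-s)`. -/
noncomputable def commKernel (s : ℝ) (z : R3 × R3) : ℝ :=
  (‖z.1 - z.2‖ ^ 3)⁻¹ * |(jb z.2 / jb z.1) ^ s - 1|

/-- The near-diagonal part of the bound of `commKernel`. -/
noncomputable def nearKernel (A : ℝ) (x : R3) : ℝ := if ‖x‖ ≤ A then ‖x‖ ^ (-2 : ℝ) / A else 0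

/-- The off-diagonal part of the bound of `commKernel`. -/
noncomputable def farKernel (z : R3 × R3) : ℝ := (max (jb z.1) (jb z.2) ^ 3)⁻¹

theorem exists_abs_rpow_sub_one_le (s : ℝ) :
    ∃ C, 0 ≤ C ∧ ∀ ρ ∈ Icc (1 / 2 : ℝ) 2, |ρ ^ s - 1| ≤ C * |ρ - 1| := by
  have hc : ContinuousOn (deriv fun ρ : ℝ => ρ ^ s) (Icc (1 / 2 : ℝ) 2) := by
    have : ContinuousOn (fun ρ : ℝ => s * ρ ^ (s - 1)) (Icc (1 / 2 : ℝ) 2) := fun x hx => by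
      have : x ≠ 0 := by have := hx.1; intro h; rw [h] at this; norm_num at this
      exact (continuousAt_const.mul
        (Real.continuousAt_rpow_const _ _ (Or.inl this))).continuousWithinAt
    refine this.congr fun x hx => ?_
    have : x ≠ 0 := by have := hx.1; intro h; rw [h] at this; norm_num at this
    exact (Real.hasDerivAt_rpow_const (Or.inl this)).deriv
  obtain ⟨C, hC⟩ := isCompact_Icc.exists_bound_of_continuousOn hc
  refine ⟨C, (norm_nonneg _).trans (hC 1 (by norm_num)), fun ρ hρ => ?_⟩
  have := Convex.norm_image_sub_le_of_norm_deriv_le (f := fun ρ : ℝ => ρ ^ s) (fun x hx => ?_) hC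
    (convex_Icc _ _) (show (1 : ℝ) ∈ Icc (1 / 2 : ℝ) 2 by norm_num) hρ
  · simpa using this
  · have : x ≠ 0 := by have := hx.1; intro h; rw [h] at this; norm_num at this
    exact (Real.hasDerivAt_rpow_const (Or.inl this)).differentiableAt

theorem nearKernel_nonneg {A : ℝ} (hA : 0 ≤ A) (x : R3) : 0 ≤ nearKernel A x := by
  unfold nearKernel; positivity

theorem farKernel_pos (z : R3 × R3) : 0 < farKernel z := by
  have := jb_pos z.1
  have : 0 < max (jb z.1) (jb z.2) := lt_max_of_lt_left this
  unfold farKernel; positivity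

/-- Near the diagonal `⟨y⟩/⟨x⟩` stays in `[1/2, 2]` and differs from `1` by at most `|x-y|/⟨x⟩`,
which lowers the singularity to `|x-y|^{-2}`. Away from it `|x-y|` is comparable to or larger than
`max ⟨x⟩ ⟨y⟩`, and the triangle inequality is enough. The near bound is given with either scale,
since Schur's test freezes each variable in turn. -/
theorem exists_commKernel_le {s : ℝ} :
    ∃ C, 0 ≤ C ∧ ∀ z : R3 × R3,
      (commKernel s z ≤ C * nearKernel (jb z.1) (z.1 - z.2) ∧
        commKernel s z ≤ C * nearKernel (jb z.2) (z.1 - z.2) ∧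
        jb z.1 ≤ 2 * jb z.2 ∧ jb z.2 ≤ 2 * jb z.1) ∨
      commKernel s z ≤ C * (farKernel z * (1 + (jb z.2 / jb z.1) ^ s)) := by
  obtain ⟨C, hC0, hC⟩ := exists_abs_rpow_sub_one_le s
  -- The `2` pays for replacing `⟨x⟩` by `⟨y⟩` in the near bound, and `27 = 3³` comes from `max ⟨x⟩
  -- ⟨y⟩ ≤ 3|x-y|` in the far region.
  refine ⟨2 * C + 27, by positivity, fun z => ?_⟩
  obtain ⟨x, y⟩ := z
  have hx := jb_pos x
  have hy := jb_pos y
  set d := ‖x - y‖ with hd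
  have hd0 : 0 ≤ d := norm_nonneg _
  have h1 : jb x ≤ jb y + d := jb_le_add x y
  have h2 : jb y ≤ jb x + d := by rw [hd, norm_sub_rev]; exact jb_le_add y x
  rcases le_or_gt d (jb y / 2) with h | h
  · left
    have hρ : jb y / jb x ∈ Icc (1 / 2 : ℝ) 2 := by
      constructor
      · rw [le_div_iff₀ hx]; linarith
      · rw [div_le_iff₀ hx]; linarith
    have h3 : |jb y / jb x - 1| ≤ d / jb x := by
      rw [div_sub_one hx.ne', abs_div, abs_of_pos hx]
      gcongr
      rw [abs_le]; constructor <;> linarith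
    have h4 : commKernel s (x, y) ≤ C * (d ^ (-2 : ℝ) / jb x) := by
      have h5 : commKernel s (x, y) ≤ (d ^ 3)⁻¹ * (C * (d / jb x)) := by
        unfold commKernel
        exact mul_le_mul_of_nonneg_left ((hC _ hρ).trans (mul_le_mul_of_nonneg_left h3 hC0))
          (by positivity)
      refine h5.trans (le_of_eq ?_)
      rw [show (-2 : ℝ) = ((-2 : ℤ) : ℝ) by norm_num, Real.rpow_intCast]
      rcases hd0.eq_or_lt with h6 | h6
      · rw [← h6]; simp
      · field_simp
    have h6 : 0 ≤ d ^ (-2 : ℝ) := by positivity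
    refine ⟨?_, ?_, ?_, ?_⟩
    · rw [nearKernel, if_pos (show ‖x - y‖ ≤ jb x by linarith)]
      refine h4.trans ?_
      gcongr
      linarith
    · rw [nearKernel, if_pos (show ‖x - y‖ ≤ jb y by linarith)]
      refine h4.trans ?_
      have : d ^ (-2 : ℝ) / jb x ≤ 2 * (d ^ (-2 : ℝ) / jb y) := by
        rw [← mul_div_assoc, div_le_div_iff₀ hx hy]
        nlinarith
      have h7 : 0 ≤ d ^ (-2 : ℝ) / jb y := by positivity
      calc _ ≤ C * (2 * (d ^ (-2 : ℝ) / jb y)) := by gcongr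
        _ ≤ (2 * C + 27) * (d ^ (-2 : ℝ) / jb y) := by nlinarith
    · change jb x ≤ 2 * jb y; linarith
    · change jb y ≤ 2 * jb x; linarith
  · right
    have hM : max (jb x) (jb y) ≤ 3 * d := max_le (by linarith) (by linarith)
    have hMp : 0 < max (jb x) (jb y) := lt_max_of_lt_left hx
    have hdp : 0 < d := by linarith
    have h3 : (d ^ 3)⁻¹ ≤ 27 * farKernel (x, y) := by
      unfold farKernel
      rw [inv_eq_one_div, div_le_iff₀ (by positivity), mul_assoc, mul_comm, mul_assoc,
        mul_comm, ← div_eq_mul_inv]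
      simp only
      rw [le_div_iff₀ (by positivity)]
      calc 1 * max (jb x) (jb y) ^ 3 ≤ 1 * (3 * d) ^ 3 := by gcongr
        _ = _ := by ring
    have h4 : |(jb y / jb x) ^ s - 1| ≤ 1 + (jb y / jb x) ^ s := by
      have : 0 ≤ (jb y / jb x) ^ s := by positivity
      rw [abs_le]; constructor <;> linarith
    have hf := farKernel_pos (x, y)
    have : 0 ≤ (jb y / jb x) ^ s := by positivity
    calc commKernel s (x, y) ≤ (27 * farKernel (x, y)) * (1 + (jb y / jb x) ^ s) := by
          unfold commKernel; gcongr
      _ = 27 * (farKernel (x, y) * (1 + (jb y / jb x) ^ s)) := by ring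
      _ ≤ _ := by gcongr; linarith

theorem lintegral_nearKernel_le {A : ℝ} (hA : 0 < A) :
    ∫⁻ x, ENNReal.ofReal (nearKernel A x) ≤ ENNReal.ofReal sphereConst := by
  have e : ∀ x : R3, ENNReal.ofReal (nearKernel A x) =
      ENNReal.ofReal A⁻¹ * ENNReal.ofReal (if ‖x‖ ≤ A then ‖x‖ ^ (-2 : ℝ) else 0) := fun x => by
    rw [← ENNReal.ofReal_mul (by positivity), nearKernel]
    congr 1
    split_ifs <;> ring
  simp_rw [e]
  rw [lintegral_const_mul' _ _ ENNReal.ofReal_ne_top]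
  refine (mul_le_mul_right (lintegral_norm_rpow_ball (by norm_num) hA) _).trans (le_of_eq ?_)
  rw [← ENNReal.ofReal_mul (by positivity)]
  congr 1
  norm_num
  field_simp

theorem lintegral_nearKernel_sub_left_le {A : ℝ} (hA : 0 < A) (x : R3) :
    ∫⁻ y, ENNReal.ofReal (nearKernel A (x - y)) ≤ ENNReal.ofReal sphereConst := by
  rw [lintegral_sub_left_eq_self (fun y => ENNReal.ofReal (nearKernel A y)) x]
  exact lintegral_nearKernel_le hA

theorem lintegral_nearKernel_sub_right_le {A : ℝ} (hA : 0 < A) (y : R3) :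
    ∫⁻ x, ENNReal.ofReal (nearKernel A (x - y)) ≤ ENNReal.ofReal sphereConst := by
  rw [lintegral_sub_right_eq_self (fun y => ENNReal.ofReal (nearKernel A y)) y]
  exact lintegral_nearKernel_le hA

/-- With `A = ⟨y⟩`, the integrand is at most `A^{t-3} |x|^{-t}` for `|x| ≤ A` and `A^t |x|^{-3-t}`
beyond. These are integrable because `t < 3` and `t > 0` respectively, and the powers of `A` cancel,
so the bound is uniform in `y`. -/
theorem lintegral_farKernel_le {t : ℝ} (ht0 : 0 < t) (ht : t < 3) (y : R3) :
    ∫⁻ x, ENNReal.ofReal (farKernel (x, y) * (jb y / jb x) ^ t) ≤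
      ENNReal.ofReal (sphereConst * (1 / (3 - t) + 1 / t)) := by
  have hA := jb_pos y
  set A := jb y
  have h1 : ∀ x : R3, x ≠ 0 → ENNReal.ofReal (farKernel (x, y) * (jb y / jb x) ^ t) ≤
      ENNReal.ofReal (A ^ (t - 3)) * ENNReal.ofReal (if ‖x‖ ≤ A then ‖x‖ ^ (-t) else 0) +
      ENNReal.ofReal (A ^ t) * ENNReal.ofReal (if ‖x‖ ≤ A then 0 else ‖x‖ ^ (-3 - t)) := by
    intro x hx0
    have hn : 0 < ‖x‖ := norm_pos_iff.2 hx0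
    have hx := jb_pos x
    have hnx := norm_le_jb x
    have e1 : (jb y / jb x) ^ t ≤ A ^ t * ‖x‖ ^ (-t) := by
      rw [Real.div_rpow hA.le hx.le, div_eq_mul_inv, ← Real.rpow_neg hx.le]
      exact mul_le_mul_of_nonneg_left (Real.rpow_le_rpow_of_nonpos hn hnx (by linarith))
        (by positivity)
    have hMp : 0 < max (jb x) A := lt_max_of_lt_left hx
    split_ifs with h
    · rw [ENNReal.ofReal_zero, mul_zero, add_zero, ← ENNReal.ofReal_mul (by positivity)]
      refine ENNReal.ofReal_le_ofReal ?_
      have e2 : farKernel (x, y) ≤ A ^ (-3 : ℝ) := by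
        rw [show (-3 : ℝ) = ((-3 : ℤ) : ℝ) by norm_num, Real.rpow_intCast, zpow_neg]
        unfold farKernel
        exact inv_anti₀ (by positivity) (by
          have : A ≤ max (jb x) A := le_max_right _ _
          exact_mod_cast pow_le_pow_left₀ hA.le this 3)
      calc _ ≤ A ^ (-3 : ℝ) * (A ^ t * ‖x‖ ^ (-t)) := by
            have := farKernel_pos (x, y)
            gcongr
        _ = _ := by
          rw [← mul_assoc, ← Real.rpow_add hA]; congr 2; ring
    · rw [ENNReal.ofReal_zero, mul_zero, zero_add, ← ENNReal.ofReal_mul (by positivity)]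
      refine ENNReal.ofReal_le_ofReal ?_
      have e2 : farKernel (x, y) ≤ ‖x‖ ^ (-3 : ℝ) := by
        rw [show (-3 : ℝ) = ((-3 : ℤ) : ℝ) by norm_num, Real.rpow_intCast, zpow_neg]
        unfold farKernel
        exact inv_anti₀ (by positivity) (by
          have : ‖x‖ ≤ max (jb x) A := hnx.trans (le_max_left _ _)
          exact_mod_cast pow_le_pow_left₀ hn.le this 3)
      calc _ ≤ ‖x‖ ^ (-3 : ℝ) * (A ^ t * ‖x‖ ^ (-t)) := by
            have := farKernel_pos (x, y)
            gcongr
        _ = A ^ t * (‖x‖ ^ (-3 : ℝ) * ‖x‖ ^ (-t)) := by ring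
        _ = _ := by
          rw [← Real.rpow_add hn]; congr 2
  have h2 : ∀ᵐ x : R3, x ≠ 0 := by simp [ae_iff]
  refine (lintegral_mono_ae (h2.mono h1)).trans ?_
  have hm : Measurable fun x : R3 => ‖x‖ := measurable_norm
  rw [lintegral_add_left (by
    exact (measurable_const.mul ((Measurable.ite (measurableSet_le hm measurable_const)
      (hm.pow_const _) measurable_const).ennreal_ofReal))),
    lintegral_const_mul' _ _ ENNReal.ofReal_ne_top, lintegral_const_mul' _ _ ENNReal.ofReal_ne_top]
  refine (add_le_add (mul_le_mul_right (lintegral_norm_rpow_ball ht hA) _)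
    (mul_le_mul_right (lintegral_norm_rpow_compl_ball ht0 hA) _)).trans (le_of_eq ?_)
  have hs := sphereConst_nonneg
  have h3t : 0 < 3 - t := by linarith
  rw [← ENNReal.ofReal_mul (by positivity), ← ENNReal.ofReal_mul (by positivity),
    ← ENNReal.ofReal_add (by positivity) (by positivity)]
  congr 1
  have e1 : A ^ (t - 3) * A ^ (3 - t) = 1 := by
    rw [← Real.rpow_add hA]; simp
  have e2 : A ^ t * A ^ (-t) = 1 := by
    rw [← Real.rpow_add hA]; simp
  calc _ = sphereConst * ((A ^ (t - 3) * A ^ (3 - t)) / (3 - t) + (A ^ t * A ^ (-t)) / t) := by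
        ring
    _ = _ := by rw [e1, e2]

theorem farKernel_swap (x y : R3) : farKernel (x, y) = farKernel (y, x) := by
  simp [farKernel, max_comm]

theorem measurable_commKernel (s : ℝ) : Measurable (commKernel s) := by
  have := measurable_jb
  unfold commKernel
  fun_prop

theorem measurable_farKernel : Measurable farKernel := by
  have h1 : Measurable fun z : R3 × R3 => jb z.1 := measurable_jb.comp measurable_fst
  have h2 : Measurable fun z : R3 × R3 => jb z.2 := measurable_jb.comp measurable_snd
  exact ((h1.max h2).pow_const 3).inv

theorem commKernel_nonneg (s : ℝ) (z : R3 × R3) : 0 ≤ commKernel s z := by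
  unfold commKernel; positivity

/-- In the far region the factor `1 + (⟨y⟩/⟨x⟩)^s` produces the two exponents `t` and `t + s`, both
of which must lie in `(0,3)`. -/
theorem exists_lintegral_commKernel_left_le {s t : ℝ} (ht : 0 < t) (hs : 0 ≤ s) (hst : t + s < 3) :
    ∃ C : ℝ≥0∞, C ≠ ⊤ ∧ ∀ y : R3,
      ∫⁻ x, ENNReal.ofReal (commKernel s (x, y) * (jb y / jb x) ^ t) ≤ C := by
  obtain ⟨C, hC0, hC⟩ := exists_commKernel_le (s := s)
  refine ⟨ENNReal.ofReal (C * 2 ^ t) * ENNReal.ofReal sphereConst + ENNReal.ofReal C *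
    (ENNReal.ofReal (sphereConst * (1 / (3 - t) + 1 / t)) +
      ENNReal.ofReal (sphereConst * (1 / (3 - (t + s)) + 1 / (t + s)))),
    by finiteness, fun y => ?_⟩
  have hy := jb_pos y
  have hpt : ∀ x : R3, ENNReal.ofReal (commKernel s (x, y) * (jb y / jb x) ^ t) ≤
      ENNReal.ofReal (C * 2 ^ t) * ENNReal.ofReal (nearKernel (jb y) (x - y)) +
      ENNReal.ofReal C * (ENNReal.ofReal (farKernel (x, y) * (jb y / jb x) ^ t) +
        ENNReal.ofReal (farKernel (x, y) * (jb y / jb x) ^ (t + s))) := fun x => by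
    have hx := jb_pos x
    have hn := nearKernel_nonneg hy.le (x - y)
    have hf := (farKernel_pos (x, y)).le
    have hρ : 0 < jb y / jb x := by positivity
    rw [← ENNReal.ofReal_add (by positivity) (by positivity), ← ENNReal.ofReal_mul (by positivity),
      ← ENNReal.ofReal_mul (by positivity), ← ENNReal.ofReal_add (by positivity) (by positivity)]
    refine ENNReal.ofReal_le_ofReal ?_
    rcases hC (x, y) with ⟨-, h, -, h2⟩ | h
    · have : (jb y / jb x) ^ t ≤ 2 ^ t :=
        Real.rpow_le_rpow hρ.le ((div_le_iff₀ hx).2 h2) ht.le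
      refine le_add_of_le_of_nonneg ?_ (by positivity)
      calc _ ≤ (C * nearKernel (jb y) (x - y)) * 2 ^ t := by gcongr
        _ = _ := by ring
    · refine le_add_of_nonneg_of_le (by positivity) ?_
      rw [Real.rpow_add hρ]
      calc _ ≤ (C * (farKernel (x, y) * (1 + (jb y / jb x) ^ s))) * (jb y / jb x) ^ t := by
            gcongr
        _ = _ := by ring
  refine (lintegral_mono hpt).trans ?_
  have m0 : Measurable fun x : R3 => farKernel (x, y) :=
    measurable_farKernel.comp (measurable_id.prodMk measurable_const)
  have m1 : ∀ r : ℝ, Measurable fun x : R3 =>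
      ENNReal.ofReal (farKernel (x, y) * (jb y / jb x) ^ r) := fun r => by
    have := measurable_jb
    fun_prop
  have m2 : Measurable fun x : R3 => ENNReal.ofReal C *
      (ENNReal.ofReal (farKernel (x, y) * (jb y / jb x) ^ t) +
        ENNReal.ofReal (farKernel (x, y) * (jb y / jb x) ^ (t + s))) :=
    ((m1 t).add (m1 (t + s))).const_mul _
  rw [lintegral_add_right _ m2,
    lintegral_const_mul' _ _ ENNReal.ofReal_ne_top, lintegral_const_mul' _ _ ENNReal.ofReal_ne_top,
    lintegral_add_left (m1 t)]
  gcongr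
  · exact lintegral_nearKernel_sub_right_le hy y
  · exact lintegral_farKernel_le ht (by linarith) y
  · exact lintegral_farKernel_le (by linarith) hst y

/-- Here the ratio is reversed, so the commutator factor produces the exponents `t` and `t - s`
instead; hence the condition `s < t`. -/
theorem exists_lintegral_commKernel_right_le {s t : ℝ} (hs : 0 ≤ s) (hst : s < t) (ht : t < 3) :
    ∃ C : ℝ≥0∞, C ≠ ⊤ ∧ ∀ x : R3,
      ∫⁻ y, ENNReal.ofReal (commKernel s (x, y) * (jb x / jb y) ^ t) ≤ C := by
  obtain ⟨C, hC0, hC⟩ := exists_commKernel_le (s := s)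
  have ht0 : 0 < t := by linarith
  refine ⟨ENNReal.ofReal (C * 2 ^ t) * ENNReal.ofReal sphereConst + ENNReal.ofReal C *
    (ENNReal.ofReal (sphereConst * (1 / (3 - t) + 1 / t)) +
      ENNReal.ofReal (sphereConst * (1 / (3 - (t - s)) + 1 / (t - s)))),
    by finiteness, fun x => ?_⟩
  have hx := jb_pos x
  have hpt : ∀ y : R3, ENNReal.ofReal (commKernel s (x, y) * (jb x / jb y) ^ t) ≤
      ENNReal.ofReal (C * 2 ^ t) * ENNReal.ofReal (nearKernel (jb x) (x - y)) +
      ENNReal.ofReal C * (ENNReal.ofReal (farKernel (y, x) * (jb x / jb y) ^ t) +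
        ENNReal.ofReal (farKernel (y, x) * (jb x / jb y) ^ (t - s))) := fun y => by
    have hy := jb_pos y
    have hn := nearKernel_nonneg hx.le (x - y)
    have hf := (farKernel_pos (y, x)).le
    have hρ : 0 < jb x / jb y := by positivity
    have hρ' : 0 < jb y / jb x := by positivity
    rw [← ENNReal.ofReal_add (by positivity) (by positivity), ← ENNReal.ofReal_mul (by positivity),
      ← ENNReal.ofReal_mul (by positivity), ← ENNReal.ofReal_add (by positivity) (by positivity)]
    refine ENNReal.ofReal_le_ofReal ?_
    rcases hC (x, y) with ⟨h, -, h2, -⟩ | h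
    · have : (jb x / jb y) ^ t ≤ 2 ^ t :=
        Real.rpow_le_rpow hρ.le ((div_le_iff₀ hy).2 h2) ht0.le
      refine le_add_of_le_of_nonneg ?_ (by positivity)
      calc _ ≤ (C * nearKernel (jb x) (x - y)) * 2 ^ t := by gcongr
        _ = _ := by ring
    · refine le_add_of_nonneg_of_le (by positivity) ?_
      have e : (jb x / jb y) ^ (t - s) = (jb x / jb y) ^ t * (jb y / jb x) ^ s := by
        rw [sub_eq_add_neg, Real.rpow_add hρ, Real.rpow_neg hρ.le, ← Real.inv_rpow hρ.le, inv_div]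
      rw [e]
      calc _ ≤ (C * (farKernel (x, y) * (1 + (jb y / jb x) ^ s))) * (jb x / jb y) ^ t := by
            gcongr
        _ = _ := by rw [farKernel_swap]; ring
  refine (lintegral_mono hpt).trans ?_
  have m0 : Measurable fun y : R3 => farKernel (y, x) :=
    measurable_farKernel.comp (measurable_id.prodMk measurable_const)
  have m1 : ∀ r : ℝ, Measurable fun y : R3 =>
      ENNReal.ofReal (farKernel (y, x) * (jb x / jb y) ^ r) := fun r => by
    have := measurable_jb
    fun_prop
  have m2 : Measurable fun y : R3 => ENNReal.ofReal C *
      (ENNReal.ofReal (farKernel (y, x) * (jb x / jb y) ^ t) +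
        ENNReal.ofReal (farKernel (y, x) * (jb x / jb y) ^ (t - s))) :=
    ((m1 t).add (m1 (t - s))).const_mul _
  rw [lintegral_add_right _ m2,
    lintegral_const_mul' _ _ ENNReal.ofReal_ne_top, lintegral_const_mul' _ _ ENNReal.ofReal_ne_top,
    lintegral_add_left (m1 t)]
  gcongr
  · exact lintegral_nearKernel_sub_left_le hx x
  · exact lintegral_farKernel_le ht0 ht x
  · exact lintegral_farKernel_le (by linarith) (by linarith) x

/-- The commutator kernel is bounded on `L^p`. -/
theorem exists_lintegral_commKernel_le {p q s α : ℝ} (hpq : p.HolderConjugate q) (hs : 0 ≤ s)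
    (h1 : α * p + s < 3) (h2 : s < α * q) (h3 : α * q < 3) :
    ∃ C : ℝ≥0∞, C ≠ ⊤ ∧ ∀ F G : R3 → ℝ, Measurable F → Measurable G →
      ∫⁻ x, ∫⁻ y, ENNReal.ofReal (commKernel s (x, y) * |F y| * |G x|) ≤
        C * (∫⁻ x, ENNReal.ofReal (|F x| ^ p)) ^ (1 / p) *
          (∫⁻ x, ENNReal.ofReal (|G x| ^ q)) ^ (1 / q) := by
  have hp := hpq.pos
  have hq := hpq.symm.pos
  have hα : 0 < α := by
    by_contra h
    have : α * q ≤ 0 := mul_nonpos_of_nonpos_of_nonneg (not_lt.1 h) hq.le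
    linarith
  obtain ⟨C₁, hC₁, H₁⟩ := exists_lintegral_commKernel_left_le (mul_pos hα hp) hs h1
  obtain ⟨C₂, hC₂, H₂⟩ := exists_lintegral_commKernel_right_le hs h2 h3
  refine ⟨C₁ ^ (1 / p) * C₂ ^ (1 / q), ?_, fun F G hF hG => ?_⟩
  · exact ENNReal.mul_ne_top (ENNReal.rpow_ne_top_of_nonneg (by positivity) hC₁)
      (ENNReal.rpow_ne_top_of_nonneg (by positivity) hC₂)
  · have hpos : ∀ z : R3 × R3, 0 < jb z.2 / jb z.1 := fun z => div_pos (jb_pos _) (jb_pos _)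
    -- With `B = (⟨y⟩/⟨x⟩)^α` the two Schur integrals have exponents `t = αp` and `t = αq`, which is
    -- where the three numerical hypotheses come from.
    refine lintegral_kernel_le hpq (L := commKernel s) (B := fun z => (jb z.2 / jb z.1) ^ α)
      (measurable_commKernel s) (commKernel_nonneg s) ?_
      (fun z => Real.rpow_pos_of_pos (hpos z) _) ?_ ?_ hF hG
    · have := measurable_jb
      fun_prop
    · intro y
      refine le_trans (le_of_eq ?_) (H₁ y)
      congr 1; ext x
      rw [← Real.rpow_mul (hpos (x, y)).le]
    · intro x
      refine le_trans (le_of_eq ?_) (H₂ x)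
      congr 1; ext y
      rw [← Real.inv_rpow (hpos (x, y)).le, inv_div, ← Real.rpow_mul (hpos (y, x)).le]

/-! ### The kernel of the Riesz transforms as a superposition of derivatives of heat kernels -/

theorem integral_fourier_mul {h k : R3 → ℂ} (hh : Integrable h) (hk : Integrable k) :
    ∫ x, 𝓕 h x * k x = ∫ ξ, h ξ * 𝓕 k ξ := by
  have h1 := VectorFourier.integral_bilin_fourierIntegral_eq_flip (μ := volume) (ν := volume)
    (ContinuousLinearMap.mul ℂ ℂ) (L := innerₗ R3)
    Real.continuous_fourierChar (by exact continuous_inner) hh hk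
  simp only [ContinuousLinearMap.mul_apply'] at h1
  convert! h1 using 4
  simp only [Real.fourier_eq, VectorFourier.fourierIntegral]
  congr 1; ext v
  simp [real_inner_comm]

theorem integrable_char_smul {h : R3 → ℂ} (hh : Integrable h) (x : R3) :
    Integrable fun ξ : R3 => Real.fourierChar (inner ℝ ξ x) • h ξ := by
  simpa using (Real.fourierIntegral_convergent_iff (-x)).2 hh

theorem fourierInv_mul_fourier {h : R3 → ℂ} (hh : Integrable h) (f : 𝓢(R3, ℂ)) (x : R3) :
    𝓕⁻ (fun ξ => h ξ * 𝓕 f ξ) x = ∫ y, 𝓕⁻ h (x - y) * f y := by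
  have h1 := integral_fourier_mul (integrable_char_smul hh x) f.integrable
  rw [← SchwartzMap.fourier_coe] at h1
  rw [Real.fourierInv_eq]
  simp_rw [smul_mul_assoc] at h1
  rw [← h1]
  congr 1; ext y
  congr 1
  rw [Real.fourier_eq, Real.fourierInv_eq]
  congr 1; ext ξ
  rw [smul_smul, ← AddChar.map_add_eq_mul, inner_sub_right, neg_add_eq_sub]

theorem integrable_mul_fourier {h : R3 → ℂ} (hh : Integrable h) (f : 𝓢(R3, ℂ)) :
    Integrable fun ξ => h ξ * 𝓕 f ξ :=
  hh.mul_bdd (𝓕 f).continuous.aestronglyMeasurable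
    (Filter.Eventually.of_forall fun x => SchwartzMap.norm_le_seminorm ℝ (𝓕 f) x)

theorem mform_eq_integral {h : R3 → ℂ} (hh : Integrable h) (f g : 𝓢(R3, ℝ)) :
    mform h f g = ∫ x, (∫ y, 𝓕⁻ h (x - y) * fc f y) * fc g x := by
  have h1 := integral_fourierInv_mul (integrable_mul_fourier hh (fc f)) (fc g).integrable
  rw [← SchwartzMap.fourierInv_coe] at h1
  rw [mform, ← h1]
  simp_rw [fourierInv_mul_fourier hh]

/-- The symbol `i ξ_j e^{-πτ|ξ|²}`. -/
noncomputable def heatSym (j : Fin 3) (τ : ℝ) (ξ : R3) : ℂ :=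
  Complex.I * (((ξ j * Real.exp (-(Real.pi * τ) * ‖ξ‖ ^ 2) : ℝ)) : ℂ)

/-- The kernel `-x_j τ^{-5/2} e^{-π|x|²/τ}` with Fourier transform `heatSym`. -/
noncomputable def heatKer (j : Fin 3) (τ : ℝ) (x : R3) : ℝ :=
  -(x j * (τ ^ (-5 / 2 : ℝ) * Real.exp (-(Real.pi / τ) * ‖x‖ ^ 2)))

theorem integrable_gaussian {b : ℝ} (hb : 0 < b) :
    Integrable fun ξ : R3 => Real.exp (-b * ‖ξ‖ ^ 2) := by
  have := GaussianFourier.integrable_cexp_neg_mul_sq_norm_add (V := R3) (b := b) (by simpa using hb)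
    0 0
  refine this.norm.congr (Filter.Eventually.of_forall fun ξ => ?_)
  simp [Complex.norm_exp, ← Complex.ofReal_pow]

theorem integrable_norm_mul_gaussian {b : ℝ} (hb : 0 < b) :
    Integrable fun ξ : R3 => ‖ξ‖ * Real.exp (-b * ‖ξ‖ ^ 2) := by
  refine ((integrable_gaussian (half_pos hb)).const_mul (1 + 2 / b)).mono'
    (by fun_prop) (Filter.Eventually.of_forall fun ξ => ?_)
  have h1 := Real.add_one_le_exp (b / 2 * ‖ξ‖ ^ 2)
  have h2 : ‖ξ‖ ≤ (1 + 2 / b) * (b / 2 * ‖ξ‖ ^ 2 + 1) := by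
    have : (1 + 2 / b) * (b / 2 * ‖ξ‖ ^ 2 + 1) = b / 2 * ‖ξ‖ ^ 2 + ‖ξ‖ ^ 2 + 1 + 2 / b := by
      field_simp; ring
    rw [this]
    have : 0 < 2 / b := by positivity
    have : 0 ≤ b / 2 * ‖ξ‖ ^ 2 := by positivity
    nlinarith [sq_nonneg (‖ξ‖ - 1)]
  rw [Real.norm_of_nonneg (by positivity)]
  calc _ ≤ ((1 + 2 / b) * Real.exp (b / 2 * ‖ξ‖ ^ 2)) * Real.exp (-b * ‖ξ‖ ^ 2) := by
        gcongr
        exact h2.trans (by gcongr)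
    _ = _ := by
        rw [mul_assoc, ← Real.exp_add]; congr 2; ring

/-- The `j`-th derivative of the transform of the Gaussian is computed twice: under the integral it
brings down `-2πi ξ_j`, and on the explicit Gaussian it brings down `-2π w_j/τ`. Comparing the two
and cancelling `-2πi` gives the formula. -/
theorem fourier_coord_mul_gaussian (j : Fin 3) {τ : ℝ} (hτ : 0 < τ) (w : R3) :
    𝓕 (fun ξ : R3 => ((ξ j * Real.exp (-(Real.pi * τ) * ‖ξ‖ ^ 2) : ℝ) : ℂ)) w =
      -Complex.I * ((w j * (τ ^ (-5 / 2 : ℝ) * Real.exp (-(Real.pi / τ) * ‖w‖ ^ 2)) : ℝ) : ℂ) := by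
  have hb : 0 < Real.pi * τ := by positivity
  set g : R3 → ℂ := fun ξ => Complex.exp (-((Real.pi * τ : ℝ) : ℂ) * (‖ξ‖ : ℂ) ^ 2) with hg
  have hge : ∀ ξ, g ξ = ((Real.exp (-(Real.pi * τ) * ‖ξ‖ ^ 2) : ℝ) : ℂ) := fun ξ => by
    simp [hg]
  have hgn : ∀ ξ, ‖g ξ‖ = Real.exp (-(Real.pi * τ) * ‖ξ‖ ^ 2) := fun ξ => by
    rw [hge, Complex.norm_real, Real.norm_of_nonneg (Real.exp_pos _).le]
  have hgi : Integrable g := by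
    refine (integrable_gaussian hb).ofReal.congr (Filter.Eventually.of_forall fun ξ => ?_)
    exact (hge ξ).symm
  have hgi' : Integrable fun ξ => ‖ξ‖ * ‖g ξ‖ := by
    simp_rw [hgn]; exact integrable_norm_mul_gaussian hb
  have hF : 𝓕 g = fun w => ((τ ^ (-3 / 2 : ℝ) * Real.exp (-(Real.pi / τ) * ‖w‖ ^ 2) : ℝ) : ℂ) := by
    ext w
    rw [hg, fourier_gaussian_innerProductSpace (by simpa using hb)]
    have e1 : ((Real.pi : ℂ) / ((Real.pi * τ : ℝ) : ℂ)) = ((τ⁻¹ : ℝ) : ℂ) := by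
      push_cast; field_simp
    have e2 : (-(Real.pi : ℂ) ^ 2 * (‖w‖ : ℂ) ^ 2 / ((Real.pi * τ : ℝ) : ℂ)) =
        ((-(Real.pi / τ) * ‖w‖ ^ 2 : ℝ) : ℂ) := by
      push_cast; field_simp
    have e3 : ((Module.finrank ℝ R3 : ℂ) / 2) = ((3 / 2 : ℝ) : ℂ) := by simp
    rw [e1, e2, e3, ← Complex.ofReal_cpow (by positivity), ← Complex.ofReal_exp,
      ← Complex.ofReal_mul]
    congr 2
    rw [Real.inv_rpow hτ.le, ← Real.rpow_neg hτ.le]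
    norm_num
  have hd := Real.hasFDerivAt_fourier hgi hgi' w
  have hreal : HasFDerivAt (fun w : R3 => (τ ^ (-3 / 2 : ℝ) *
      Real.exp (-(Real.pi / τ) * ‖w‖ ^ 2) : ℝ)) (τ ^ (-3 / 2 : ℝ) •
        (Real.exp (-(Real.pi / τ) * ‖w‖ ^ 2) • (-(Real.pi / τ)) • (2 • innerSL ℝ w))) w :=
    (((hasStrictFDerivAt_norm_sq w).hasFDerivAt.const_mul _).exp).const_mul _
  have hd2 := (Complex.ofRealCLM.hasFDerivAt.comp w hreal).unique (by rw [hF] at hd; exact hd)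
  have h3 := congrArg (fun A => A (EuclideanSpace.single j 1)) hd2
  have hint : Integrable (VectorFourier.fourierSMulRight (innerSL ℝ) g) := by
    refine (hgi'.const_mul (2 * Real.pi)).mono' hgi.1.fourierSMulRight
      (Filter.Eventually.of_forall fun ξ => ?_)
    rw [VectorFourier.norm_fourierSMulRight, innerSL_apply_norm, mul_assoc]
  rw [Real.fourier_continuousLinearMap_apply hint] at h3
  have e4 : (fun ξ => VectorFourier.fourierSMulRight (innerSL ℝ) g ξ (EuclideanSpace.single j 1)) =
      fun ξ => (-(2 * Real.pi * Complex.I)) •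
        (((ξ j * Real.exp (-(Real.pi * τ) * ‖ξ‖ ^ 2) : ℝ) : ℂ)) := by
    ext ξ
    rw [VectorFourier.fourierSMulRight_apply, hge]
    rw [innerSL_apply_apply, EuclideanSpace.inner_single_right]
    simp
  rw [e4, Real.fourier_eq] at h3
  simp_rw [smul_comm _ (-(2 * (Real.pi : ℂ) * Complex.I))] at h3
  rw [integral_smul, ← Real.fourier_eq] at h3
  have h5 : (((τ ^ (-3 / 2 : ℝ) * (Real.exp (-(Real.pi / τ) * ‖w‖ ^ 2) *
      (-(Real.pi / τ) * (2 * w j)))) : ℝ) : ℂ) = _ := Eq.trans ?_ h3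
  · have h6 : τ ^ (-3 / 2 : ℝ) / τ = τ ^ (-5 / 2 : ℝ) := by
      rw [← Real.rpow_sub_one hτ.ne']; norm_num
    have hne : -(2 * (Real.pi : ℂ) * Complex.I) ≠ 0 := by
      simp [Real.pi_ne_zero]
    rw [smul_eq_mul] at h5
    refine mul_left_cancel₀ hne (h5.symm.trans ?_)
    rw [← h6]
    push_cast
    field_simp
    ring_nf
    simp
  · simp [EuclideanSpace.inner_single_right]

theorem integrable_heatSym (j : Fin 3) {τ : ℝ} (hτ : 0 < τ) : Integrable (heatSym j τ) := by
  refine (integrable_norm_mul_gaussian (b := Real.pi * τ) (by positivity)).mono' ?_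
    (Filter.Eventually.of_forall fun ξ => ?_)
  · unfold heatSym
    have := continuous_coord j
    exact Continuous.aestronglyMeasurable (by fun_prop)
  · rw [heatSym, norm_mul, Complex.norm_I, one_mul, Complex.norm_real, norm_mul,
      Real.norm_of_nonneg (Real.exp_pos _).le]
    gcongr
    exact abs_coord_le _ _

theorem fourierInv_heatSym (j : Fin 3) {τ : ℝ} (hτ : 0 < τ) (x : R3) :
    𝓕⁻ (heatSym j τ) x = (heatKer j τ x : ℂ) := by
  have h1 := fourier_coord_mul_gaussian j hτ (-x)
  rw [Real.fourierInv_eq_fourier_neg, Real.fourier_eq]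
  unfold heatSym
  have e : ∀ (v : R3) (y : ℝ), Real.fourierChar (-inner ℝ v (-x)) • (Complex.I * (y : ℂ)) =
      Complex.I * (Real.fourierChar (-inner ℝ v (-x)) • (y : ℂ)) := fun v y => (mul_smul_comm _ _ _).symm
  simp_rw [e]
  rw [integral_const_mul, ← Real.fourier_eq, h1, heatKer]
  simp only [PiLp.neg_apply, norm_neg]
  push_cast
  ring_nf
  simp

/-- This is `Γ(1/2) = √π` after rescaling; the `π` in the exponent is there to cancel the constant.
-/
theorem integral_rpow_mul_gaussian {r : ℝ} (hr : 0 < r) :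
    ∫ τ in Ioi (0 : ℝ), τ ^ (-1 / 2 : ℝ) * Real.exp (-(Real.pi * τ) * r ^ 2) = 1 / r := by
  have h := Real.integral_rpow_mul_exp_neg_mul_Ioi (a := 1 / 2) (r := Real.pi * r ^ 2)
    (by norm_num) (by positivity)
  rw [Real.Gamma_one_half_eq, ← Real.sqrt_eq_rpow, ← Real.sqrt_mul (by positivity)] at h
  have e : 1 / (Real.pi * r ^ 2) * Real.pi = (1 / r) ^ 2 := by field_simp
  rw [e, Real.sqrt_sq (by positivity)] at h
  rw [← h]
  congr 1; ext τ
  congr 2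
  · norm_num
  · ring

theorem integrableOn_rpow_mul_gaussian {r : ℝ} (hr : 0 < r) :
    IntegrableOn (fun τ : ℝ => τ ^ (-1 / 2 : ℝ) * Real.exp (-(Real.pi * τ) * r ^ 2)) (Ioi 0) :=
  .of_integral_ne_zero (by rw [integral_rpow_mul_gaussian hr]; positivity)

theorem measurable_heatSym_uncurry (j : Fin 3) :
    Measurable fun z : ℝ × R3 => heatSym j z.1 z.2 := by
  unfold heatSym
  have := measurable_coord j
  fun_prop

/-- The symbol `i ξ_j / |ξ|` is the superposition `∫ τ^{-1/2} i ξ_j e^{-πτ|ξ|²} dτ`. -/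
theorem integrable_rpow_smul_heatSym (j : Fin 3) {φ : R3 → ℂ} (hφ : Integrable φ) :
    Integrable (fun z : ℝ × R3 => z.1 ^ (-1 / 2 : ℝ) • (heatSym j z.1 z.2 * φ z.2))
      ((volume.restrict (Ioi 0)).prod volume) := by
  have hmeas : AEStronglyMeasurable
      (fun z : ℝ × R3 => z.1 ^ (-1 / 2 : ℝ) • (heatSym j z.1 z.2 * φ z.2))
      ((volume.restrict (Ioi 0)).prod volume) := by
    refine AEStronglyMeasurable.smul (f := fun z : ℝ × R3 => z.1 ^ (-1 / 2 : ℝ))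
      (Measurable.aestronglyMeasurable (by fun_prop))
      ((measurable_heatSym_uncurry j).aestronglyMeasurable.mul ?_)
    exact hφ.1.comp_snd
  have hn : ∀ ξ : R3, ∀ τ ∈ Ioi (0 : ℝ), ‖τ ^ (-1 / 2 : ℝ) • (heatSym j τ ξ * φ ξ)‖ =
      |ξ j| * ‖φ ξ‖ * (τ ^ (-1 / 2 : ℝ) * Real.exp (-(Real.pi * τ) * ‖ξ‖ ^ 2)) := by
    intro ξ τ hτ
    rw [norm_smul, norm_mul, heatSym, norm_mul, Complex.norm_I, Complex.norm_real, norm_mul,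
      Real.norm_of_nonneg (Real.exp_pos _).le, Real.norm_of_nonneg
        (Real.rpow_nonneg (le_of_lt hτ) _), Real.norm_eq_abs]
    ring
  -- The `τ`-integral is taken first. It converges for `ξ ≠ 0`, and its value is at most `|φ(ξ)|
  -- |ξ_j|/|ξ| ≤ |φ(ξ)|`.
  refine (integrable_prod_iff' hmeas).2 ⟨?_, ?_⟩
  · have h0 : ∀ᵐ ξ : R3, ξ ≠ 0 := by simp [ae_iff]
    filter_upwards [h0] with ξ hξ
    have h1 := (integrableOn_rpow_mul_gaussian (norm_pos_iff.2 hξ)).const_mul (|ξ j| * ‖φ ξ‖)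
    refine h1.mono' ?_ ?_
    · have := (measurable_heatSym_uncurry j).comp (measurable_prodMk_right (y := ξ))
      refine Measurable.aestronglyMeasurable
        (Measurable.smul (f := fun τ : ℝ => τ ^ (-1 / 2 : ℝ)) (by fun_prop) ?_)
      exact Measurable.mul_const this _
    · filter_upwards [ae_restrict_mem measurableSet_Ioi] with τ hτ
      exact (hn ξ τ hτ).le
  · refine hφ.norm.mono' hmeas.norm.prod_swap.integral_prod_right'
      (Filter.Eventually.of_forall fun ξ => ?_)
    change ‖∫ τ in Ioi (0 : ℝ), ‖τ ^ (-1 / 2 : ℝ) • (heatSym j τ ξ * φ ξ)‖‖ ≤ _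
    rw [setIntegral_congr_fun measurableSet_Ioi (hn ξ), integral_const_mul]
    rcases eq_or_ne ξ 0 with rfl | hξ
    · simp
    · have hp := norm_pos_iff.2 hξ
      rw [integral_rpow_mul_gaussian hp, Real.norm_of_nonneg (by positivity)]
      have := abs_coord_le ξ j
      calc _ = ‖φ ξ‖ * (|ξ j| / ‖ξ‖) := by ring
        _ ≤ ‖φ ξ‖ * 1 := by gcongr; exact (div_le_one hp).2 this
        _ = _ := mul_one _

theorem integral_rpow_smul_heatSym (j : Fin 3) (ξ : R3) :
    ∫ τ in Ioi (0 : ℝ), τ ^ (-1 / 2 : ℝ) • heatSym j τ ξ = rsym j ξ := by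
  have e : ∀ τ : ℝ, τ ^ (-1 / 2 : ℝ) • heatSym j τ ξ = (Complex.I * (ξ j : ℂ)) *
      ((τ ^ (-1 / 2 : ℝ) * Real.exp (-(Real.pi * τ) * ‖ξ‖ ^ 2) : ℝ) : ℂ) := fun τ => by
    rw [heatSym, Complex.real_smul]; push_cast; ring
  simp_rw [e]
  rw [integral_const_mul, integral_complex_ofReal]
  rcases eq_or_ne ξ 0 with rfl | hξ
  · simp [rsym]
  · rw [integral_rpow_mul_gaussian (norm_pos_iff.2 hξ), rsym]
    push_cast
    ring

theorem integrableOn_rpow_smul_mform (j : Fin 3) (f g : 𝓢(R3, ℝ)) :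
    IntegrableOn (fun τ : ℝ => τ ^ (-1 / 2 : ℝ) • mform (heatSym j τ) f g) (Ioi 0) := by
  have h := (integrable_rpow_smul_heatSym j
    (integrable_fourier_mul_fourierInv f g)).integral_prod_left
  refine h.congr (Filter.Eventually.of_forall fun τ => ?_)
  simp only [mform, integral_smul, mul_assoc]

theorem mform_rsym_eq_integral (j : Fin 3) (f g : 𝓢(R3, ℝ)) :
    mform (rsym j) f g = ∫ τ in Ioi (0 : ℝ), τ ^ (-1 / 2 : ℝ) • mform (heatSym j τ) f g := by
  have hφ := integrable_fourier_mul_fourierInv f g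
  set φ : R3 → ℂ := fun ξ => 𝓕 (fc f) ξ * 𝓕⁻ (fc g) ξ
  have h := integral_integral_swap (f := fun (τ : ℝ) (ξ : R3) =>
    τ ^ (-1 / 2 : ℝ) • (heatSym j τ ξ * φ ξ)) (μ := volume.restrict (Ioi 0)) (ν := volume)
    (integrable_rpow_smul_heatSym j hφ)
  simp_rw [integral_smul, ← smul_mul_assoc, integral_mul_const, integral_rpow_smul_heatSym] at h
  simp only [mform, mul_assoc]
  rw [← h]

/-- The `τ`-integral is split at `τ = |z|²`, the natural parabolic scale, and each half contributes
at most `|z|^{-3}`. Below it, `e^{-X} ≤ 6/X³` with `X = π|z|²/τ` cancels `τ^{-3}`, and `6 ≤ π³`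
absorbs the constant. Above it, the exponential is dropped. -/
theorem lintegral_heatKer_le (j : Fin 3) (z : R3) :
    ∫⁻ τ in Ioi (0 : ℝ), ENNReal.ofReal (τ ^ (-1 / 2 : ℝ) * |heatKer j τ z|) ≤
      ENNReal.ofReal (2 * (‖z‖ ^ 3)⁻¹) := by
  rcases eq_or_ne z 0 with rfl | hz
  · simp [heatKer]
  have hr : 0 < ‖z‖ := norm_pos_iff.2 hz
  set r := ‖z‖ with hr'
  have hb : ∀ τ ∈ Ioi (0 : ℝ), τ ^ (-1 / 2 : ℝ) * |heatKer j τ z| ≤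
      r * (τ ^ (-3 : ℝ) * Real.exp (-(Real.pi * r ^ 2 / τ))) := by
    intro τ hτ
    have hτ0 : (0 : ℝ) < τ := hτ
    have e : τ ^ (-3 : ℝ) = τ ^ (-1 / 2 : ℝ) * τ ^ (-5 / 2 : ℝ) := by
      rw [← Real.rpow_add hτ0]; norm_num
    rw [heatKer, abs_neg, abs_mul, abs_of_nonneg (a := τ ^ (-5 / 2 : ℝ) * _) (by positivity), e]
    have h1 : |z j| ≤ r := abs_coord_le z j
    have h2 : -(Real.pi / τ) * ‖z‖ ^ 2 = -(Real.pi * r ^ 2 / τ) := by ring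
    rw [h2]
    calc _ = |z j| * (τ ^ (-1 / 2 : ℝ) * τ ^ (-5 / 2 : ℝ) * Real.exp (-(Real.pi * r ^ 2 / τ))) := by
          ring
      _ ≤ _ := by gcongr
  have hX : ∀ X : ℝ, 0 < X → Real.exp (-X) ≤ 6 / X ^ 3 := fun X hX => by
    have := Real.pow_div_factorial_le_exp X hX.le 3
    rw [Real.exp_neg, inv_le_comm₀ (Real.exp_pos _) (by positivity)]
    refine le_trans (le_of_eq ?_) this
    simp [Nat.factorial]
  have h1 : ∫⁻ τ in Ioc 0 (r ^ 2), ENNReal.ofReal (τ ^ (-1 / 2 : ℝ) * |heatKer j τ z|) ≤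
      ENNReal.ofReal ((r ^ 3)⁻¹) := by
    calc _ ≤ ∫⁻ τ in Ioc 0 (r ^ 2), ENNReal.ofReal ((r ^ 5)⁻¹) := by
          refine setLIntegral_mono' measurableSet_Ioc fun τ hτ => ENNReal.ofReal_le_ofReal ?_
          have hτ0 : 0 < τ := hτ.1
          refine (hb τ hτ0).trans ?_
          have h6 : (6 : ℝ) ≤ Real.pi ^ 3 := by
            nlinarith [Real.pi_gt_three, mul_pos Real.pi_pos Real.pi_pos]
          calc r * (τ ^ (-3 : ℝ) * Real.exp (-(Real.pi * r ^ 2 / τ)))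
              ≤ r * (τ ^ (-3 : ℝ) * (6 / (Real.pi * r ^ 2 / τ) ^ 3)) := by
                gcongr; exact hX _ (by positivity)
            _ = (r ^ 5)⁻¹ * (6 / Real.pi ^ 3) := by
                rw [Real.rpow_neg hτ0.le]; norm_cast; field_simp
            _ ≤ (r ^ 5)⁻¹ * 1 := by
                gcongr; exact (div_le_one (by positivity)).2 h6
            _ = _ := mul_one _
      _ = _ := by
          rw [setLIntegral_const, Real.volume_Ioc, ← ENNReal.ofReal_mul (by positivity)]
          congr 1; field_simp; ring
  have h2 : ∫⁻ τ in Ioi (r ^ 2), ENNReal.ofReal (τ ^ (-1 / 2 : ℝ) * |heatKer j τ z|) ≤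
      ENNReal.ofReal ((r ^ 3)⁻¹) := by
    have hi : IntegrableOn (fun τ : ℝ => r * τ ^ (-3 : ℝ)) (Ioi (r ^ 2)) :=
      (integrableOn_Ioi_rpow_of_lt (by norm_num) (by positivity)).const_mul r
    calc _ ≤ ∫⁻ τ in Ioi (r ^ 2), ENNReal.ofReal (r * τ ^ (-3 : ℝ)) := by
          refine setLIntegral_mono' measurableSet_Ioi fun τ hτ => ENNReal.ofReal_le_ofReal ?_
          have hτ0 : 0 < τ := lt_trans (by positivity : (0 : ℝ) < r ^ 2) hτ
          refine (hb τ hτ0).trans ?_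
          gcongr
          refine mul_le_of_le_one_right (by positivity) (Real.exp_le_one_iff.2 ?_)
          have : 0 < Real.pi * r ^ 2 / τ := by positivity
          linarith
      _ ≤ _ := by
          rw [← ofReal_integral_eq_lintegral_ofReal hi ?_, integral_const_mul,
            integral_Ioi_rpow_of_lt (by norm_num) (by positivity)]
          · refine ENNReal.ofReal_le_ofReal ?_
            have e : (r ^ 2) ^ ((-3 : ℝ) + 1) = (r ^ 4)⁻¹ := by
              rw [show (-3 : ℝ) + 1 = -(2 : ℕ) by norm_num, Real.rpow_neg (by positivity),
                Real.rpow_natCast]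
              ring
            rw [e]
            have : r * (-(r ^ 4)⁻¹ / (-3 + 1)) = (r ^ 3)⁻¹ / 2 := by field_simp; norm_num
            rw [this]
            exact half_le_self (by positivity)
          · filter_upwards [ae_restrict_mem measurableSet_Ioi] with τ hτ
            have hτ0 : 0 < τ := lt_trans (by positivity : (0 : ℝ) < r ^ 2) hτ
            simp only [Pi.zero_apply]
            positivity
  rw [← Ioc_union_Ioi_eq_Ioi (a := (0 : ℝ)) (b := r ^ 2) (by positivity)]
  refine (lintegral_union_le _ _ _).trans ((add_le_add h1 h2).trans (le_of_eq ?_))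
  rw [← ENNReal.ofReal_add (by positivity) (by positivity)]
  congr 1; ring

/-! ### Weighted bounds for the Riesz transforms of Schwartz functions -/

/-- Multiplication of a Schwartz function by `(1 + |x|²)^{r/2}`. -/
noncomputable def wmul (r : ℝ) (f : 𝓢(R3, ℝ)) : 𝓢(R3, ℝ) :=
  SchwartzMap.smulLeftCLM ℝ (fun x : R3 => (1 + ‖x‖ ^ 2) ^ (r / 2)) f

theorem wmul_apply (r : ℝ) (f : 𝓢(R3, ℝ)) (x : R3) : wmul r f x = jb x ^ r * f x := by
  rw [wmul, SchwartzMap.smulLeftCLM_apply_apply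
    (Function.hasTemperateGrowth_one_add_norm_sq_rpow R3 (r / 2)), smul_eq_mul, jb, Real.sqrt_eq_rpow,
    ← Real.rpow_mul (by positivity)]
  congr 2
  ring

theorem wmul_wmul_neg (r : ℝ) (f : 𝓢(R3, ℝ)) : wmul r (wmul (-r) f) = f := by
  ext x
  have := jb_pos x
  rw [wmul_apply, wmul_apply, ← mul_assoc, ← Real.rpow_add this]
  simp

theorem wmul_neg_wmul (r : ℝ) (f : 𝓢(R3, ℝ)) : wmul (-r) (wmul r f) = f := by
  simpa using wmul_wmul_neg (-r) f

theorem mform_heatSym (j : Fin 3) {τ : ℝ} (hτ : 0 < τ) (f g : 𝓢(R3, ℝ)) :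
    mform (heatSym j τ) f g = ∫ x, (∫ y, ((heatKer j τ (x - y) * f y * g x : ℝ) : ℂ)) := by
  rw [mform_eq_integral (integrable_heatSym j hτ)]
  congr 1; ext x
  rw [← integral_mul_const]
  congr 1; ext y
  rw [fourierInv_heatSym j hτ]
  push_cast
  rfl

theorem continuous_heatKer (j : Fin 3) (τ : ℝ) : Continuous (heatKer j τ) := by
  unfold heatKer
  have := continuous_coord j
  fun_prop

theorem exists_abs_heatKer_le (j : Fin 3) {τ : ℝ} (hτ : 0 < τ) : ∃ C, ∀ z, |heatKer j τ z| ≤ C := by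
  refine ⟨∫ ξ, ‖heatSym j τ ξ‖, fun z => ?_⟩
  have := norm_fourierInv_le (heatSym j τ) z
  rwa [fourierInv_heatSym j hτ, Complex.norm_real] at this

theorem integrable_heatKer_mul (j : Fin 3) {τ : ℝ} (hτ : 0 < τ) (f g : 𝓢(R3, ℝ)) :
    Integrable (fun z : R3 × R3 => ((heatKer j τ (z.1 - z.2) * f z.2 * g z.1 : ℝ) : ℂ))
      (volume.prod volume) := by
  obtain ⟨C, hC⟩ := exists_abs_heatKer_le j hτ
  have h1 : Integrable (fun z : R3 × R3 => g z.1 * f z.2) (volume.prod volume) :=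
    g.integrable.mul_prod f.integrable
  have h2 := h1.bdd_mul (f := fun z : R3 × R3 => heatKer j τ (z.1 - z.2)) (c := C)
    ((continuous_heatKer j τ).comp (by fun_prop : Continuous
      fun z : R3 × R3 => z.1 - z.2)).aestronglyMeasurable (Filter.Eventually.of_forall fun z => hC _)
  refine (h2.ofReal (𝕜 := ℂ)).congr (Filter.Eventually.of_forall fun z => ?_)
  simp only []
  rw [mul_comm (g z.1), ← mul_assoc]
  rfl

/-- For fixed `τ > 0` the kernel is bounded, so both forms are absolutely convergent double
integrals and can be subtracted pointwise. The difference of the weights gives the factor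
`(⟨y⟩/⟨x⟩)^s - 1`. -/
theorem enorm_mform_heatSym_sub_le (s : ℝ) (j : Fin 3) {τ : ℝ} (hτ : 0 < τ) (F G : 𝓢(R3, ℝ)) :
    ‖mform (heatSym j τ) (wmul s F) (wmul (-s) G) - mform (heatSym j τ) F G‖ₑ ≤
      ∫⁻ x, ∫⁻ y, ENNReal.ofReal (|heatKer j τ (x - y)| *
        (|(jb y / jb x) ^ s - 1| * |F y| * |G x|)) := by
  have h1 := integrable_heatKer_mul j hτ (wmul s F) (wmul (-s) G)
  have h2 := integrable_heatKer_mul j hτ F G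
  rw [mform_heatSym j hτ, mform_heatSym j hτ, ← integral_integral_sub' h1 h2]
  refine (enorm_integral_le_lintegral_enorm _).trans (lintegral_mono fun x => ?_)
  refine (enorm_integral_le_lintegral_enorm _).trans (lintegral_mono fun y => le_of_eq ?_)
  have hx := jb_pos x
  have hy := jb_pos y
  have e : ((heatKer j τ (x - y) * (wmul s F) y * (wmul (-s) G) x : ℝ) : ℂ) -
      ((heatKer j τ (x - y) * F y * G x : ℝ) : ℂ) =
      ((heatKer j τ (x - y) * (((jb y / jb x) ^ s - 1) * F y * G x) : ℝ) : ℂ) := by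
    rw [wmul_apply, wmul_apply, Real.div_rpow hy.le hx.le, Real.rpow_neg hx.le]
    push_cast
    ring
  simp only [Pi.sub_apply]
  rw [e, ← ofReal_norm, Complex.norm_real]
  simp only [norm_mul, Real.norm_eq_abs]

/-- Superposing over `τ` with absolute values inside, Tonelli allows the `τ`-integral to be done
first at fixed `x`, `y`. It yields `2|x-y|^{-3}`, which together with the weight difference is the
commutator kernel. -/
theorem enorm_mform_rsym_sub_le (s : ℝ) (j : Fin 3) (F G : 𝓢(R3, ℝ)) :
    ‖mform (rsym j) (wmul s F) (wmul (-s) G) - mform (rsym j) F G‖ₑ ≤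
      ENNReal.ofReal 2 * ∫⁻ x, ∫⁻ y, ENNReal.ofReal (commKernel s (x, y) * |F y| * |G x|) := by
  have hjm := measurable_jb
  have hFm := F.continuous.measurable
  have hGm := G.continuous.measurable
  have hKm : Measurable fun z : (ℝ × R3) × R3 => heatKer j z.1.1 (z.1.2 - z.2) := by
    unfold heatKer
    have := measurable_coord j
    fun_prop
  have hm : Measurable fun z : (ℝ × R3) × R3 => ENNReal.ofReal (z.1.1 ^ (-1 / 2 : ℝ) *
      |heatKer j z.1.1 (z.1.2 - z.2)| * (|(jb z.2 / jb z.1.2) ^ s - 1| * |F z.2| * |G z.1.2|)) := by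
    fun_prop
  rw [mform_rsym_eq_integral, mform_rsym_eq_integral,
    ← integral_sub (integrableOn_rpow_smul_mform j _ _) (integrableOn_rpow_smul_mform j _ _)]
  calc _ ≤ ∫⁻ τ in Ioi (0 : ℝ), ∫⁻ x, ∫⁻ y, ENNReal.ofReal (τ ^ (-1 / 2 : ℝ) *
        |heatKer j τ (x - y)| * (|(jb y / jb x) ^ s - 1| * |F y| * |G x|)) := by
        refine (enorm_integral_le_lintegral_enorm _).trans
          (setLIntegral_mono' measurableSet_Ioi fun τ hτ => ?_)
        have hτ0 : (0 : ℝ) ≤ τ ^ (-1 / 2 : ℝ) := Real.rpow_nonneg (le_of_lt hτ) _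
        rw [← smul_sub, enorm_smul, Real.enorm_of_nonneg hτ0]
        simp_rw [mul_assoc (τ ^ (-1 / 2 : ℝ)), ENNReal.ofReal_mul hτ0]
        have h3 := fun x => lintegral_const_mul' (μ := (volume : Measure R3))
          (ENNReal.ofReal (τ ^ (-1 / 2 : ℝ)))
          (fun y => ENNReal.ofReal (|heatKer j τ (x - y)| *
            (|(jb y / jb x) ^ s - 1| * |F y| * |G x|))) (by simp)
        simp_rw [h3]
        rw [lintegral_const_mul' _ _ (by simp)]
        gcongr
        exact enorm_mform_heatSym_sub_le s j hτ F G
    _ = ∫⁻ x, ∫⁻ y, ∫⁻ τ in Ioi (0 : ℝ), ENNReal.ofReal (τ ^ (-1 / 2 : ℝ) *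
        |heatKer j τ (x - y)| * (|(jb y / jb x) ^ s - 1| * |F y| * |G x|)) := by
        rw [lintegral_lintegral_swap hm.lintegral_prod_right'.aemeasurable]
        congr 1; ext x
        rw [lintegral_lintegral_swap]
        have : Measurable fun z : ℝ × R3 => ((z.1, x), z.2) := by fun_prop
        exact (hm.comp this).aemeasurable
    _ ≤ ∫⁻ x, ∫⁻ y, ENNReal.ofReal 2 * ENNReal.ofReal (commKernel s (x, y) * |F y| * |G x|) := by
        refine lintegral_mono fun x => lintegral_mono fun y => ?_
        have hnn : 0 ≤ |(jb y / jb x) ^ s - 1| * |F y| * |G x| := by positivity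
        simp_rw [ENNReal.ofReal_mul' hnn]
        rw [lintegral_mul_const' _ _ (by simp)]
        refine (mul_le_mul_left (lintegral_heatKer_le j (x - y)) _).trans (le_of_eq ?_)
        rw [← ENNReal.ofReal_mul' hnn, ← ENNReal.ofReal_mul (by norm_num)]
        congr 1
        simp only [commKernel]
        ring
    _ = _ := by
        have h3 := fun x => lintegral_const_mul' (μ := (volume : Measure R3)) (ENNReal.ofReal 2)
          (fun y => ENNReal.ofReal (commKernel s (x, y) * |F y| * |G x|)) (by simp)
        simp_rw [h3]
        rw [lintegral_const_mul' _ _ (by simp)]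

theorem integrable_abs_schwartz_rpow {p : ℝ} (hp : 1 ≤ p) (f : 𝓢(R3, ℝ)) :
    Integrable fun x => |f x| ^ p := by
  have := (f.memLp (ENNReal.ofReal p) volume).integrable_norm_rpow
    (by simpa using one_pos.trans_le hp) (by simp)
  rwa [ENNReal.toReal_ofReal (zero_le_one.trans hp)] at this

theorem lintegral_rpow_eq_nrm {p : ℝ} (hp : 1 ≤ p) (f : 𝓢(R3, ℝ)) :
    (∫⁻ x, ENNReal.ofReal (|f x| ^ p)) ^ (1 / p) = ENNReal.ofReal (nrm p f) := by
  rw [← ofReal_integral_eq_lintegral_ofReal (integrable_abs_schwartz_rpow hp f)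
    (Filter.Eventually.of_forall fun x => by positivity), nrm,
    ENNReal.ofReal_rpow_of_nonneg (integral_nonneg fun x => by positivity) (by positivity)]

/-- The weighted form is the unweighted one plus the commutator: the first is bounded by hypothesis,
the second by Schur's test. The exponent `α` is free and only has to satisfy the three inequalities.
-/
theorem exists_norm_mform_rsym_wmul_le {p q s α : ℝ} (hpq : p.HolderConjugate q) (hs : 0 ≤ s)
    (h1 : α * p + s < 3) (h2 : s < α * q) (h3 : α * q < 3) (j : Fin 3) {C : ℝ} (hC : 0 ≤ C)
    (hb : ∀ f g, ‖mform (rsym j) f g‖ ≤ C * nrm p f * nrm q g) :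
    ∃ C', 0 ≤ C' ∧ ∀ F G, ‖mform (rsym j) (wmul s F) (wmul (-s) G)‖ ≤ C' * nrm p F * nrm q G := by
  obtain ⟨K, hK, H⟩ := exists_lintegral_commKernel_le hpq hs h1 h2 h3
  refine ⟨2 * K.toReal + C, by positivity, fun F G => ?_⟩
  have e1 := enorm_mform_rsym_sub_le s j F G
  have e2 := H F G F.continuous.measurable G.continuous.measurable
  rw [lintegral_rpow_eq_nrm hpq.lt.le, lintegral_rpow_eq_nrm hpq.symm.lt.le,
    ← ENNReal.ofReal_toReal hK, ← ENNReal.ofReal_mul (by positivity),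
    ← ENNReal.ofReal_mul (mul_nonneg (by positivity) (nrm_nonneg _ _))] at e2
  have e3 := e1.trans (mul_le_mul_right e2 (ENNReal.ofReal 2))
  rw [← ENNReal.ofReal_mul (by norm_num), ← ofReal_norm,
    ENNReal.ofReal_le_ofReal_iff (by have := nrm_nonneg p F; have := nrm_nonneg q G; positivity)]
    at e3
  have e4 := norm_le_norm_add_norm_sub' (mform (rsym j) (wmul s F) (wmul (-s) G))
    (mform (rsym j) F G)
  have e5 := hb F G
  linarith

/-! ### The converse of Hölder's inequality, tested on Schwartz functions -/

theorem exists_schwartz_approx {g : R3 → ℝ} (hg : Continuous g) (hgc : HasCompactSupport g)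
    {ε : ℝ} (hε : 0 < ε) : ∃ f : 𝓢(R3, ℝ), (∀ x, |f x - g x| ≤ ε) ∧
      ∀ x ∉ Metric.cthickening 1 (tsupport g), f x = 0 := by
  obtain ⟨δ, hδ, H⟩ := Metric.uniformContinuous_iff.mp
    (hgc.uniformContinuous_of_continuous hg) ε hε
  obtain ⟨f, hf, hfg⟩ := hg.exists_contDiff_dist_le_of_forall_mem_ball_dist_le
    (lt_min hδ one_pos)
  have hsupp : ∀ x ∉ Metric.cthickening 1 (tsupport g), f x = 0 := by
    intro x hx
    have h0 : ∀ y ∈ Metric.ball x (min δ 1), g y = 0 := by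
      intro y hy
      by_contra hne
      have h1 : y ∈ tsupport g := subset_tsupport g hne
      refine hx (Metric.mem_cthickening_of_dist_le x y 1 _ h1 ?_)
      rw [dist_comm]
      exact (Metric.mem_ball.1 hy).le.trans (min_le_right _ _)
    have hgx := h0 x (Metric.mem_ball_self (lt_min hδ one_pos))
    have h2 := hfg x 0 fun y hy => by rw [h0 y hy, hgx, dist_self]
    rw [hgx, dist_zero_right] at h2
    simpa using h2
  have hc : HasCompactSupport f :=
    HasCompactSupport.intro hgc.cthickening hsupp
  refine ⟨hc.toSchwartzMap hf, fun x => ?_, hsupp⟩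
  have := hfg x ε fun y hy => (H (lt_of_lt_of_le (Metric.mem_ball.1 hy) (min_le_left _ _))).le
  rwa [Real.dist_eq] at this

theorem abs_integral_mul_le_of_schwartz {h : R3 → ℝ} (hh : Continuous h) {q M : ℝ} (hq : 1 < q)
    (H : ∀ g : 𝓢(R3, ℝ), |∫ x, h x * g x| ≤ M * nrm q g) {g : R3 → ℝ} (hg : Continuous g)
    (hgc : HasCompactSupport g) : |∫ x, h x * g x| ≤ M * nrm q g := by
  choose f hf1 hf2 using fun n : ℕ =>
    exists_schwartz_approx hg hgc (ε := 1 / (n + 1)) (by positivity)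
  set K := Metric.cthickening 1 (tsupport g) with hK
  have hKc : IsCompact K := hgc.isCompact.cthickening
  have hq0 : 0 < q := by linarith
  have hlim : ∀ x, Filter.Tendsto (fun n => f n x) Filter.atTop (nhds (g x)) := fun x => by
    rw [tendsto_iff_dist_tendsto_zero]
    exact squeeze_zero (fun _ => dist_nonneg) (fun n => hf1 n x)
      tendsto_one_div_add_atTop_nhds_zero_nat
  have hle : ∀ n x, |f n x| ≤ K.indicator (fun x => |g x| + 1) x := by
    intro n x
    by_cases hx : x ∈ K
    · rw [indicator_of_mem hx]
      have h1 := hf1 n x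
      have h2 : (1 : ℝ) / (n + 1) ≤ 1 := by
        rw [div_le_one (by positivity)]; linarith [(Nat.cast_nonneg n : (0 : ℝ) ≤ n)]
      have := abs_sub_abs_le_abs_sub (f n x) (g x)
      linarith
    · rw [indicator_of_notMem hx, hf2 n x hx, abs_zero]
  have hlim1 : Filter.Tendsto (fun n => ∫ x, h x * f n x) Filter.atTop
      (nhds (∫ x, h x * g x)) := by
    refine tendsto_integral_of_dominated_convergence
      (K.indicator fun x => |h x| * (|g x| + 1)) (fun n => ?_) ?_ (fun n => ?_) ?_
    · exact (hh.mul (f n).continuous).aestronglyMeasurable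
    · rw [integrable_indicator_iff hKc.measurableSet]
      exact (by fun_prop : Continuous fun x => |h x| * (|g x| + 1)).continuousOn.integrableOn_compact
        hKc
    · refine Filter.Eventually.of_forall fun x => ?_
      rw [norm_mul, Real.norm_eq_abs, Real.norm_eq_abs]
      refine (mul_le_mul_of_nonneg_left (hle n x) (abs_nonneg _)).trans (le_of_eq ?_)
      by_cases hx : x ∈ K <;> simp [hx]
    · exact Filter.Eventually.of_forall fun x => (hlim x).const_mul _
  have hlim2 : Filter.Tendsto (fun n => ∫ x, |f n x| ^ q) Filter.atTop
      (nhds (∫ x, |g x| ^ q)) := by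
    refine tendsto_integral_of_dominated_convergence
      (K.indicator fun x => (|g x| + 1) ^ q) (fun n => ?_) ?_ (fun n => ?_) ?_
    · exact ((f n).continuous.abs.rpow_const fun _ => Or.inr hq0.le).aestronglyMeasurable
    · rw [integrable_indicator_iff hKc.measurableSet]
      exact ((by fun_prop : Continuous fun x => |g x| + 1).rpow_const
        fun _ => Or.inr hq0.le).continuousOn.integrableOn_compact hKc
    · refine Filter.Eventually.of_forall fun x => ?_
      rw [Real.norm_of_nonneg (by positivity)]
      refine (Real.rpow_le_rpow (abs_nonneg _) (hle n x) hq0.le).trans (le_of_eq ?_)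
      by_cases hx : x ∈ K <;> simp [hx, hq0.ne']
    · exact Filter.Eventually.of_forall fun x =>
        ((hlim x).abs).rpow_const (Or.inr hq0.le)
  exact le_of_tendsto_of_tendsto' hlim1.abs
    ((hlim2.rpow_const (Or.inr (by positivity))).const_mul M) fun n => H (f n)

/-- The extremal test function `sgn(h)|h|^{p-1}` is used, truncated by `χ` because `h` is not known
to be in `L^p`. Then `A = ∫ χ|h|^p` is finite and satisfies `A ≤ M A^{1/q}`, so `A ≤ M^p`. The balls
then exhaust the space. -/
theorem lintegral_rpow_le_of_forall_integral_mul_le {p q : ℝ} (hpq : p.HolderConjugate q)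
    {h : R3 → ℝ} (hh : Continuous h) {M : ℝ} (hM : 0 ≤ M)
    (H : ∀ g : 𝓢(R3, ℝ), |∫ x, h x * g x| ≤ M * nrm q g) :
    ∫⁻ x, ENNReal.ofReal (|h x| ^ p) ≤ ENNReal.ofReal (M ^ p) := by
  have hp := hpq.lt
  have hq := hpq.symm.lt
  have hp0 := hpq.pos
  have hq0 := hpq.symm.pos
  have key : ∀ n : ℕ, ∫⁻ x in Metric.closedBall 0 (n : ℝ), ENNReal.ofReal (|h x| ^ p) ≤
      ENNReal.ofReal (M ^ p) := by
    intro n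
    set χ : R3 → ℝ := fun x => max 0 (min 1 (n + 1 - ‖x‖)) with hχ
    have hχ0 : ∀ x, 0 ≤ χ x := fun x => le_max_left _ _
    have hχ1 : ∀ x, χ x ≤ 1 := fun x => max_le zero_le_one (min_le_left _ _)
    have hχc : Continuous χ := by fun_prop
    have hχs : HasCompactSupport χ := by
      refine HasCompactSupport.intro (isCompact_closedBall (0 : R3) (n + 1)) fun x hx => ?_
      rw [Metric.mem_closedBall, dist_zero_right, not_le] at hx
      exact max_eq_left ((min_le_right _ _).trans (by linarith))
    have hχb : ∀ x ∈ Metric.closedBall (0 : R3) n, χ x = 1 := by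
      intro x hx
      rw [Metric.mem_closedBall, dist_zero_right] at hx
      simp only [hχ]
      rw [min_eq_left (by linarith), max_eq_right zero_le_one]
    -- Positive and negative parts express `sgn(h)|h|^{p-1}` in a manifestly continuous way, since
    -- `p > 1`.
    set g : R3 → ℝ := fun x => χ x * ((max (h x) 0) ^ (p - 1) - (max (-h x) 0) ^ (p - 1)) with hg
    have hgc : Continuous g := by
      refine hχc.mul (Continuous.sub ?_ ?_) <;>
      exact Continuous.rpow_const (by fun_prop) fun _ => Or.inr (by linarith)
    have hgs : HasCompactSupport g := hχs.mul_right
    have hhg : ∀ x, h x * g x = χ x * |h x| ^ p := by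
      intro x
      have e : ∀ t : ℝ, 0 < t → t * t ^ (p - 1) = t ^ p := fun t ht => by
        rw [Real.rpow_sub_one ht.ne']; field_simp
      rcases lt_trichotomy (h x) 0 with hx | hx | hx
      · simp only [hg]
        rw [max_eq_right hx.le, max_eq_left (by linarith), Real.zero_rpow (by linarith),
          abs_of_neg hx, ← e _ (neg_pos.2 hx)]
        ring
      · simp [hx, Real.zero_rpow hp0.ne']
      · simp only [hg]
        rw [max_eq_left hx.le, max_eq_right (by linarith), Real.zero_rpow (by linarith),
          abs_of_pos hx, ← e _ hx]
        ring
    have hga : ∀ x, |g x| ^ q ≤ χ x * |h x| ^ p := by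
      intro x
      have e1 : |(max (h x) 0) ^ (p - 1) - (max (-h x) 0) ^ (p - 1)| = |h x| ^ (p - 1) := by
        rcases le_total (h x) 0 with hx | hx
        · rw [max_eq_right hx, max_eq_left (by linarith), Real.zero_rpow (by linarith), zero_sub,
            abs_neg, abs_of_nonpos hx, abs_of_nonneg (Real.rpow_nonneg (by linarith) _)]
        · rw [max_eq_left hx, max_eq_right (by linarith), Real.zero_rpow (by linarith), sub_zero,
            abs_of_nonneg hx, abs_of_nonneg (Real.rpow_nonneg hx _)]
      have e2 : (p - 1) * q = p := by
        have := hpq.mul_eq_add; linarith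
      rw [abs_mul, abs_of_nonneg (hχ0 x), e1, Real.mul_rpow (hχ0 x) (by positivity),
        ← Real.rpow_mul (abs_nonneg _), e2]
      gcongr
      exact Real.rpow_le_self_of_le_one (hχ0 x) (hχ1 x) hq.le
    have hi : Integrable fun x => χ x * |h x| ^ p := by
      refine Continuous.integrable_of_hasCompactSupport (hχc.mul (hh.abs.rpow_const
        fun _ => Or.inr hp0.le)) hχs.mul_right
    set A := ∫ x, χ x * |h x| ^ p with hA
    have hA0 : 0 ≤ A := integral_nonneg fun x => mul_nonneg (hχ0 x) (by positivity)
    have h1 : A ≤ M * A ^ (1 / q) := by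
      have h2 := abs_integral_mul_le_of_schwartz hh hq H hgc hgs
      simp_rw [hhg] at h2
      rw [← hA, abs_of_nonneg hA0] at h2
      refine h2.trans (mul_le_mul_of_nonneg_left ?_ hM)
      refine Real.rpow_le_rpow (integral_nonneg fun x => by positivity) ?_ (by positivity)
      exact integral_mono_of_nonneg (Filter.Eventually.of_forall fun x => by positivity) hi
        (Filter.Eventually.of_forall hga)
    have h3 : A ≤ M ^ p := by
      rcases hA0.eq_or_lt with h0 | h0
      · rw [← h0]; positivity
      · have e : A = A ^ (1 / p) * A ^ (1 / q) := by
          rw [← Real.rpow_add h0, one_div, one_div, hpq.inv_add_inv_eq_one, Real.rpow_one]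
        have h4 : A ^ (1 / p) ≤ M := by
          refine le_of_mul_le_mul_right ?_ (Real.rpow_pos_of_pos h0 (1 / q))
          rwa [← e]
        calc A = (A ^ (1 / p)) ^ p := by
              rw [← Real.rpow_mul hA0, one_div, inv_mul_cancel₀ hp0.ne', Real.rpow_one]
          _ ≤ _ := by gcongr
    calc _ ≤ ∫⁻ x in Metric.closedBall 0 (n : ℝ), ENNReal.ofReal (χ x * |h x| ^ p) := by
          refine setLIntegral_mono' Metric.isClosed_closedBall.measurableSet fun x hx => ?_
          rw [hχb x hx, one_mul]
      _ ≤ ∫⁻ x, ENNReal.ofReal (χ x * |h x| ^ p) := setLIntegral_le_lintegral _ _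
      _ = ENNReal.ofReal A := (ofReal_integral_eq_lintegral_ofReal hi
          (Filter.Eventually.of_forall fun x => mul_nonneg (hχ0 x) (by positivity))).symm
      _ ≤ _ := ENNReal.ofReal_le_ofReal h3
  have hu : (⋃ n : ℕ, Metric.closedBall (0 : R3) n) = univ := Metric.iUnion_closedBall_nat 0
  rw [← setLIntegral_univ, ← hu, setLIntegral_iUnion_of_directed _
    (Monotone.directed_le fun m n hmn => Metric.closedBall_subset_closedBall (by exact_mod_cast hmn))]
  exact iSup_le key

/-! ### Composition of two Riesz transforms on Schwartz functions -/

/-- The abstract `L²` transform and the Fourier integral agree as tempered distributions. This is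
needed because `rsym j · f̂` is integrable and square integrable, yet not Schwartz in general, so
Plancherel for Schwartz functions does not apply to it. -/
theorem lpFourierInv_ae_eq {h : R3 → ℂ} (h1 : Integrable h) (h2 : MemLp h 2 volume) :
    (𝓕⁻ (h2.toLp h) : Lp ℂ 2 (volume : Measure R3)) =ᵐ[volume] 𝓕⁻ h := by
  refine ae_eq_of_integral_contDiff_smul_eq ((Lp.memLp _).locallyIntegrable one_le_two)
    (continuous_fourierInv h1).locallyIntegrable fun g hg hgc => ?_
  have hg₁ : HasCompactSupport (Complex.ofRealCLM ∘ g) := hgc.comp_left rfl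
  have hg₂ : ContDiff ℝ (⊤ : ℕ∞) (Complex.ofRealCLM ∘ g) := by fun_prop
  set k : 𝓢(R3, ℂ) := hg₁.toSchwartzMap hg₂
  have e1 := congrArg (fun S => S k) (Lp.fourierInv_toTemperedDistribution_eq (h2.toLp h))
  simp only [TemperedDistribution.fourierInv_apply, Lp.toTemperedDistribution_apply] at e1
  have e2 : ∫ x, k x • (𝓕⁻ (h2.toLp h) : Lp ℂ 2 (volume : Measure R3)) x =
      ∫ x, g x • (𝓕⁻ (h2.toLp h) : Lp ℂ 2 (volume : Measure R3)) x := by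
    congr 1
  rw [← e2, ← e1]
  have e3 := integral_fourierInv_mul h1 k.integrable
  rw [← SchwartzMap.fourierInv_coe] at e3
  calc ∫ x, 𝓕⁻ k x • (h2.toLp h) x = ∫ x, h x * 𝓕⁻ k x := by
        refine integral_congr_ae ?_
        filter_upwards [h2.coeFn_toLp] with x hx
        rw [hx, smul_eq_mul, mul_comm]
    _ = ∫ x, 𝓕⁻ h x * k x := e3.symm
    _ = _ := by
        congr 1; ext x
        rw [mul_comm, Complex.real_smul]; rfl

theorem integral_conj_fourierInv_mul {h k : R3 → ℂ} (h1 : Integrable h) (h2 : MemLp h 2 volume)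
    (k1 : Integrable k) (k2 : MemLp k 2 volume) :
    ∫ x, (starRingEnd ℂ) (𝓕⁻ h x) * 𝓕⁻ k x = ∫ ξ, (starRingEnd ℂ) (h ξ) * k ξ := by
  have e := Lp.inner_fourier_eq (𝓕⁻ (h2.toLp h)) (𝓕⁻ (k2.toLp k))
  rw [FourierTransform.fourier_fourierInv_eq, FourierTransform.fourier_fourierInv_eq] at e
  rw [L2.inner_def, L2.inner_def] at e
  calc _ = ∫ x, inner ℂ ((𝓕⁻ (h2.toLp h) : Lp ℂ 2 (volume : Measure R3)) x)
        ((𝓕⁻ (k2.toLp k) : Lp ℂ 2 (volume : Measure R3)) x) := by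
        refine integral_congr_ae ?_
        filter_upwards [lpFourierInv_ae_eq h1 h2, lpFourierInv_ae_eq k1 k2] with x hx hy
        rw [hx, hy, RCLike.inner_apply', mul_comm]
    _ = _ := by
        rw [← e]
        refine integral_congr_ae ?_
        filter_upwards [h2.coeFn_toLp, k2.coeFn_toLp] with x hx hy
        rw [hx, hy, RCLike.inner_apply', mul_comm]

theorem conj_fourier_fc (f : 𝓢(R3, ℝ)) (ξ : R3) :
    (starRingEnd ℂ) (𝓕 (fc f) ξ) = 𝓕⁻ (fc f) ξ := by
  rw [SchwartzMap.fourier_coe, SchwartzMap.fourierInv_coe, Real.fourier_eq, Real.fourierInv_eq,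
    ← integral_conj]
  congr 1; ext x
  simp [Circle.smul_def, ← Circle.coe_inv_eq_conj, AddChar.map_neg_eq_inv]

theorem conj_rsym (j : Fin 3) (ξ : R3) : (starRingEnd ℂ) (rsym j ξ) = -rsym j ξ := by
  simp [rsym]

theorem ofReal_rieszSchwartz (j : Fin 3) (f : 𝓢(R3, ℝ)) (x : R3) :
    (rieszSchwartz j f x : ℂ) = 𝓕⁻ (fun ξ => rsym j ξ * 𝓕 (fc f) ξ) x := by
  rw [rieszSchwartz_eq, ← Complex.conj_eq_iff_re, Real.fourierInv_eq, ← integral_conj,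
    ← integral_neg_eq_self]
  congr 1; ext ξ
  simp only [Circle.smul_def, smul_eq_mul, map_mul, conj_fourier_fc, conj_rsym, rsym_neg, neg_neg,
    fourierInv_neg_apply, inner_neg_left, ← Circle.coe_inv_eq_conj, AddChar.map_neg_eq_inv, inv_inv, map_neg]

theorem memLp_rsym_fourier (j : Fin 3) (f : 𝓢(R3, ℝ)) :
    MemLp (fun ξ => rsym j ξ * 𝓕 (fc f) ξ) 2 volume := by
  refine ((𝓕 (fc f)).memLp 2 volume).of_le
    (integrable_rsym_fourier j f).1 (Filter.Eventually.of_forall fun ξ => ?_)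
  rw [norm_mul]
  exact mul_le_of_le_one_left (norm_nonneg _) (norm_rsym_le j ξ)

/-- The standard basis vectors of `ℝ³`. -/
noncomputable abbrev e (i : Fin 3) : R3 := EuclideanSpace.single i 1

/-- The Laplacian of a Schwartz function. -/
noncomputable def lap (φ : 𝓢(R3, ℝ)) : 𝓢(R3, ℝ) := ∑ i, ∂_{e i} (∂_{e i} φ)

theorem fc_lineDeriv (φ : 𝓢(R3, ℝ)) (m : R3) : fc (∂_{m} φ) = ∂_{m} (fc φ) := by
  ext x
  rw [fc_apply, SchwartzMap.lineDerivOp_apply_eq_fderiv, SchwartzMap.lineDerivOp_apply_eq_fderiv]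
  have := (Complex.ofRealCLM.hasFDerivAt.comp x (φ.differentiableAt (x := x)).hasFDerivAt).fderiv
  change _ = fderiv ℝ (Complex.ofRealCLM ∘ φ) x m
  rw [this]
  rfl

theorem fourier_fc_lineDeriv (φ : 𝓢(R3, ℝ)) (i : Fin 3) (ξ : R3) :
    𝓕 (fc (∂_{e i} φ)) ξ = 2 * Real.pi * Complex.I * ξ i * 𝓕 (fc φ) ξ := by
  rw [fc_lineDeriv, SchwartzMap.fourier_lineDerivOp_eq, smul_apply,
    SchwartzMap.smulLeftCLM_apply_apply (by fun_prop)]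
  simp [EuclideanSpace.inner_single_right]
  ring

theorem fourier_fc_lap (φ : 𝓢(R3, ℝ)) (ξ : R3) :
    𝓕 (fc (lap φ)) ξ = -(4 * Real.pi ^ 2 * ‖ξ‖ ^ 2) * 𝓕 (fc φ) ξ := by
  have h1 : 𝓕 (fc (lap φ)) ξ = ∑ i, 𝓕 (fc (∂_{e i} (∂_{e i} φ))) ξ := by
    have : fc (lap φ) = ∑ i, fc (∂_{e i} (∂_{e i} φ)) := by
      unfold lap fc; rw [map_sum]
    rw [this]
    have h2 : 𝓕 (∑ i, fc (∂_{e i} (∂_{e i} φ))) = ∑ i, 𝓕 (fc (∂_{e i} (∂_{e i} φ))) :=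
      map_sum (FourierTransform.fourierCLM ℂ 𝓢(R3, ℂ)) _ _
    rw [h2, sum_apply]
  rw [h1]
  simp_rw [fourier_fc_lineDeriv]
  have h3 : ((‖ξ‖ : ℂ)) ^ 2 = ∑ i, (ξ i : ℂ) ^ 2 := by
    rw [← Complex.ofReal_pow, EuclideanSpace.real_norm_sq_eq]; push_cast; rfl
  rw [h3, Fin.sum_univ_three, Fin.sum_univ_three]
  linear_combination (4 * (Real.pi : ℂ) ^ 2 * ((ξ 0 : ℂ) ^ 2 + ξ 1 ^ 2 + ξ 2 ^ 2) *
    𝓕 (fc φ) ξ) * Complex.I_sq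

/-- `R_j R_i Δ = -∂_i ∂_j` on Schwartz functions, in weak form. -/
theorem integral_rieszSchwartz_mul_rieszSchwartz_lap (i j : Fin 3) (g φ : 𝓢(R3, ℝ)) :
    ∫ x, rieszSchwartz j g x * rieszSchwartz i (lap φ) x = ∫ x, g x * ∂_{e i} (∂_{e j} φ) x := by
  have h1 := integral_conj_fourierInv_mul (integrable_rsym_fourier j g) (memLp_rsym_fourier j g)
    (integrable_rsym_fourier i (lap φ)) (memLp_rsym_fourier i (lap φ))
  simp_rw [← ofReal_rieszSchwartz, Complex.conj_ofReal, ← Complex.ofReal_mul] at h1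
  rw [integral_complex_ofReal] at h1
  have h2 := integral_fourier_mul (fc (∂_{e i} (∂_{e j} φ))).integrable (𝓕⁻ (fc g)).integrable
  rw [← SchwartzMap.fourier_coe, ← SchwartzMap.fourier_coe,
    FourierTransform.fourier_fourierInv_eq] at h2
  simp only [fc_apply, ← Complex.ofReal_mul] at h2
  rw [integral_complex_ofReal] at h2
  rw [← Complex.ofReal_inj, h1]
  simp_rw [mul_comm (g _)]
  rw [← h2]
  congr 1; ext ξ
  rw [map_mul, conj_fourier_fc, conj_rsym, fourier_fc_lap, fourier_fc_lineDeriv,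
    fourier_fc_lineDeriv]
  rcases eq_or_ne ξ 0 with rfl | hξ
  · simp
  · have : (‖ξ‖ : ℂ) ≠ 0 := by simpa using hξ
    unfold rsym
    push_cast
    field_simp
    ring_nf

/-! ### The weighted spaces -/

theorem jb_le_one_add_norm (x : R3) : jb x ≤ 1 + ‖x‖ := by
  refine Real.sqrt_le_iff.2 ⟨by positivity, ?_⟩
  nlinarith [norm_nonneg x]

theorem one_add_norm_le (x : R3) : 1 + ‖x‖ ≤ 2 * jb x := by
  linarith [one_le_jb x, norm_le_jb x]

theorem weight_nonneg (δ : ℝ) (x : R3) : 0 ≤ weight δ x := by unfold weight; positivity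

theorem weight_pos (δ : ℝ) (x : R3) : 0 < weight δ x := by unfold weight; positivity

theorem weight_le {δ : ℝ} (hδ : 0 ≤ δ) (x : R3) : weight δ x ≤ jb x ^ (-δ) :=
  Real.rpow_le_rpow_of_nonpos (jb_pos x) (jb_le_one_add_norm x) (by linarith)

theorem le_weight {δ : ℝ} (hδ : 0 ≤ δ) (x : R3) : jb x ^ (-δ) ≤ 2 ^ δ * weight δ x := by
  have h1 : (2 * jb x) ^ (-δ) ≤ weight δ x :=
    Real.rpow_le_rpow_of_nonpos (by positivity) (one_add_norm_le x) (by linarith)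
  rw [Real.mul_rpow (by norm_num) (jb_pos x).le, Real.rpow_neg (by norm_num)] at h1
  calc jb x ^ (-δ) = 2 ^ δ * ((2 ^ δ)⁻¹ * jb x ^ (-δ)) := by field_simp
    _ ≤ _ := by gcongr

theorem ae_weightMeasure {δ : ℝ} : ae (weightMeasure δ) = ae (volume : Measure R3) := by
  refine le_antisymm (withDensity_absolutelyContinuous _ _).ae_le ?_
  refine (withDensity_absolutelyContinuous'
    (continuous_weight δ).measurable.ennreal_ofReal.aemeasurable ?_).ae_le
  exact Filter.Eventually.of_forall fun x => by simpa using weight_pos δ x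

theorem volume_ac_weightMeasure (δ : ℝ) : (volume : Measure R3) ≪ weightMeasure δ :=
  Measure.ae_le_iff_absolutelyContinuous.1 ae_weightMeasure.ge

theorem weightMeasure_ac_volume (δ : ℝ) : weightMeasure δ ≪ (volume : Measure R3) :=
  withDensity_absolutelyContinuous _ _

theorem lintegral_weightMeasure (δ : ℝ) (f : R3 → ℝ≥0∞) :
    ∫⁻ x, f x ∂weightMeasure δ = ∫⁻ x, ENNReal.ofReal (weight δ x) * f x :=
  lintegral_withDensity_eq_lintegral_mul_non_measurable _
    (continuous_weight δ).measurable.ennreal_ofReal (by simp) f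

theorem eLpNorm_weightMeasure_le {p : ℝ≥0∞} (hp0 : p ≠ 0) (hp : p ≠ ⊤) {δ : ℝ} (hδ : 0 ≤ δ)
    (f : R3 → ℝ) : eLpNorm f p (weightMeasure δ) ≤
      eLpNorm (fun x => jb x ^ (-(δ / p.toReal)) * f x) p volume := by
  have hpr := ENNReal.toReal_pos hp0 hp
  rw [eLpNorm_eq_lintegral_rpow_enorm_toReal hp0 hp, eLpNorm_eq_lintegral_rpow_enorm_toReal hp0 hp,
    lintegral_weightMeasure]
  gcongr with x
  rw [enorm_mul, ENNReal.mul_rpow_of_nonneg _ _ hpr.le,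
    Real.enorm_of_nonneg (Real.rpow_nonneg (jb_pos x).le _),
    ENNReal.ofReal_rpow_of_nonneg (Real.rpow_nonneg (jb_pos x).le _) hpr.le,
    ← Real.rpow_mul (jb_pos x).le, neg_mul, div_mul_cancel₀ _ hpr.ne']
  gcongr
  exact weight_le hδ x

theorem eLpNorm_volume_le {p : ℝ≥0∞} (hp0 : p ≠ 0) (hp : p ≠ ⊤) {δ : ℝ} (hδ : 0 ≤ δ)
    (f : R3 → ℝ) : eLpNorm (fun x => jb x ^ (-(δ / p.toReal)) * f x) p volume ≤
      ENNReal.ofReal (2 ^ (δ / p.toReal)) * eLpNorm f p (weightMeasure δ) := by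
  have hpr := ENNReal.toReal_pos hp0 hp
  rw [eLpNorm_eq_lintegral_rpow_enorm_toReal hp0 hp, eLpNorm_eq_lintegral_rpow_enorm_toReal hp0 hp,
    lintegral_weightMeasure]
  have e : ENNReal.ofReal (2 ^ (δ / p.toReal)) =
      ENNReal.ofReal (2 ^ δ) ^ (1 / p.toReal) := by
    rw [ENNReal.ofReal_rpow_of_nonneg (by positivity) (by positivity),
      ← Real.rpow_mul (by norm_num)]
    congr 2; ring
  rw [e, ← ENNReal.mul_rpow_of_nonneg _ _ (by positivity), ← lintegral_const_mul' _ _ (by simp)]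
  gcongr with x
  rw [enorm_mul, ENNReal.mul_rpow_of_nonneg _ _ hpr.le,
    Real.enorm_of_nonneg (Real.rpow_nonneg (jb_pos x).le _),
    ENNReal.ofReal_rpow_of_nonneg (Real.rpow_nonneg (jb_pos x).le _) hpr.le,
    ← Real.rpow_mul (jb_pos x).le, neg_mul, div_mul_cancel₀ _ hpr.ne', ← mul_assoc,
    ← ENNReal.ofReal_mul (by positivity)]
  gcongr
  exact le_weight hδ x

theorem enorm_integral_mul_le {p q : ℝ≥0∞} [p.HolderConjugate q] (hp0 : p ≠ 0) (hp : p ≠ ⊤)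
    {δ : ℝ} (hδ : 0 ≤ δ) {f h : R3 → ℝ} (hf : AEStronglyMeasurable f (weightMeasure δ))
    (hh : AEStronglyMeasurable h volume) :
    ∫⁻ x, ‖f x * h x‖ₑ ≤ ENNReal.ofReal (2 ^ (δ / p.toReal)) * eLpNorm f p (weightMeasure δ) *
      eLpNorm (fun x => jb x ^ (δ / p.toReal) * h x) q volume := by
  set s := δ / p.toReal
  have hm : ∀ r : ℝ, AEStronglyMeasurable (fun x => jb x ^ r) (volume : Measure R3) := fun r =>
    (measurable_jb.pow_const r).aestronglyMeasurable
  have hf' : AEStronglyMeasurable f volume := hf.mono_ac (volume_ac_weightMeasure δ)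
  have h1 := eLpNorm_smul_le_mul_eLpNorm (p := p) (q := q) (r := 1) ((hm s).mul hh) ((hm (-s)).mul hf')
  refine le_trans ?_ (h1.trans (mul_le_mul_left (eLpNorm_volume_le hp0 hp hδ f) _))
  rw [eLpNorm_one_eq_lintegral_enorm]
  refine le_of_eq (lintegral_congr fun x => ?_)
  have : jb x ^ (-s) * jb x ^ s = 1 := by
    rw [← Real.rpow_add (jb_pos x)]; simp
  simp only [Pi.smul_apply', Pi.mul_apply, smul_eq_mul]
  congr 1
  linear_combination -(f x * h x) * this

theorem integrable_mul_of_memLp {p q : ℝ≥0∞} [p.HolderConjugate q] (hp0 : p ≠ 0) (hp : p ≠ ⊤)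
    {δ : ℝ} (hδ : 0 ≤ δ) {f h : R3 → ℝ} (hf : MemLp f p (weightMeasure δ))
    (hh : AEStronglyMeasurable h volume)
    (hh' : eLpNorm (fun x => jb x ^ (δ / p.toReal) * h x) q volume ≠ ⊤) :
    Integrable fun x => f x * h x := by
  refine ⟨(hf.1.mono_ac (volume_ac_weightMeasure δ)).mul hh, ?_⟩
  refine (enorm_integral_mul_le (p := p) (q := q) hp0 hp hδ hf.1 hh).trans_lt ?_
  have := hf.2.ne
  exact (by finiteness : _ ≠ ⊤).lt_top

/-- The functional `f ↦ ∫ f h` on `L^p(w_δ)`. -/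
theorem exists_pairing {p q : ℝ≥0∞} [Fact (1 ≤ p)] [p.HolderConjugate q] (hp : p ≠ ⊤)
    {δ : ℝ} (hδ : 0 ≤ δ) {h : R3 → ℝ} (hh : AEStronglyMeasurable h volume)
    (hh' : eLpNorm (fun x => jb x ^ (δ / p.toReal) * h x) q volume ≠ ⊤) :
    ∃ Λ : Lp ℝ p (weightMeasure δ) →L[ℝ] ℝ, ∀ f, Λ f = ∫ x, f x * h x := by
  have hp0 : p ≠ 0 := (one_pos.trans_le Fact.out).ne'
  have hi := fun f : Lp ℝ p (weightMeasure δ) =>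
    integrable_mul_of_memLp (q := q) hp0 hp hδ (Lp.memLp f) hh hh'
  refine ⟨LinearMap.mkContinuous
    { toFun := fun f => ∫ x, f x * h x
      map_add' := fun f g => ?_
      map_smul' := fun c f => ?_ }
    (2 ^ (δ / p.toReal) * (eLpNorm (fun x => jb x ^ (δ / p.toReal) * h x) q volume).toReal)
    fun f => ?_, fun f => rfl⟩
  · rw [← integral_add (hi f) (hi g)]
    refine integral_congr_ae ?_
    filter_upwards [(volume_ac_weightMeasure δ).ae_le (Lp.coeFn_add f g)] with x hx
    rw [hx, Pi.add_apply, add_mul]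
  · rw [RingHom.id_apply, ← integral_smul]
    refine integral_congr_ae ?_
    filter_upwards [(volume_ac_weightMeasure δ).ae_le (Lp.coeFn_smul c f)] with x hx
    rw [hx, Pi.smul_apply, smul_mul_assoc]
  · have h1 := (enorm_integral_le_lintegral_enorm (μ := volume) fun x => f x * h x).trans
      (enorm_integral_mul_le (q := q) hp0 hp hδ (Lp.memLp f).1 hh)
    rw [← ofReal_norm, ENNReal.ofReal_le_iff_le_toReal (by
      have := (Lp.memLp f).2.ne
      finiteness)] at h1
    rw [ENNReal.toReal_mul, ENNReal.toReal_mul, ENNReal.toReal_ofReal (by positivity)] at h1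
    change ‖∫ x, f x * h x‖ ≤ _
    rw [Lp.norm_def]
    linarith

/-! ### The Riesz transforms on the weighted spaces -/

/-- The weighted bound `‖v R_j f‖_p ≤ C ‖v f‖_p`, `v = ⟨x⟩^{-s}`, in bilinear form. -/
def RieszBound (p q s : ℝ) (j : Fin 3) (C : ℝ) : Prop :=
  ∀ F G : 𝓢(R3, ℝ), ‖mform (rsym j) (wmul s F) (wmul (-s) G)‖ ≤ C * nrm p F * nrm q G

theorem eLpNorm_eq_lintegral_abs {p : ℝ≥0∞} (hp0 : p ≠ 0) (hp : p ≠ ⊤) (h : R3 → ℝ) :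
    eLpNorm h p volume = (∫⁻ x, ENNReal.ofReal (|h x| ^ p.toReal)) ^ (1 / p.toReal) := by
  rw [eLpNorm_eq_lintegral_rpow_enorm_toReal hp0 hp]
  congr 1
  refine lintegral_congr fun x => ?_
  rw [Real.enorm_eq_ofReal_abs, ENNReal.ofReal_rpow_of_nonneg (abs_nonneg _) (by positivity)]

theorem eLpNorm_le_of_forall_integral_mul_le {p q : ℝ≥0∞} (hpq : p.toReal.HolderConjugate q.toReal)
    {h : R3 → ℝ} (hh : Continuous h) {M : ℝ} (hM : 0 ≤ M)
    (H : ∀ g : 𝓢(R3, ℝ), |∫ x, h x * g x| ≤ M * nrm q.toReal g) :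
    eLpNorm h p volume ≤ ENNReal.ofReal M := by
  have hp := ENNReal.toReal_pos_iff.1 hpq.pos
  rw [eLpNorm_eq_lintegral_abs hp.1.ne' hp.2.ne]
  refine (ENNReal.rpow_le_rpow (lintegral_rpow_le_of_forall_integral_mul_le hpq hh hM H)
    (by positivity)).trans (le_of_eq ?_)
  rw [ENNReal.ofReal_rpow_of_nonneg (by positivity) (by positivity), ← Real.rpow_mul hM,
    mul_one_div_cancel hpq.pos.ne', Real.rpow_one]

theorem eLpNorm_schwartz {p : ℝ≥0∞} (hp1 : 1 ≤ p.toReal) (f : 𝓢(R3, ℝ)) :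
    eLpNorm f p volume = ENNReal.ofReal (nrm p.toReal f) := by
  have hp := ENNReal.toReal_pos_iff.1 (one_pos.trans_le hp1)
  rw [eLpNorm_eq_lintegral_abs hp.1.ne' hp.2.ne, lintegral_rpow_eq_nrm hp1]

theorem eLpNorm_weight_rieszSchwartz_le {p q : ℝ≥0∞} (hpq : p.toReal.HolderConjugate q.toReal)
    {s C : ℝ} {j : Fin 3} (hC : 0 ≤ C) (H : RieszBound p.toReal q.toReal s j C) (f : 𝓢(R3, ℝ)) :
    eLpNorm (fun x => jb x ^ (-s) * rieszSchwartz j f x) p volume ≤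
      ENNReal.ofReal (C * nrm p.toReal (wmul (-s) f)) := by
  refine eLpNorm_le_of_forall_integral_mul_le hpq ?_ (mul_nonneg hC (nrm_nonneg _ _)) fun g => ?_
  · exact (continuous_jb.rpow_const fun x => Or.inl (jb_pos x).ne').mul
      (continuous_rieszSchwartz j f)
  · have h1 := H (wmul (-s) f) g
    rw [wmul_wmul_neg] at h1
    have h2 : ∀ x, jb x ^ (-s) * rieszSchwartz j f x * g x =
        rieszSchwartz j f x * wmul (-s) g x := fun x => by rw [wmul_apply]; ring
    simp_rw [h2]
    rw [integral_rieszSchwartz_mul]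
    exact (Complex.abs_re_le_norm _).trans h1

/-- The same bilinear bound read in its other variable, through antisymmetry: `R_j g` lies in the
dual weighted space. It makes `f ↦ ∫ f R_j g` continuous on `L^p(w_δ)`, even though `R_j g` need not
be Schwartz. -/
theorem eLpNorm_weight_rieszSchwartz_ne_top {p q : ℝ≥0∞}
    (hpq : p.toReal.HolderConjugate q.toReal)
    {s C : ℝ} {j : Fin 3} (hC : 0 ≤ C) (H : RieszBound p.toReal q.toReal s j C) (g : 𝓢(R3, ℝ)) :
    eLpNorm (fun x => jb x ^ s * rieszSchwartz j g x) q volume ≠ ⊤ := by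
  refine ne_top_of_le_ne_top (b := ENNReal.ofReal (C * nrm q.toReal (wmul s g)))
    (by simp) (eLpNorm_le_of_forall_integral_mul_le hpq.symm ?_
      (mul_nonneg hC (nrm_nonneg _ _)) fun f => ?_)
  · exact (continuous_jb.rpow_const fun x => Or.inl (jb_pos x).ne').mul
      (continuous_rieszSchwartz j g)
  · have h1 := H f (wmul s g)
    rw [wmul_neg_wmul, mform_rsym_symm, norm_neg] at h1
    have h2 : ∀ x, jb x ^ s * rieszSchwartz j g x * f x =
        rieszSchwartz j g x * wmul s f x := fun x => by rw [wmul_apply]; ring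
    simp_rw [h2]
    rw [integral_rieszSchwartz_mul]
    refine (Complex.abs_re_le_norm _).trans (h1.trans (le_of_eq (by ring)))

theorem eLpNorm_rieszSchwartz_le {p q : ℝ≥0∞} (hpq : p.toReal.HolderConjugate q.toReal)
    {δ C : ℝ} (hδ : 0 ≤ δ) {j : Fin 3} (hC : 0 ≤ C)
    (H : RieszBound p.toReal q.toReal (δ / p.toReal) j C) (f : 𝓢(R3, ℝ)) :
    eLpNorm (rieszSchwartz j f) p (weightMeasure δ) ≤
      ENNReal.ofReal (C * 2 ^ (δ / p.toReal)) * eLpNorm f p (weightMeasure δ) := by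
  have hp := ENNReal.toReal_pos_iff.1 hpq.pos
  refine (eLpNorm_weightMeasure_le hp.1.ne' hp.2.ne hδ _).trans
    ((eLpNorm_weight_rieszSchwartz_le hpq hC H f).trans ?_)
  rw [ENNReal.ofReal_mul hC, ENNReal.ofReal_mul hC, mul_assoc, ← eLpNorm_schwartz hpq.lt.le]
  gcongr
  refine le_trans (le_of_eq ?_) (eLpNorm_volume_le hp.1.ne' hp.2.ne hδ _)
  congr 1
  ext x
  exact wmul_apply _ _ _

/-- The Riesz transform on `L^p(w_δ)`, with its adjoint relation. -/
theorem exists_isRieszTransform {p q : ℝ≥0∞} [Fact (1 ≤ p)] [p.HolderConjugate q]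
    (hpq : p.toReal.HolderConjugate q.toReal) {δ C : ℝ} (hδ : 0 ≤ δ) {j : Fin 3} (hC : 0 ≤ C)
    (H : RieszBound p.toReal q.toReal (δ / p.toReal) j C) :
    ∃ R : Lp ℝ p (weightMeasure δ) →L[ℝ] Lp ℝ p (weightMeasure δ), IsRieszTransform j R ∧
      ∀ (f : Lp ℝ p (weightMeasure δ)) (φ : 𝓢(R3, ℝ)),
        ∫ x, R f x * φ x = -∫ x, f x * rieszSchwartz j φ x := by
  have hp := ENNReal.toReal_pos_iff.1 hpq.pos
  have hmem : ∀ f : 𝓢(R3, ℝ), MemLp (rieszSchwartz j f) p (weightMeasure δ) := fun f =>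
    ⟨(continuous_rieszSchwartz j f).aestronglyMeasurable,
      (eLpNorm_rieszSchwartz_le hpq hδ hC H f).trans_lt
        (ENNReal.mul_lt_top (by simp) (f.memLp p (weightMeasure δ)).2)⟩
  let L : 𝓢(R3, ℝ) →ₗ[ℝ] Lp ℝ p (weightMeasure δ) :=
    { toFun := fun f => (hmem f).toLp _
      map_add' := fun f g => by
        rw [← MemLp.toLp_add]
        congr 1
        ext x
        exact rieszSchwartz_add j f g x
      map_smul' := fun c f => by
        rw [RingHom.id_apply, ← MemLp.toLp_const_smul]
        congr 1
        ext x
        exact rieszSchwartz_smul j c f x }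
  have hd := SchwartzMap.denseRange_toLpCLM (E := R3) (F := ℝ) hp.2.ne (μ := weightMeasure δ)
  have hL : ∀ f, ‖L f‖ ≤ (C * 2 ^ (δ / p.toReal)) *
      ‖SchwartzMap.toLpCLM ℝ ℝ p (weightMeasure δ) f‖ := fun f => by
    have h1 := eLpNorm_rieszSchwartz_le hpq hδ hC H f
    have h2 := (f.memLp p (weightMeasure δ)).2.ne
    have h3 := ENNReal.toReal_mono (by finiteness) h1
    rw [ENNReal.toReal_mul, ENNReal.toReal_ofReal (by positivity)] at h3
    rw [SchwartzMap.toLpCLM_apply, SchwartzMap.norm_toLp]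
    change ‖(hmem f).toLp _‖ ≤ _
    rw [Lp.norm_toLp]
    exact h3
  set R := L.extendOfNorm (SchwartzMap.toLpCLM ℝ ℝ p (weightMeasure δ)).toLinearMap with hR
  have hRL : ∀ f : 𝓢(R3, ℝ), R (f.toLp p (weightMeasure δ)) = L f := fun f =>
    LinearMap.extendOfNorm_eq (e := (SchwartzMap.toLpCLM ℝ ℝ p (weightMeasure δ)).toLinearMap)
      hd ⟨_, hL⟩ f
  have hRiesz : IsRieszTransform j R := fun f => by
    rw [hRL]
    exact (hmem f).coeFn_toLp
  refine ⟨R, hRiesz, fun f φ => ?_⟩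
  obtain ⟨Λ₁, h1⟩ := exists_pairing (q := q) hp.2.ne hδ φ.continuous.aestronglyMeasurable (by
    have := ((wmul (δ / p.toReal) φ).memLp q volume).2.ne
    convert! this using 3
    exact (wmul_apply _ _ _).symm)
  obtain ⟨Λ₂, h2⟩ := exists_pairing (q := q) hp.2.ne hδ
    (continuous_rieszSchwartz j φ).aestronglyMeasurable
    (eLpNorm_weight_rieszSchwartz_ne_top hpq hC H φ)
  rw [← h1, ← h2]
  -- Both sides are continuous in `f`, so it suffices to compare them on Schwartz functions, where
  -- the identity is the antisymmetry of the form.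
  refine congrFun (hd.equalizer (Λ₁.continuous.comp R.continuous) Λ₂.continuous.neg ?_) f
  funext g
  have e1 : ⇑g =ᵐ[volume] g.toLp p (weightMeasure δ) :=
    (volume_ac_weightMeasure δ).ae_le (g.coeFn_toLp p (weightMeasure δ)).symm
  have e2 := (volume_ac_weightMeasure δ).ae_le (hRiesz g)
  simp only [Function.comp_apply, SchwartzMap.toLpCLM_apply, Pi.neg_apply]
  rw [h1, h2]
  have e3 := integral_rieszSchwartz_mul_eq_neg j g φ
  refine Eq.trans (integral_congr_ae ?_) (e3.trans (congrArg Neg.neg (integral_congr_ae ?_)))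
  · filter_upwards [e2] with x hx
    rw [hx]
  · filter_upwards [e1] with x hx
    rw [hx]

/-- The adjoint relation moves the outer operator onto `lap φ`. It cannot be used a second time,
because `R_i (lap φ)` is no longer a Schwartz test function in general; the inner operator is
handled by density in `f` and Plancherel. -/
theorem integral_riesz_riesz_lap {p q : ℝ≥0∞} [Fact (1 ≤ p)] [p.HolderConjugate q]
    (hpq : p.toReal.HolderConjugate q.toReal) {δ C : ℝ} (hδ : 0 ≤ δ) {i j : Fin 3} (hC : 0 ≤ C)
    (H : RieszBound p.toReal q.toReal (δ / p.toReal) i C)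
    {R R' : Lp ℝ p (weightMeasure δ) →L[ℝ] Lp ℝ p (weightMeasure δ)}
    (hR : ∀ (f : Lp ℝ p (weightMeasure δ)) (φ : 𝓢(R3, ℝ)),
        ∫ x, R f x * φ x = -∫ x, f x * rieszSchwartz i φ x)
    (hR' : IsRieszTransform j R')
    (f : Lp ℝ p (weightMeasure δ)) (φ : 𝓢(R3, ℝ)) :
    ∫ x, R (R' f) x * lap φ x = -∫ x, f x * ∂_{e i} (∂_{e j} φ) x := by
  have hp := ENNReal.toReal_pos_iff.1 hpq.pos
  have hd := SchwartzMap.denseRange_toLpCLM (E := R3) (F := ℝ) hp.2.ne (μ := weightMeasure δ)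
  rw [hR]
  congr 1
  obtain ⟨Λ₁, h1⟩ := exists_pairing (q := q) hp.2.ne hδ
    (continuous_rieszSchwartz i (lap φ)).aestronglyMeasurable
    (eLpNorm_weight_rieszSchwartz_ne_top hpq hC H (lap φ))
  obtain ⟨Λ₂, h2⟩ := exists_pairing (q := q) hp.2.ne hδ
    (∂_{e i} (∂_{e j} φ)).continuous.aestronglyMeasurable (by
    have := ((wmul (δ / p.toReal) (∂_{e i} (∂_{e j} φ))).memLp q volume).2.ne
    convert! this using 3
    exact (wmul_apply _ _ _).symm)
  rw [← h1, ← h2]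
  refine congrFun (hd.equalizer (Λ₁.continuous.comp R'.continuous) Λ₂.continuous ?_) f
  funext g
  have e1 : ⇑g =ᵐ[volume] g.toLp p (weightMeasure δ) :=
    (volume_ac_weightMeasure δ).ae_le (g.coeFn_toLp p (weightMeasure δ)).symm
  have e2 := (volume_ac_weightMeasure δ).ae_le (hR' g)
  simp only [Function.comp_apply, SchwartzMap.toLpCLM_apply]
  rw [h1, h2]
  refine Eq.trans (integral_congr_ae ?_)
    ((integral_rieszSchwartz_mul_rieszSchwartz_lap i j g φ).trans (integral_congr_ae ?_))
  · filter_upwards [e2] with x hx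
    rw [hx]
  · filter_upwards [e1] with x hx
    rw [hx]

instance holderConjugate_six_fifths : ENNReal.HolderConjugate (6 / 5) 6 := by
  have h := (Real.holderConjugate_iff.2 ⟨by norm_num, by norm_num⟩ :
    (6 / 5 : ℝ).HolderConjugate 6).ennrealOfReal
  rwa [ENNReal.ofReal_div_of_pos (by norm_num), ENNReal.ofReal_ofNat, ENNReal.ofReal_ofNat] at h

/-- The Riesz transforms on the two spaces of interest, and the formula `R_i R_j Δ = -∂_i ∂_j`. -/
theorem exists_riesz_two {γ : ℝ} (hγ : 0 < γ) (hγ' : γ < 5 / 2) :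
    ∃ S : Fin 3 → Lp ℝ 2 (weightMeasure γ) →L[ℝ] Lp ℝ 2 (weightMeasure γ),
      (∀ j, IsRieszTransform j (S j)) ∧ ∀ i j f (φ : 𝓢(R3, ℝ)),
        ∫ x, S i (S j f) x * lap φ x = -∫ x, f x * ∂_{e i} (∂_{e j} φ) x := by
  have hpq : (2 : ℝ≥0∞).toReal.HolderConjugate (2 : ℝ≥0∞).toReal := by
    simpa using Real.HolderConjugate.two_two
  have hb : ∀ j, ∃ C, 0 ≤ C ∧
      RieszBound (2 : ℝ≥0∞).toReal (2 : ℝ≥0∞).toReal (γ / (2 : ℝ≥0∞).toReal) j C := fun j => by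
    -- Here `s = γ/2` and `αp = αq = 3/2`, so the conditions are `3/2 + γ/2 < 3`, `γ/2 < 3/2` and
    -- `3/2 < 3`.
    refine exists_norm_mform_rsym_wmul_le (α := 3 / 4) hpq (by positivity) ?_ ?_ ?_ j zero_le_one
      fun f g => ?_
    · simp; linarith
    · simp; linarith
    · norm_num
    · simpa using norm_mform_le (norm_rsym_le j) f g
  choose C hC H using hb
  choose S hS1 hS2 using fun j => exists_isRieszTransform hpq hγ.le (hC j) (H j)
  exact ⟨S, hS1, fun i j f φ => integral_riesz_riesz_lap hpq hγ.le (hC i) (H i) (hS2 i) (hS1 j) f φ⟩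

theorem exists_riesz_six_fifths {γ : ℝ} (hγ : 0 < γ) (hγ' : γ < 5 / 2) :
    ∃ R : Fin 3 → Lp ℝ (6 / 5) (weightMeasure (6 * γ / 5)) →L[ℝ]
        Lp ℝ (6 / 5) (weightMeasure (6 * γ / 5)),
      (∀ j, IsRieszTransform j (R j)) ∧ ∀ i j f (φ : 𝓢(R3, ℝ)),
        ∫ x, R i (R j f) x * lap φ x = -∫ x, f x * ∂_{e i} (∂_{e j} φ) x := by
  have e1 : (6 / 5 : ℝ≥0∞).toReal = 6 / 5 := by simp
  have e2 : (6 : ℝ≥0∞).toReal = 6 := by simp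
  have hpq' : (6 / 5 : ℝ).HolderConjugate 6 := Real.holderConjugate_iff.2 ⟨by norm_num, by norm_num⟩
  have hpq : (6 / 5 : ℝ≥0∞).toReal.HolderConjugate (6 : ℝ≥0∞).toReal := by rwa [e1, e2]
  have hb : ∀ j, ∃ C, 0 ≤ C ∧ RieszBound (6 / 5 : ℝ≥0∞).toReal (6 : ℝ≥0∞).toReal
      (6 * γ / 5 / (6 / 5 : ℝ≥0∞).toReal) j C := fun j => by
    obtain ⟨K, hK, hKb⟩ := exists_norm_mform_rsym_le_six hpq'.symm j
    have e3 : 6 * γ / 5 / (6 / 5) = γ := by ring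
    rw [e1, e2, e3]
    -- Here `s = γ`, `αp = 1/2` and `αq = 5/2`: both conditions involving `γ` become exactly `γ <
    -- 5/2`.
    refine exists_norm_mform_rsym_wmul_le (α := 5 / 12) hpq' hγ.le (by linarith) (by linarith)
      (by norm_num) j hK fun f g => ?_
    -- Antisymmetry exchanges the arguments, so the `L^6` bound is also the `L^{6/5}` bound.
    rw [mform_rsym_symm, norm_neg]
    exact (hKb g f).trans (le_of_eq (by ring))
  choose C hC H using hb
  choose S hS1 hS2 using fun j => exists_isRieszTransform hpq (by positivity) (hC j) (H j)
  exact ⟨S, hS1, fun i j f φ =>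
    integral_riesz_riesz_lap hpq (by positivity) (hC i) (H i) (hS2 i) (hS1 j) f φ⟩

/-! ### The spaces `L^r((0,T), L^p(w_δ))` -/

theorem restrict_slab (T : ℝ) : (volume.restrict (slab T : Set (ℝ × R3)) : Measure (ℝ × R3)) =
    (volume.restrict (Ioo 0 T)).prod volume := by
  have : (slab T : Set (ℝ × R3)) = Ioo 0 T ×ˢ univ := rfl
  rw [this, Measure.volume_eq_prod, ← Measure.prod_restrict, Measure.restrict_univ]

theorem MemLL.exists_stronglyMeasurable {V : Type*} [NormedAddCommGroup V] {r p : ℝ≥0∞} {δ T : ℝ}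
    {f : ℝ → R3 → V} (hf : MemLL r p δ T f) : ∃ g : ℝ × R3 → V, StronglyMeasurable g ∧
      ∀ᵐ t ∂(volume.restrict (Ioo 0 T)), f t =ᵐ[weightMeasure δ] fun x => g (t, x) := by
  have h1 := hf.1
  rw [restrict_slab] at h1
  refine ⟨h1.mk _, h1.stronglyMeasurable_mk, ?_⟩
  have h2 := Measure.ae_ae_of_ae_prod h1.ae_eq_mk
  filter_upwards [h2] with t ht
  exact (weightMeasure_ac_volume δ).ae_le ht

theorem measurable_eLpNorm_slice {V : Type*} [NormedAddCommGroup V] {p : ℝ≥0∞} (hp0 : p ≠ 0)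
    (hp : p ≠ ⊤) {μ : Measure R3} [SFinite μ] {g : ℝ × R3 → V} (hg : StronglyMeasurable g) :
    Measurable fun t => eLpNorm (fun x => g (t, x)) p μ := by
  simp_rw [eLpNorm_eq_lintegral_rpow_enorm_toReal hp0 hp]
  have := hg.enorm
  exact (Measurable.lintegral_prod_right' (f := fun z : ℝ × R3 => ‖g z‖ₑ ^ p.toReal)
    (by fun_prop)).pow_const _

theorem MemLL.aemeasurable_eLpNorm {V : Type*} [NormedAddCommGroup V] {r p : ℝ≥0∞} (hp0 : p ≠ 0)
    (hp : p ≠ ⊤) {δ T : ℝ} {f : ℝ → R3 → V} (hf : MemLL r p δ T f) :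
    AEMeasurable (fun t => eLpNorm (f t) p (weightMeasure δ)) (volume.restrict (Ioo 0 T)) := by
  obtain ⟨g, hg, hfg⟩ := hf.exists_stronglyMeasurable
  refine ⟨_, measurable_eLpNorm_slice hp0 hp (μ := weightMeasure δ) hg, ?_⟩
  filter_upwards [hfg] with t ht
  exact eLpNorm_congr_ae ht

theorem ae_lt_top_of_eLpNorm_lt_top {α : Type*} [MeasurableSpace α] {μ : Measure α} {r : ℝ≥0∞}
    (hr : r ≠ 0) {g : α → ℝ≥0∞} (hg : AEMeasurable g μ) (h : eLpNorm g r μ < ⊤) :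
    ∀ᵐ t ∂μ, g t < ⊤ := by
  rcases eq_or_ne r ⊤ with rfl | hr'
  · rw [eLpNorm_exponent_top] at h
    filter_upwards [ae_le_eLpNormEssSup (f := g) (μ := μ)] with t ht
    exact ht.trans_lt h
  · have h1 := lintegral_rpow_enorm_lt_top_of_eLpNorm_lt_top hr hr' h
    filter_upwards [ae_lt_top' (by fun_prop) h1.ne] with t ht
    exact (ENNReal.rpow_lt_top_iff_of_pos (ENNReal.toReal_pos hr hr')).1 ht

theorem MemLL.ae_memLp {V : Type*} [NormedAddCommGroup V] {r p : ℝ≥0∞} (hr : r ≠ 0) (hp0 : p ≠ 0)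
    (hp : p ≠ ⊤) {δ T : ℝ} {f : ℝ → R3 → V} (hf : MemLL r p δ T f) :
    ∀ᵐ t ∂(volume.restrict (Ioo 0 T)), MemLp (f t) p (weightMeasure δ) := by
  obtain ⟨g, hg, hfg⟩ := hf.exists_stronglyMeasurable
  filter_upwards [ae_lt_top_of_eLpNorm_lt_top hr (hf.aemeasurable_eLpNorm hp0 hp) hf.2, hfg]
    with t ht h2
  exact ⟨⟨_, hg.comp_measurable measurable_prodMk_left, h2⟩, ht⟩

instance sigmaFinite_weightMeasure (δ : ℝ) : SigmaFinite (weightMeasure δ) := by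
  have : IsLocallyFiniteMeasure (weightMeasure δ) :=
    IsLocallyFiniteMeasure.withDensity_ofReal (continuous_weight δ)
  infer_instance

theorem summable_geometric_enn (C : ℝ≥0∞) (hC : C ≠ ⊤) :
    ∑' n : ℕ, C * (2⁻¹ : ℝ≥0∞) ^ n ≠ ⊤ := by
  rw [ENNReal.tsum_mul_left, ENNReal.tsum_geometric]
  refine ENNReal.mul_ne_top hC ?_
  simp

/-- Geometric convergence in `L^p` is summable and forces the whole sequence to converge almost
everywhere; a subsequence converging in measure serves only to identify the limit. The `+ 1` in the
summable bound supplies a strict inequality. -/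
theorem ae_tendsto_of_edist_lt {p : ℝ≥0∞} [Fact (1 ≤ p)] {μ : Measure R3} {F : ℕ → Lp ℝ p μ}
    {f : Lp ℝ p μ} {C : ℝ≥0∞} (hC : C ≠ ⊤) (h : ∀ n, edist (F n) f ≤ C * 2⁻¹ ^ n) :
    ∀ᵐ x ∂μ, Filter.Tendsto (fun n => F n x) Filter.atTop (nhds (f x)) := by
  have hlim : Filter.Tendsto F Filter.atTop (nhds f) := by
    rw [tendsto_iff_edist_tendsto_0]
    refine tendsto_of_tendsto_of_tendsto_of_le_of_le tendsto_const_nhds ?_ (fun _ => zero_le) h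
    have := ENNReal.Tendsto.const_mul (a := C) (ENNReal.tendsto_pow_atTop_nhds_zero_of_lt_one
      (by simp : (2⁻¹ : ℝ≥0∞) < 1)) (Or.inr hC)
    simpa using this
  obtain ⟨ns, hns, hae⟩ := (tendstoInMeasure_of_tendsto_Lp hlim).exists_seq_tendsto_ae
  have h2 := Lp.ae_tendsto_of_cauchy_eLpNorm (fun n => Lp.aestronglyMeasurable (F n))
    (Fact.out : 1 ≤ p) (B := fun n => (2 * C + 1) * 2⁻¹ ^ n)
    (summable_geometric_enn _ (by finiteness)) fun N n m hn hm => by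
      rw [← Lp.edist_def]
      have hmono : ∀ k, N ≤ k → C * (2⁻¹ : ℝ≥0∞) ^ k ≤ C * 2⁻¹ ^ N := fun k hk =>
        mul_le_mul_right (pow_le_pow_right_of_le_one' (by simp) hk) C
      calc edist (F n) (F m) ≤ edist (F n) f + edist (F m) f := edist_triangle_right _ _ _
        _ ≤ C * 2⁻¹ ^ N + C * 2⁻¹ ^ N :=
            add_le_add ((h n).trans (hmono n hn)) ((h m).trans (hmono m hm))
        _ = 2 * C * 2⁻¹ ^ N := by ring
        _ < (2 * C + 1) * 2⁻¹ ^ N := by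
            rw [add_mul, one_mul]
            refine ENNReal.lt_add_right (by finiteness) ?_
            exact (ENNReal.pow_pos (by simp) N).ne'
  filter_upwards [hae, h2] with x hx ⟨l, hl⟩
  rwa [tendsto_nhds_unique hx (hl.comp hns.tendsto_atTop)]

/-- A jointly measurable representative of `t ↦ A (f t)` for a bounded operator `A`. -/
theorem MemLL.exists_clm_apply {r p : ℝ≥0∞} [Fact (1 ≤ p)] (hr : r ≠ 0) (hp : p ≠ ⊤)
    {δ T : ℝ} {f : ℝ → R3 → ℝ} (hf : MemLL r p δ T f)
    (A : Lp ℝ p (weightMeasure δ) →L[ℝ] Lp ℝ p (weightMeasure δ)) :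
    ∃ P : ℝ → R3 → ℝ, MemLL r p δ T P ∧ ∀ᵐ t ∂(volume.restrict (Ioo 0 T)),
      ∃ h : MemLp (f t) p (weightMeasure δ), P t =ᵐ[weightMeasure δ] A (h.toLp _) := by
  have hp0 : p ≠ 0 := (one_pos.trans_le Fact.out).ne'
  have : Fact (p ≠ ⊤) := ⟨hp⟩
  obtain ⟨g, hg, hfg⟩ := hf.exists_stronglyMeasurable
  set d : ℕ → Lp ℝ p (weightMeasure δ) := denseSeq _ with hd
  -- Each `f t` is replaced by the first member of a dense sequence within `2⁻ⁿ` of it. The index `K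
  -- n t` is measurable in `t` and takes countably many values, so applying `A` keeps joint
  -- measurability.
  let S : ℕ → ℕ → Set ℝ := fun n k =>
    {t | eLpNorm (fun x => g (t, x) - d k x) p (weightMeasure δ) < 2⁻¹ ^ n}
  have hS : ∀ n k, MeasurableSet (S n k) := fun n k =>
    measurableSet_lt (measurable_eLpNorm_slice hp0 hp (g := fun z : ℝ × R3 => g z - d k z.2)
      (hg.sub ((Lp.stronglyMeasurable (d k)).comp_measurable measurable_snd))) measurable_const
  -- The complement is added so that the search for `k` succeeds for every `t`, including the
  -- exceptional times where `f t` is not in the space.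
  have hex : ∀ n t, ∃ k, t ∈ S n k ∪ (⋃ k, S n k)ᶜ := fun n t => by
    by_cases h : t ∈ ⋃ k, S n k
    · obtain ⟨k, hk⟩ := mem_iUnion.1 h
      exact ⟨k, Or.inl hk⟩
    · exact ⟨0, Or.inr h⟩
  classical
  let K : ℕ → ℝ → ℕ := fun n t => Nat.find (hex n t)
  have hK : ∀ n, Measurable (K n) := fun n =>
    measurable_find (hex n) fun k => (hS n k).union (MeasurableSet.iUnion (hS n)).compl
  let Q : ℕ → ℝ × R3 → ℝ := fun n z => A (d (K n z.1)) z.2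
  have hQ : ∀ n, StronglyMeasurable (Q n) := fun n => by
    have h1 : Measurable fun z : ℕ × R3 => A (d z.1) z.2 :=
      measurable_from_prod_countable_right fun k => (Lp.stronglyMeasurable (A (d k))).measurable
    have h2 : Measurable fun z : ℝ × R3 => (K n z.1, z.2) :=
      ((hK n).comp measurable_fst).prodMk measurable_snd
    exact (h1.comp h2).stronglyMeasurable
  let P : ℝ → R3 → ℝ := fun t x => Filter.limUnder Filter.atTop fun n => Q n (t, x)
  have hP : StronglyMeasurable fun z : ℝ × R3 => P z.1 z.2 := StronglyMeasurable.limUnder hQ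
  have hPA : ∀ᵐ t ∂(volume.restrict (Ioo 0 T)),
      ∃ h : MemLp (f t) p (weightMeasure δ), P t =ᵐ[weightMeasure δ] A (h.toLp _) := by
    filter_upwards [hf.ae_memLp hr hp0 hp, hfg] with t ht htg
    refine ⟨ht, ?_⟩
    have hdist : ∀ k, edist (d k) (ht.toLp _) =
        eLpNorm (fun x => g (t, x) - d k x) p (weightMeasure δ) := fun k => by
      rw [edist_comm, Lp.edist_def]
      refine eLpNorm_congr_ae ?_
      filter_upwards [ht.coeFn_toLp, htg] with x h1 h2
      rw [Pi.sub_apply, h1, h2]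
    have hKt : ∀ n, edist (d (K n t)) (ht.toLp _) ≤ 2⁻¹ ^ n := fun n => by
      have hmem : t ∈ ⋃ k, S n k := by
        obtain ⟨_, ⟨k, rfl⟩, hk⟩ := EMetric.mem_closure_iff.1
          (denseRange_denseSeq (Lp ℝ p (weightMeasure δ)) (ht.toLp _)) (2⁻¹ ^ n)
          (ENNReal.pow_pos (by simp : (0 : ℝ≥0∞) < 2⁻¹) n)
        rw [edist_comm] at hk
        exact mem_iUnion.2 ⟨k, (hdist k).symm.trans_lt hk⟩
      have hspec := Nat.find_spec (hex n t)
      rcases hspec with h | h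
      · rw [hdist]; exact le_of_lt h
      · exact absurd hmem h
    have hlim := ae_tendsto_of_edist_lt (F := fun n => A (d (K n t))) (f := A (ht.toLp _))
      (C := ‖A‖ₑ) (by simp) fun n => by
        rw [edist_eq_enorm_sub, ← map_sub]
        refine (A.le_opENorm _).trans ?_
        rw [← edist_eq_enorm_sub]
        gcongr
        exact hKt n
    filter_upwards [hlim] with x hx
    exact hx.limUnder_eq
  refine ⟨P, ⟨hP.aestronglyMeasurable, ?_⟩, hPA⟩
  refine lt_of_le_of_lt (eLpNorm_le_nnreal_smul_eLpNorm_of_ae_le_mul' (c := ‖A‖₊)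
    (g := fun t => eLpNorm (f t) p (weightMeasure δ)) ?_ r) (ENNReal.mul_lt_top (by simp) hf.2)
  filter_upwards [hPA] with t ⟨h, ht⟩
  rw [enorm_eq_self, enorm_eq_self, eLpNorm_congr_ae ht, ← Lp.enorm_def, ← Lp.enorm_toLp (hf := h)]
  exact A.le_opENorm _

theorem eLpNorm_weightMeasure {p : ℝ≥0∞} (hp0 : p ≠ 0) (hp : p ≠ ⊤) (δ : ℝ) (f : R3 → ℝ) :
    eLpNorm f p (weightMeasure δ) = eLpNorm (fun x => weight (δ / p.toReal) x * f x) p volume := by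
  have hpr := ENNReal.toReal_pos hp0 hp
  rw [eLpNorm_eq_lintegral_rpow_enorm_toReal hp0 hp, eLpNorm_eq_lintegral_rpow_enorm_toReal hp0 hp,
    lintegral_weightMeasure]
  congr 1
  refine lintegral_congr fun x => ?_
  rw [enorm_mul, ENNReal.mul_rpow_of_nonneg _ _ hpr.le, Real.enorm_of_nonneg (weight_nonneg _ _),
    ENNReal.ofReal_rpow_of_nonneg (weight_nonneg _ _) hpr.le]
  unfold weight
  rw [← Real.rpow_mul (by positivity), neg_mul, div_mul_cancel₀ _ hpr.ne']

theorem MemLL.of_le {V W : Type*} [NormedAddCommGroup V] [NormedAddCommGroup W] {r p : ℝ≥0∞}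
    {δ T : ℝ} {f : ℝ → R3 → V} {g : ℝ → R3 → W} (hf : MemLL r p δ T f)
    (hg : AEStronglyMeasurable (fun z : ℝ × R3 => g z.1 z.2)
      (volume.restrict (slab T : Set (ℝ × R3)))) (h : ∀ t x, ‖g t x‖ ≤ ‖f t x‖) :
    MemLL r p δ T g := by
  refine ⟨hg, lt_of_le_of_lt (eLpNorm_mono_enorm fun t => ?_) hf.2⟩
  rw [enorm_eq_self, enorm_eq_self]
  exact eLpNorm_mono (h t)

theorem MemLL.coord {r p : ℝ≥0∞} {δ T : ℝ} {f : ℝ → R3 → R3} (hf : MemLL r p δ T f) (i : Fin 3) :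
    MemLL r p δ T fun t x => f t x i :=
  hf.of_le ((continuous_coord i).comp_aestronglyMeasurable hf.1) fun t x => by
    rw [Real.norm_eq_abs]; exact abs_coord_le _ _

theorem MemLL.add {r p : ℝ≥0∞} (hr : 1 ≤ r) (hp : 1 ≤ p) (hp' : p ≠ ⊤) {δ T : ℝ}
    {f g : ℝ → R3 → ℝ} (hf : MemLL r p δ T f) (hg : MemLL r p δ T g) :
    MemLL r p δ T fun t x => f t x + g t x := by
  have hp0 : p ≠ 0 := (one_pos.trans_le hp).ne'
  have hr0 : r ≠ 0 := (one_pos.trans_le hr).ne'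
  refine ⟨hf.1.add hg.1, ?_⟩
  have h1 : ∀ᵐ t ∂(volume.restrict (Ioo 0 T)),
      ‖eLpNorm (fun x => f t x + g t x) p (weightMeasure δ)‖ₑ ≤
      ‖eLpNorm (f t) p (weightMeasure δ) + eLpNorm (g t) p (weightMeasure δ)‖ₑ := by
    filter_upwards [hf.ae_memLp hr0 hp0 hp', hg.ae_memLp hr0 hp0 hp'] with t h1 h2
    exact eLpNorm_add_le h1.1 h2.1 hp
  refine (eLpNorm_mono_enorm_ae h1).trans_lt
    ((eLpNorm_add_le ((hf.aemeasurable_eLpNorm hp0 hp').aestronglyMeasurable)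
      ((hg.aemeasurable_eLpNorm hp0 hp').aestronglyMeasurable) hr).trans_lt ?_)
  exact ENNReal.add_lt_top.2 ⟨hf.2, hg.2⟩

theorem memLL_zero {r p : ℝ≥0∞} {δ T : ℝ} : MemLL r p δ T fun _ (_ : R3) => (0 : ℝ) := by
  refine ⟨aestronglyMeasurable_const, ?_⟩
  simp

theorem MemLL.sum {ι : Type*} {r p : ℝ≥0∞} (hr : 1 ≤ r) (hp : 1 ≤ p) (hp' : p ≠ ⊤) {δ T : ℝ}
    {f : ι → ℝ → R3 → ℝ} (s : Finset ι) (hf : ∀ i, MemLL r p δ T (f i)) :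
    MemLL r p δ T fun t x => ∑ i ∈ s, f i t x := by
  classical
  induction s using Finset.induction_on with
  | empty => simpa using memLL_zero
  | insert a s ha ih =>
    simp_rw [Finset.sum_insert ha]
    exact (hf a).add hr hp hp' ih

/-- Hölder in space with `5/6 = 1/2 + 1/3`. The weights match because, once absorbed into the
functions, they have exponents `γ/2` for `u`, `γ/2` for `b` and `γ` for the product. -/
theorem MemLL.mul {γ T : ℝ} {b u : ℝ → R3 → ℝ} (hb : MemLL 3 3 (3 * γ / 2) T b)
    (hu : MemLL ⊤ 2 γ T u) : MemLL 3 (6 / 5) (6 * γ / 5) T fun t x => b t x * u t x := by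
  refine ⟨hb.1.mul hu.1, ?_⟩
  have : ENNReal.HolderTriple 2 3 (6 / 5) := ⟨by
    rw [ENNReal.inv_div (by simp) (by simp), ← ENNReal.toReal_eq_toReal_iff' (by simp)
      (ENNReal.div_ne_top (by simp) (by simp)), ENNReal.toReal_add (by simp) (by simp)]
    simp
    norm_num⟩
  have h65 : (6 / 5 : ℝ≥0∞) ≠ ⊤ := ENNReal.div_ne_top (by simp) (by simp)
  have hu1 := hu.2
  rw [eLpNorm_exponent_top] at hu1
  have h1 : ∀ᵐ t ∂(volume.restrict (Ioo 0 T)),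
      ‖eLpNorm (fun x => b t x * u t x) (6 / 5) (weightMeasure (6 * γ / 5))‖ₑ ≤
      ((eLpNormEssSup (fun t => eLpNorm (u t) 2 (weightMeasure γ))
        (volume.restrict (Ioo 0 T))).toNNReal : ℝ≥0∞) *
          ‖eLpNorm (b t) 3 (weightMeasure (3 * γ / 2))‖ₑ := by
    filter_upwards [hb.ae_memLp (by simp) (by simp) (by simp),
      hu.ae_memLp (by simp) (by simp) (by simp),
      ae_le_eLpNormEssSup (f := fun t => eLpNorm (u t) 2 (weightMeasure γ))
        (μ := volume.restrict (Ioo 0 T))] with t h1 h2 h3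
    rw [ENNReal.coe_toNNReal hu1.ne]
    refine le_trans ?_ (mul_le_mul_left h3 _)
    simp only [enorm_eq_self]
    rw [eLpNorm_weightMeasure (by simp) h65, eLpNorm_weightMeasure (by simp) (by simp),
      eLpNorm_weightMeasure (by simp) (by simp)]
    have hw : ∀ δ : ℝ, AEStronglyMeasurable (weight δ) (volume : Measure R3) := fun δ =>
      (continuous_weight δ).aestronglyMeasurable
    have h4 := eLpNorm_smul_le_mul_eLpNorm (p := 2) (q := 3) (r := 6 / 5) (μ := volume)
      ((hw (3 * γ / 2 / 3)).mul (h1.1.mono_ac (volume_ac_weightMeasure _)))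
      ((hw (γ / 2)).mul (h2.1.mono_ac (volume_ac_weightMeasure _)))
    refine le_trans (le_of_eq ?_) h4
    congr 1
    ext x
    simp only [Pi.smul_apply', Pi.mul_apply, smul_eq_mul]
    have : weight (γ / 2) x * weight (3 * γ / 2 / 3) x =
        weight (6 * γ / 5 / (6 / 5 : ℝ≥0∞).toReal) x := by
      unfold weight
      rw [← Real.rpow_add (by positivity)]
      congr 1
      simp
      ring
    rw [← this]
    ring
  exact (eLpNorm_le_nnreal_smul_eLpNorm_of_ae_le_mul' h1 3).trans_lt
    (ENNReal.mul_lt_top (by simp) hb.2)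

/-! ### Local estimates -/

theorem eLpNorm_closedBall_le {a p : ℝ≥0∞} (hap : a ≤ p) (hp0 : p ≠ 0) (hp : p ≠ ⊤)
    {δ : ℝ} (hδ : 0 ≤ δ) {R : ℝ} (hR : 0 ≤ R) {f : R3 → ℝ} (hf : MemLp f p (weightMeasure δ)) :
    eLpNorm f a (volume.restrict (Metric.closedBall 0 R)) ≤
      (ENNReal.ofReal ((1 + R) ^ (δ / p.toReal)) *
        volume (Metric.closedBall (0 : R3) R) ^ (1 / a.toReal - 1 / p.toReal)) *
      eLpNorm f p (weightMeasure δ) := by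
  have hpr := ENNReal.toReal_pos hp0 hp
  have hf' := hf.1.mono_ac (volume_ac_weightMeasure δ)
  set s := δ / p.toReal with hs
  have hs0 : 0 ≤ s := by positivity
  have hwf : AEStronglyMeasurable (fun x => weight s x * f x) volume :=
    (continuous_weight s).aestronglyMeasurable.mul hf'
  have h1 : ∀ᵐ x ∂(volume.restrict (Metric.closedBall (0 : R3) R)),
      ‖f x‖ₑ ≤ (((1 + R) ^ s).toNNReal : ℝ≥0∞) * ‖weight s x * f x‖ₑ := by
    filter_upwards [ae_restrict_mem Metric.isClosed_closedBall.measurableSet] with x hx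
    rw [Metric.mem_closedBall, dist_zero_right] at hx
    have h2 : 1 ≤ (1 + R) ^ s * weight s x := by
      unfold weight
      rw [Real.rpow_neg (by positivity), ← div_eq_mul_inv, one_le_div (by positivity)]
      gcongr
    rw [enorm_mul, ← mul_assoc, Real.enorm_of_nonneg (weight_nonneg _ _)]
    change _ ≤ ENNReal.ofReal _ * _ * _
    rw [← ENNReal.ofReal_mul (by positivity)]
    exact le_mul_of_one_le_left zero_le (by simpa using h2)
  refine (eLpNorm_le_nnreal_smul_eLpNorm_of_ae_le_mul' h1 a).trans ?_
  rw [ENNReal.smul_def, smul_eq_mul, mul_assoc]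
  change ENNReal.ofReal _ * _ ≤ _
  gcongr
  refine (eLpNorm_le_eLpNorm_mul_rpow_measure_univ hap hwf.restrict).trans ?_
  rw [Measure.restrict_apply_univ, mul_comm, eLpNorm_weightMeasure hp0 hp]
  gcongr
  exact Measure.restrict_le_self

theorem MemLL.exists_eLpNorm_le {a r p : ℝ≥0∞} (ha : a ≠ 0) (har : a ≤ r) (hap : a ≤ p)
    (hp : p ≠ ⊤) {δ T : ℝ} (hδ : 0 ≤ δ) {f : ℝ → R3 → ℝ} (hf : MemLL r p δ T f) :
    ∃ K : ℝ≥0∞, K ≠ ⊤ ∧ ∀ R : ℝ, 0 ≤ R → eLpNorm (fun z : ℝ × R3 => f z.1 z.2) a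
      (volume.restrict (Ioo 0 T ×ˢ Metric.closedBall 0 R)) ≤
      (ENNReal.ofReal ((1 + R) ^ (δ / p.toReal)) *
        volume (Metric.closedBall (0 : R3) R) ^ (1 / a.toReal - 1 / p.toReal)) * K := by
  have hp0 : p ≠ 0 := ((pos_iff_ne_zero.2 ha).trans_le hap).ne'
  have hr0 : r ≠ 0 := ((pos_iff_ne_zero.2 ha).trans_le har).ne'
  have ha' : a ≠ ⊤ := ne_top_of_le_ne_top hp hap
  have hapos := ENNReal.toReal_pos ha ha'
  have hppos := ENNReal.toReal_pos hp0 hp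
  have hm := hf.aemeasurable_eLpNorm hp0 hp
  refine ⟨eLpNorm (fun t => eLpNorm (f t) p (weightMeasure δ)) a (volume.restrict (Ioo 0 T)),
    ?_, fun R hR => ?_⟩
  · refine ((eLpNorm_le_eLpNorm_mul_rpow_measure_univ har hm.aestronglyMeasurable).trans_lt
      (ENNReal.mul_lt_top hf.2 ?_)).ne
    refine ENNReal.rpow_lt_top_of_nonneg ?_ (by simp)
    rcases eq_or_ne r ⊤ with rfl | hr
    · simp
    · rw [sub_nonneg]
      exact one_div_le_one_div_of_le hapos (ENNReal.toReal_mono hr har)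
  · have hvol : volume (Metric.closedBall (0 : R3) R) ≠ ⊤ := measure_closedBall_lt_top.ne
    set C := ENNReal.ofReal ((1 + R) ^ (δ / p.toReal)) *
        volume (Metric.closedBall (0 : R3) R) ^ (1 / a.toReal - 1 / p.toReal) with hC
    have hCt : C ≠ ⊤ := by
      refine ENNReal.mul_ne_top (by simp) (ENNReal.rpow_ne_top_of_nonneg ?_ hvol)
      rw [sub_nonneg]
      exact one_div_le_one_div_of_le hapos (ENNReal.toReal_mono hp hap)
    have e1 : eLpNorm (fun z : ℝ × R3 => f z.1 z.2) a
        (volume.restrict (Ioo 0 T ×ˢ Metric.closedBall 0 R)) =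
        eLpNorm (fun t => eLpNorm (f t) a (volume.restrict (Metric.closedBall (0 : R3) R))) a
          (volume.restrict (Ioo 0 T)) := by
      have hfm : AEStronglyMeasurable (fun z : ℝ × R3 => f z.1 z.2)
          ((volume.restrict (Ioo 0 T)).prod (volume.restrict (Metric.closedBall (0 : R3) R))) := by
        rw [Measure.prod_restrict]
        exact hf.1.mono_measure (Measure.restrict_mono (prod_mono subset_rfl (subset_univ _)) le_rfl)
      rw [eLpNorm_eq_lintegral_rpow_enorm_toReal ha ha', Measure.volume_eq_prod,
        ← Measure.prod_restrict, lintegral_prod _ (by fun_prop),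
        eLpNorm_eq_lintegral_rpow_enorm_toReal ha ha']
      congr 1
      refine lintegral_congr fun t => ?_
      rw [enorm_eq_self, eLpNorm_eq_lintegral_rpow_enorm_toReal ha ha', ← ENNReal.rpow_mul,
        one_div_mul_cancel hapos.ne', ENNReal.rpow_one]
    rw [e1]
    have h2 : ∀ᵐ t ∂(volume.restrict (Ioo 0 T)),
        ‖eLpNorm (f t) a (volume.restrict (Metric.closedBall (0 : R3) R))‖ₑ ≤
        (C.toNNReal : ℝ≥0∞) * ‖eLpNorm (f t) p (weightMeasure δ)‖ₑ := by
      filter_upwards [hf.ae_memLp hr0 hp0 hp] with t ht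
      rw [ENNReal.coe_toNNReal hCt]
      exact eLpNorm_closedBall_le hap hp0 hp hδ hR ht
    refine (eLpNorm_le_nnreal_smul_eLpNorm_of_ae_le_mul' h2 a).trans (le_of_eq ?_)
    rw [ENNReal.smul_def, smul_eq_mul, ENNReal.coe_toNNReal hCt]

theorem MemLL.eLpNorm_lt_top {a r p : ℝ≥0∞} (ha : a ≠ 0) (har : a ≤ r) (hap : a ≤ p)
    (hp : p ≠ ⊤) {δ T : ℝ} (hδ : 0 ≤ δ) {f : ℝ → R3 → ℝ} (hf : MemLL r p δ T f) (R : ℝ) :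
    eLpNorm (fun z : ℝ × R3 => f z.1 z.2) a
      (volume.restrict (Ioo 0 T ×ˢ Metric.closedBall 0 R)) < ⊤ := by
  obtain ⟨K, hK, H⟩ := hf.exists_eLpNorm_le ha har hap hp hδ
  have h1 := H (max R 0) (le_max_right _ _)
  have hsub : (Ioo 0 T ×ˢ Metric.closedBall (0 : R3) R) ⊆ Ioo 0 T ×ˢ Metric.closedBall 0 (max R 0) :=
    prod_mono subset_rfl (Metric.closedBall_subset_closedBall (le_max_left _ _))
  refine ((eLpNorm_mono_measure _ (Measure.restrict_mono hsub le_rfl)).trans h1).trans_lt ?_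
  refine ENNReal.mul_lt_top (ENNReal.mul_lt_top (by simp)
    (ENNReal.rpow_lt_top_of_nonneg ?_ measure_closedBall_lt_top.ne)) hK.lt_top
  rw [sub_nonneg]
  exact one_div_le_one_div_of_le (ENNReal.toReal_pos ha (ne_top_of_le_ne_top hp hap))
    (ENNReal.toReal_mono hp hap)

theorem MemLL.memLp {a r p : ℝ≥0∞} (ha : a ≠ 0) (har : a ≤ r) (hap : a ≤ p)
    (hp : p ≠ ⊤) {δ T : ℝ} (hδ : 0 ≤ δ) {f : ℝ → R3 → ℝ} (hf : MemLL r p δ T f) (R : ℝ) :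
    MemLp (fun z : ℝ × R3 => f z.1 z.2) a
      (volume.restrict (Ioo 0 T ×ˢ Metric.closedBall 0 R)) :=
  ⟨hf.1.mono_measure (Measure.restrict_mono (prod_mono subset_rfl (subset_univ _)) le_rfl),
    hf.eLpNorm_lt_top ha har hap hp hδ R⟩

/-- The spatial averages of `f` over `(0,T) × B_R` tend to `0` when `R → ∞`. -/
theorem MemLL.tendsto_average {r p : ℝ≥0∞} (hr : 1 ≤ r) (hp1 : 1 ≤ p) (hp : p ≠ ⊤) {δ T : ℝ}
    (hδ : 0 ≤ δ) (hδp : δ < 3) {f : ℝ → R3 → ℝ} (hf : MemLL r p δ T f) :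
    Filter.Tendsto (fun R : ℝ => (R ^ 3)⁻¹ *
      ∫ z in Ioo 0 T ×ˢ Metric.closedBall 0 R, ‖f z.1 z.2‖) Filter.atTop (nhds 0) := by
  obtain ⟨K, hK, H⟩ := hf.exists_eLpNorm_le one_ne_zero hr hp1 hp hδ
  have hpr : 1 ≤ p.toReal := by simpa using ENNReal.toReal_mono hp hp1
  have hp0 : 0 < p.toReal := by linarith
  set V := (volume (Metric.ball (0 : R3) 1)).toReal with hV
  -- The total power of `R`: `-3` from the normalisation, `δ/p` from the weight on the ball, and
  -- `3(1 - 1/p)` from Hölder. It is negative because `δ < 3`.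
  set κ : ℝ := (δ - 3) / p.toReal with hκ
  have hκ0 : κ < 0 := div_neg_of_neg_of_pos (by linarith) hp0
  have hb : ∀ R : ℝ, 1 ≤ R → (R ^ 3)⁻¹ * ∫ z in Ioo 0 T ×ˢ Metric.closedBall 0 R, ‖f z.1 z.2‖ ≤
      R ^ κ * (2 ^ (δ / p.toReal) * V ^ (1 - 1 / p.toReal) * K.toReal) := by
    intro R hR
    have hR0 : 0 < R := by linarith
    have h1 := H R hR0.le
    rw [eLpNorm_one_eq_lintegral_enorm, Measure.addHaar_closedBall _ _ hR0.le] at h1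
    have h2 := ENNReal.toReal_mono (by
      refine ENNReal.mul_ne_top (ENNReal.mul_ne_top (by simp)
        (ENNReal.rpow_ne_top_of_nonneg ?_ ?_)) hK
      · rw [ENNReal.toReal_one, sub_nonneg]
        exact one_div_le_one_div_of_le one_pos hpr
      · exact ENNReal.mul_ne_top (by simp) measure_ball_lt_top.ne) h1
    rw [← integral_norm_eq_lintegral_enorm
      (hf.memLp one_ne_zero hr hp1 hp hδ R).1, ENNReal.toReal_mul, ENNReal.toReal_mul,
      ENNReal.toReal_ofReal (by positivity), ← ENNReal.toReal_rpow, ENNReal.toReal_mul,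
      ENNReal.toReal_ofReal (by positivity), finrank_euclideanSpace_fin, ← hV,
      ENNReal.toReal_one, one_div_one, Real.mul_rpow (by positivity) (by positivity)] at h2
    have h3 : (1 + R) ^ (δ / p.toReal) ≤ 2 ^ (δ / p.toReal) * R ^ (δ / p.toReal) := by
      rw [← Real.mul_rpow (by norm_num) hR0.le]
      exact Real.rpow_le_rpow (by positivity) (by linarith) (by positivity)
    calc _ ≤ (R ^ 3)⁻¹ * ((2 ^ (δ / p.toReal) * R ^ (δ / p.toReal)) *
          ((R ^ 3) ^ (1 - 1 / p.toReal) * V ^ (1 - 1 / p.toReal)) * K.toReal) := by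
          gcongr
          exact h2.trans (by gcongr)
      _ = ((R ^ 3)⁻¹ * R ^ (δ / p.toReal) * (R ^ 3) ^ (1 - 1 / p.toReal)) *
          (2 ^ (δ / p.toReal) * V ^ (1 - 1 / p.toReal) * K.toReal) := by ring
      _ = _ := by
          congr 1
          rw [← Real.rpow_natCast, ← Real.rpow_neg hR0.le, ← Real.rpow_mul hR0.le,
            ← Real.rpow_add hR0, ← Real.rpow_add hR0, hκ]
          congr 1
          push_cast
          field_simp
          ring
  have hlim : Filter.Tendsto (fun R : ℝ => R ^ κ *
      (2 ^ (δ / p.toReal) * V ^ (1 - 1 / p.toReal) * K.toReal)) Filter.atTop (nhds 0) := by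
    have := (tendsto_rpow_neg_atTop (neg_pos.2 hκ0)).mul_const
      (2 ^ (δ / p.toReal) * V ^ (1 - 1 / p.toReal) * K.toReal)
    simpa using this
  refine tendsto_of_tendsto_of_tendsto_of_le_of_le' tendsto_const_nhds hlim ?_ ?_
  · filter_upwards [Filter.eventually_ge_atTop 1] with R hR
    have : 0 ≤ ∫ z in Ioo 0 T ×ˢ Metric.closedBall (0 : R3) R, ‖f z.1 z.2‖ :=
      integral_nonneg fun _ => norm_nonneg _
    positivity
  · filter_upwards [Filter.eventually_ge_atTop 1] with R hR
    exact hb R hR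

/-! ### Test functions and distributions on the slab -/

theorem test_lineDeriv_apply {T : ℝ} (φ : 𝓓(slab T, ℝ)) (m z : ℝ × R3) :
    (∂_{m} φ) z = fderiv ℝ φ z m := by
  rw [TestFunction.lineDerivOp_eq_lineDerivCLM (𝕜 := ℝ), TestFunction.lineDerivCLM_apply_of_le (by simp)]
  exact ((φ.contDiff.differentiable (by simp)) z).lineDeriv_eq_fderiv

theorem test_lineDeriv_comm {T : ℝ} (φ : 𝓓(slab T, ℝ)) (m n : ℝ × R3) :
    ∂_{m} (∂_{n} φ) = ∂_{n} (∂_{m} φ) := by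
  ext z
  have h : ∀ a b : ℝ × R3, (∂_{a} (∂_{b} φ)) z = fderiv ℝ (fderiv ℝ φ) z a b := fun a b => by
    rw [test_lineDeriv_apply]
    have e : ⇑(∂_{b} φ : 𝓓(slab T, ℝ)) = fun w => fderiv ℝ φ w b := by
      ext w; exact test_lineDeriv_apply φ b w
    have hd : DifferentiableAt ℝ (fderiv ℝ φ) z :=
      (((φ.contDiff.of_le (WithTop.coe_le_coe.2 le_top : ((2 : ℕ∞) : WithTop ℕ∞) ≤ _)).fderiv_right
        (m := 1) (by norm_num)).differentiable (by simp)) z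
    rw [e, fderiv_clm_apply hd (differentiableAt_const _)]
    simp
  rw [h, h]
  have hs : IsSymmSndFDerivAt ℝ φ z := by
    refine (φ.contDiff.contDiffAt).isSymmSndFDerivAt ?_
    simp only [minSmoothness_of_isRCLikeNormedField]
    exact (WithTop.coe_le_coe.2 le_top : ((2 : ℕ∞) : WithTop ℕ∞) ≤ _)
  exact hs m n

/-- Extension of a function on the slab by zero. -/
noncomputable def ext (T : ℝ) (f : ℝ → R3 → ℝ) : ℝ × R3 → ℝ :=
  (slab T : Set (ℝ × R3)).indicator fun z => f z.1 z.2

theorem measurableSet_slab (T : ℝ) : MeasurableSet (slab T : Set (ℝ × R3)) :=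
  (slab T).isOpen.measurableSet

theorem locallyIntegrableOn_of_ext {T : ℝ} {f : ℝ → R3 → ℝ} (hf : LocallyIntegrable (ext T f)) :
    LocallyIntegrableOn (fun z : ℝ × R3 => f z.1 z.2) (slab T : Set (ℝ × R3)) := by
  intro z _
  obtain ⟨U, hU, hi⟩ := hf z
  refine ⟨U ∩ (slab T : Set (ℝ × R3)), Filter.inter_mem (mem_nhdsWithin_of_mem_nhds hU)
    self_mem_nhdsWithin, ?_⟩
  have h1 := (integrableOn_indicator_iff (measurableSet_slab T)).1 hi
  rwa [inter_comm] at h1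

theorem test_eq_zero_of_notMem {T : ℝ} (φ : 𝓓(slab T, ℝ)) {z : ℝ × R3}
    (hz : z ∉ (slab T : Set (ℝ × R3))) : φ z = 0 :=
  image_eq_zero_of_notMem_tsupport fun h => hz (φ.tsupport_subset h)

theorem toDist_apply {T : ℝ} {f : ℝ → R3 → ℝ} (hf : LocallyIntegrable (ext T f))
    (φ : 𝓓(slab T, ℝ)) : toDist T f φ = ∫ z, φ z * ext T f z := by
  refine (TestFunction.integralAgainstBilinCLM_eq_integral (locallyIntegrableOn_of_ext hf)).trans ?_
  congr 1; ext z
  rw [ContinuousLinearMap.mul_apply']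
  by_cases hz : z ∈ (slab T : Set (ℝ × R3))
  · rw [ext, indicator_of_mem hz]
  · rw [test_eq_zero_of_notMem φ hz, zero_mul, zero_mul]

theorem integrable_test_mul {T : ℝ} {f : ℝ × R3 → ℝ} (hf : LocallyIntegrable f)
    (φ : 𝓓(slab T, ℝ)) : Integrable fun z => φ z * f z :=
  hf.integrable_smul_left_of_hasCompactSupport φ.continuous φ.hasCompactSupport

theorem ext_sub {T : ℝ} (f g : ℝ → R3 → ℝ) :
    (ext T fun t x => f t x - g t x) = ext T f - ext T g := indicator_sub _ _ _

theorem ext_sum {T : ℝ} {ι : Type*} (s : Finset ι) (f : ι → ℝ → R3 → ℝ) :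
    (ext T fun t x => ∑ i ∈ s, f i t x) = fun z => ∑ i ∈ s, ext T (f i) z := by
  ext z
  by_cases hz : z ∈ (slab T : Set (ℝ × R3)) <;> simp [ext, hz]

theorem toDist_sub {T : ℝ} {f g : ℝ → R3 → ℝ} (hf : LocallyIntegrable (ext T f))
    (hg : LocallyIntegrable (ext T g)) :
    toDist T (fun t x => f t x - g t x) = toDist T f - toDist T g := by
  ext φ
  have h : LocallyIntegrable (ext T fun t x => f t x - g t x) := by
    rw [ext_sub]; exact hf.sub hg
  rw [toDist_apply h, sub_apply, toDist_apply hf, toDist_apply hg,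
    ← integral_sub (integrable_test_mul hf φ) (integrable_test_mul hg φ), ext_sub]
  simp only [Pi.sub_apply, mul_sub]

theorem locallyIntegrable_ext_sum {T : ℝ} {ι : Type*} (s : Finset ι) {f : ι → ℝ → R3 → ℝ}
    (hf : ∀ i, LocallyIntegrable (ext T (f i))) :
    LocallyIntegrable (ext T fun t x => ∑ i ∈ s, f i t x) := by
  rw [ext_sum]
  exact locallyIntegrable_finsetSum s fun i _ => hf i

theorem toDist_sum {T : ℝ} {ι : Type*} (s : Finset ι) {f : ι → ℝ → R3 → ℝ}
    (hf : ∀ i, LocallyIntegrable (ext T (f i))) :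
    toDist T (fun t x => ∑ i ∈ s, f i t x) = ∑ i ∈ s, toDist T (f i) := by
  ext φ
  rw [toDist_apply (locallyIntegrable_ext_sum s hf), sum_apply]
  simp_rw [toDist_apply (hf _), ext_sum, Finset.mul_sum]
  exact integral_finsetSum s fun i _ => integrable_test_mul (hf i) φ

/-- Integrability is required up to the times `0` and `T`, so the extension by zero is locally
integrable on the whole space and can be convolved there. -/
theorem locallyIntegrable_ext {T : ℝ} {f : ℝ → R3 → ℝ}
    (hf : ∀ R : ℝ, IntegrableOn (fun z : ℝ × R3 => f z.1 z.2) (Ioo 0 T ×ˢ Metric.closedBall 0 R)) :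
    LocallyIntegrable (ext T f) := by
  intro z
  refine ⟨univ ×ˢ Metric.closedBall 0 (‖z.2‖ + 1), ?_, ?_⟩
  · refine prod_mem_nhds Filter.univ_mem (Metric.closedBall_mem_nhds_of_mem ?_)
    simp
  · refine (integrableOn_indicator_iff (measurableSet_slab T)).2 ?_
    refine (hf (‖z.2‖ + 1)).mono_set ?_
    rintro w ⟨h1, h2⟩
    exact ⟨h1.1, h2.2⟩

/-- Translation of a test function in the space variable. -/
noncomputable def shift {T : ℝ} (y : R3) (φ : 𝓓(slab T, ℝ)) : 𝓓(slab T, ℝ) where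
  toFun z := φ (z - (0, y))
  contDiff' := φ.contDiff.comp (contDiff_id.sub contDiff_const)
  hasCompactSupport' := φ.hasCompactSupport.comp_homeomorph (Homeomorph.subRight ((0 : ℝ), y))
  tsupport_subset' := by
    have h : tsupport (fun z => φ (z - (0, y))) =
        (Homeomorph.subRight ((0 : ℝ), y)) ⁻¹' tsupport φ :=
      tsupport_comp_eq_preimage φ (Homeomorph.subRight ((0 : ℝ), y))
    rw [h]
    intro z hz
    have := φ.tsupport_subset hz
    simpa [slab] using this

@[simp] theorem shift_apply {T : ℝ} (y : R3) (φ : 𝓓(slab T, ℝ)) (z : ℝ × R3) :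
    shift y φ z = φ (z - (0, y)) := rfl

theorem shift_zero {T : ℝ} (φ : 𝓓(slab T, ℝ)) : shift 0 φ = φ := by
  ext z
  rw [shift_apply, show ((0 : ℝ), (0 : R3)) = 0 from rfl, sub_zero]

theorem lineDeriv_shift {T : ℝ} (m : ℝ × R3) (y : R3) (φ : 𝓓(slab T, ℝ)) :
    ∂_{m} (shift y φ) = shift y (∂_{m} φ) := by
  ext z
  rw [test_lineDeriv_apply, shift_apply, test_lineDeriv_apply]
  change fderiv ℝ (fun z => φ (z - (0, y))) z m = _
  rw [fderiv_comp_sub]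

/-- A distribution is averaging if `y ↦ h(φ(· - y))` is smooth with the expected derivatives, and
its averages over large balls tend to `0`. -/
structure Averaging {T : ℝ} (h : 𝓓'(slab T, ℝ)) : Prop where
  hasFDerivAt : ∀ (φ : 𝓓(slab T, ℝ)) (y : R3), HasFDerivAt (fun y => h (shift y φ))
    (∑ i, (-h (shift y (∂_{dx i} φ))) • (EuclideanSpace.proj i : R3 →L[ℝ] ℝ)) y
  tendsto : ∀ φ : 𝓓(slab T, ℝ), Filter.Tendsto
    (fun R : ℝ => ∫ y in Metric.closedBall (0 : R3) 1, |h (shift (R • y) φ)|) Filter.atTop (nhds 0)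

theorem Averaging.continuous {T : ℝ} {h : 𝓓'(slab T, ℝ)} (hh : Averaging h) (φ : 𝓓(slab T, ℝ)) :
    Continuous fun y => h (shift y φ) :=
  continuous_iff_continuousAt.2 fun y => (hh.hasFDerivAt φ y).continuousAt

theorem Averaging.integrableOn {T : ℝ} {h : 𝓓'(slab T, ℝ)} (hh : Averaging h) (φ : 𝓓(slab T, ℝ))
    (R : ℝ) : IntegrableOn (fun y : R3 => |h (shift (R • y) φ)|) (Metric.closedBall 0 1) := by
  have := hh.continuous φ
  have h2 : Continuous fun y : R3 => |h (shift (R • y) φ)| :=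
    (this.comp (continuous_const_smul R)).abs
  exact h2.continuousOn.integrableOn_compact (isCompact_closedBall _ _)

theorem Averaging.add {T : ℝ} {h k : 𝓓'(slab T, ℝ)} (hh : Averaging h) (hk : Averaging k) :
    Averaging (h + k) where
  hasFDerivAt φ y := by
    convert! (hh.hasFDerivAt φ y).add (hk.hasFDerivAt φ y) using 1
    rw [← Finset.sum_add_distrib]
    refine Finset.sum_congr rfl fun i _ => ?_
    rw [add_apply, neg_add, add_smul]
  tendsto φ := by
    have h1 := (hh.tendsto φ).add (hk.tendsto φ)
    rw [add_zero] at h1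
    refine squeeze_zero (fun R => integral_nonneg fun y => abs_nonneg _) (fun R => ?_) h1
    rw [← integral_add (hh.integrableOn φ R) (hk.integrableOn φ R)]
    refine integral_mono_of_nonneg (Filter.Eventually.of_forall fun y => abs_nonneg _)
      ((hh.integrableOn φ R).add (hk.integrableOn φ R)) (Filter.Eventually.of_forall fun y => ?_)
    exact abs_add_le _ _

theorem Averaging.neg {T : ℝ} {h : 𝓓'(slab T, ℝ)} (hh : Averaging h) : Averaging (-h) where
  hasFDerivAt φ y := by
    convert! (hh.hasFDerivAt φ y).neg using 1
    rw [← Finset.sum_neg_distrib]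
    refine Finset.sum_congr rfl fun i _ => ?_
    rw [neg_apply, neg_smul]
  tendsto φ := by
    simpa using hh.tendsto φ

theorem Averaging.sub {T : ℝ} {h k : 𝓓'(slab T, ℝ)} (hh : Averaging h) (hk : Averaging k) :
    Averaging (h - k) := by
  rw [sub_eq_add_neg]
  exact hh.add hk.neg

theorem averaging_zero {T : ℝ} : Averaging (0 : 𝓓'(slab T, ℝ)) where
  hasFDerivAt φ y := by simpa using hasFDerivAt_const (0 : ℝ) y
  tendsto φ := by simp

theorem Averaging.sum {T : ℝ} {ι : Type*} (s : Finset ι) {h : ι → 𝓓'(slab T, ℝ)}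
    (hh : ∀ i, Averaging (h i)) : Averaging (∑ i ∈ s, h i) := by
  classical
  induction s using Finset.induction_on with
  | empty => simpa using averaging_zero
  | insert a s ha ih =>
    rw [Finset.sum_insert ha]
    exact (hh a).add ih

/-- A derivative falls on the test function and commutes with spatial shifts, so both properties are
inherited without any estimate. This covers `∂_t` as well as the space derivatives. -/
theorem Averaging.lineDeriv {T : ℝ} {h : 𝓓'(slab T, ℝ)} (hh : Averaging h) (m : ℝ × R3) :
    Averaging (∂_{m} h) where
  hasFDerivAt φ y := by
    simp only [Distribution.lineDerivOp_apply_apply, lineDeriv_shift, map_neg]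
    convert! (hh.hasFDerivAt (∂_{m} φ) y).neg using 1
    rw [← Finset.sum_neg_distrib]
    refine Finset.sum_congr rfl fun i _ => ?_
    rw [test_lineDeriv_comm, neg_smul]
  tendsto φ := by
    simp only [Distribution.lineDerivOp_apply_apply, lineDeriv_shift, map_neg, abs_neg]
    exact hh.tendsto (∂_{m} φ)

instance isAddHaarMeasure_volume_prod : (volume : Measure (ℝ × R3)).IsAddHaarMeasure :=
  inferInstanceAs ((volume : Measure ℝ).prod (volume : Measure R3)).IsAddHaarMeasure

open scoped Convolution in
-- Up to reflecting the test function, `y ↦ toDist T f (shift y φ)` is the convolution of the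
-- extended `f` with it, restricted to `{0} × ℝ³`.
theorem hasFDerivAt_toDist_shift {T : ℝ} {f : ℝ → R3 → ℝ} (hf : LocallyIntegrable (ext T f))
    (φ : 𝓓(slab T, ℝ)) (y : R3) : HasFDerivAt (fun y => toDist T f (shift y φ))
      (∑ i, (-toDist T f (shift y (∂_{dx i} φ))) • (EuclideanSpace.proj i : R3 →L[ℝ] ℝ)) y := by
  set ψ : ℝ × R3 → ℝ := fun z => φ (-z) with hψ
  have hψc : ContDiff ℝ 1 ψ := (φ.contDiff.comp contDiff_neg).of_le
    (WithTop.coe_le_coe.2 le_top : ((1 : ℕ∞) : WithTop ℕ∞) ≤ _)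
  have hψs : HasCompactSupport ψ := φ.hasCompactSupport.comp_homeomorph (Homeomorph.neg _)
  have h1 := hψs.hasFDerivAt_convolution_right (ContinuousLinearMap.mul ℝ ℝ) hf hψc
    ((0 : ℝ), y)
  have h2 := h1.comp y (ContinuousLinearMap.inr ℝ ℝ R3).hasFDerivAt
  have e1 : (ext T f ⋆[ContinuousLinearMap.mul ℝ ℝ] ψ) ∘ (Prod.mk 0) =
      fun y => toDist T f (shift y φ) := by
    ext y
    rw [toDist_apply hf, Function.comp_apply, convolution_def]
    congr 1; ext z
    simp only [ContinuousLinearMap.mul_apply', hψ, shift_apply, neg_sub]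
    ring
  rw [e1] at h2
  convert! h2 using 1
  refine ContinuousLinearMap.coe_injective
    ((EuclideanSpace.basisFun (Fin 3) ℝ).toBasis.ext fun j => ?_)
  simp only [OrthonormalBasis.coe_toBasis, EuclideanSpace.basisFun_apply,
    ContinuousLinearMap.coe_coe, ContinuousLinearMap.comp_apply, ContinuousLinearMap.inr_apply]
  rw [convolution_precompR_apply _ hf (hψs.fderiv ℝ) (hψc.continuous_fderiv one_ne_zero),
    convolution_def, sum_apply, Finset.sum_eq_single j
    (fun i _ hi => by simp [hi]) (by simp), smul_apply, toDist_apply hf]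
  have h3 : (EuclideanSpace.proj j : R3 →L[ℝ] ℝ) (EuclideanSpace.single j 1) = 1 := by simp
  rw [h3, smul_eq_mul, mul_one, ← integral_neg]
  refine integral_congr_ae (Filter.Eventually.of_forall fun z => ?_)
  beta_reduce
  have h4 : ∀ w, fderiv ℝ ψ w = -fderiv ℝ φ (-w) := fun w => by
    have h5 : HasFDerivAt ψ ((fderiv ℝ φ (-w)).comp (-ContinuousLinearMap.id ℝ (ℝ × R3))) w :=
      ((φ.contDiff.differentiable (by simp)) (-w)).hasFDerivAt.comp w (hasFDerivAt_id w).neg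
    rw [h5.fderiv]
    ext <;> simp
  rw [shift_apply, test_lineDeriv_apply, ContinuousLinearMap.mul_apply', h4]
  simp only [neg_sub, neg_apply]
  change _ = ext T f z * -(fderiv ℝ φ (z - (0, y))) (dx j)
  ring

theorem exists_test_bound {T : ℝ} (φ : 𝓓(slab T, ℝ)) : ∃ M ρ : ℝ, 0 ≤ M ∧ 1 ≤ ρ ∧
    ∀ z, |φ z| ≤ M ∧ (ρ < ‖z.2‖ → φ z = 0) := by
  obtain ⟨M, hM⟩ := φ.hasCompactSupport.exists_bound_of_continuous φ.continuous
  obtain ⟨ρ, hρ⟩ := φ.hasCompactSupport.isCompact.isBounded.subset_closedBall 0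
  refine ⟨M, max ρ 1, (norm_nonneg _).trans (hM 0), le_max_right _ _, fun z => ⟨hM z, fun hz => ?_⟩⟩
  refine image_eq_zero_of_notMem_tsupport fun h => ?_
  have h1 := hρ h
  rw [Metric.mem_closedBall, dist_zero_right] at h1
  have h2 : ‖z.2‖ ≤ ‖z‖ := norm_snd_le z
  have := le_max_left ρ 1
  linarith

/-- For fixed `z` the shifted test function is nonzero only for `y` in a ball of radius `ρ/R`, and
for no `y` in the unit ball if `|z.2| > R + ρ`. The factor `R^{-3}` of the averages originates here.
-/
theorem lintegral_shift_le {T : ℝ} (φ : 𝓓(slab T, ℝ)) {M ρ : ℝ}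
    (hφ : ∀ z, |φ z| ≤ M ∧ (ρ < ‖z.2‖ → φ z = 0)) {R : ℝ} (hR : 0 < R) (hρ : 1 ≤ ρ)
    (z : ℝ × R3) :
    ∫⁻ y in Metric.closedBall (0 : R3) 1, ‖φ (z - (0, R • y))‖ₑ ≤
      (Metric.closedBall (0 : R3) (R + ρ)).indicator
        (fun _ => ENNReal.ofReal M * (ENNReal.ofReal ((ρ / R) ^ 3) *
          volume (Metric.ball (0 : R3) 1))) z.2 := by
  by_cases hz : z.2 ∈ Metric.closedBall (0 : R3) (R + ρ)
  · rw [indicator_of_mem hz]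
    have hpt : ∀ y : R3, ‖φ (z - (0, R • y))‖ₑ ≤
        (Metric.closedBall (R⁻¹ • z.2) (ρ / R)).indicator (fun _ => ENNReal.ofReal M) y := by
      intro y
      by_cases hy : y ∈ Metric.closedBall (R⁻¹ • z.2) (ρ / R)
      · rw [indicator_of_mem hy, Real.enorm_eq_ofReal_abs]
        exact ENNReal.ofReal_le_ofReal (hφ _).1
      · rw [indicator_of_notMem hy, (hφ _).2]
        · simp
        · rw [Metric.mem_closedBall, not_le, dist_comm, dist_eq_norm] at hy
          have e : (z - ((0 : ℝ), R • y)).2 = R • (R⁻¹ • z.2 - y) := by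
            rw [smul_sub, smul_smul, mul_inv_cancel₀ hR.ne', one_smul]; rfl
          rw [e, norm_smul, Real.norm_of_nonneg hR.le]
          rwa [div_lt_iff₀' hR] at hy
    calc _ ≤ ∫⁻ y, ‖φ (z - (0, R • y))‖ₑ := setLIntegral_le_lintegral _ _
      _ ≤ ∫⁻ y, (Metric.closedBall (R⁻¹ • z.2) (ρ / R)).indicator
          (fun _ => ENNReal.ofReal M) y := lintegral_mono hpt
      _ = _ := by
          rw [lintegral_indicator_const Metric.isClosed_closedBall.measurableSet,
            Measure.addHaar_closedBall _ _ (by positivity), finrank_euclideanSpace_fin]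
  · rw [indicator_of_notMem hz, nonpos_iff_eq_zero]
    refine (setLIntegral_congr_fun Metric.isClosed_closedBall.measurableSet
      (g := fun _ => 0) fun y hy => ?_).trans (by simp)
    rw [Metric.mem_closedBall, dist_zero_right] at hy hz
    have h1 : ρ < ‖(z - ((0 : ℝ), R • y)).2‖ := by
      have h2 : ‖R • y‖ ≤ R := by
        rw [norm_smul, Real.norm_of_nonneg hR.le]
        exact mul_le_of_le_one_right hR.le hy
      have h3 := norm_sub_norm_le z.2 (R • y)
      change ρ < ‖z.2 - R • y‖
      linarith
    simp only [(hφ _).2 h1, enorm_zero]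

theorem averaging_toDist {T : ℝ} {f : ℝ → R3 → ℝ} (hf : LocallyIntegrable (ext T f))
    (hfi : ∀ R : ℝ, IntegrableOn (fun z : ℝ × R3 => f z.1 z.2) (Ioo 0 T ×ˢ Metric.closedBall 0 R))
    (hlim : Filter.Tendsto (fun R : ℝ => (R ^ 3)⁻¹ *
      ∫ z in Ioo 0 T ×ˢ Metric.closedBall 0 R, ‖f z.1 z.2‖) Filter.atTop (nhds 0)) :
    Averaging (toDist T f) where
  hasFDerivAt := hasFDerivAt_toDist_shift hf
  tendsto φ := by
    obtain ⟨M, ρ, hM, hρ, hφ⟩ := exists_test_bound φ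
    have hcont : Continuous fun y => toDist T f (shift y φ) :=
      continuous_iff_continuousAt.2 fun y => (hasFDerivAt_toDist_shift hf φ y).continuousAt
    set V := (volume (Metric.ball (0 : R3) 1)).toReal with hV
    have hVt : volume (Metric.ball (0 : R3) 1) ≠ ⊤ := measure_ball_lt_top.ne
    -- The factor `8` comes from `R + ρ ≤ 2R`, which replaces `R^{-3}` by `8 (R + ρ)^{-3}` so that
    -- the average is over the same ball as the integral.
    have hb : ∀ R : ℝ, ρ ≤ R → ∫ y in Metric.closedBall (0 : R3) 1,
        |toDist T f (shift (R • y) φ)| ≤ (M * ρ ^ 3 * V * 8) * (((R + ρ) ^ 3)⁻¹ *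
          ∫ z in Ioo 0 T ×ˢ Metric.closedBall 0 (R + ρ), ‖f z.1 z.2‖) := by
      intro R hR
      have hR0 : 0 < R := by linarith
      have hm : AEMeasurable (Function.uncurry fun (y : R3) (z : ℝ × R3) =>
          ‖φ (z - (0, R • y))‖ₑ * ‖ext T f z‖ₑ)
          ((volume.restrict (Metric.closedBall (0 : R3) 1)).prod volume) := by
        have h1 : Measurable fun w : R3 × (ℝ × R3) => φ (w.2 - (0, R • w.1)) :=
          (φ.continuous.comp (by fun_prop)).measurable
        exact h1.enorm.aemeasurable.mul hf.aestronglyMeasurable.comp_snd.enorm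
      have h1 : ∫⁻ y in Metric.closedBall (0 : R3) 1, ‖toDist T f (shift (R • y) φ)‖ₑ ≤
          ENNReal.ofReal M * (ENNReal.ofReal ((ρ / R) ^ 3) * volume (Metric.ball (0 : R3) 1)) *
            ∫⁻ z in Ioo 0 T ×ˢ Metric.closedBall 0 (R + ρ), ‖f z.1 z.2‖ₑ := by
        calc _ ≤ ∫⁻ y in Metric.closedBall (0 : R3) 1, ∫⁻ z,
              ‖φ (z - (0, R • y))‖ₑ * ‖ext T f z‖ₑ := by
              refine lintegral_mono fun y => ?_
              rw [toDist_apply hf]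
              refine (enorm_integral_le_lintegral_enorm _).trans (le_of_eq ?_)
              simp only [shift_apply, enorm_mul]
          _ = ∫⁻ z, ∫⁻ y in Metric.closedBall (0 : R3) 1,
              ‖φ (z - (0, R • y))‖ₑ * ‖ext T f z‖ₑ := lintegral_lintegral_swap hm
          _ ≤ ∫⁻ z, (Ioo 0 T ×ˢ Metric.closedBall (0 : R3) (R + ρ)).indicator (fun z =>
              ENNReal.ofReal M * (ENNReal.ofReal ((ρ / R) ^ 3) *
                volume (Metric.ball (0 : R3) 1)) * ‖f z.1 z.2‖ₑ) z := by
              refine lintegral_mono fun z => ?_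
              rw [lintegral_mul_const' _ _ (by simp)]
              refine (mul_le_mul_left (lintegral_shift_le φ hφ hR0 hρ z) _).trans
                (le_of_eq ?_)
              by_cases h1 : z.1 ∈ Ioo 0 T <;>
              by_cases h2 : z.2 ∈ Metric.closedBall (0 : R3) (R + ρ) <;>
              simp [ext, slab, indicator, h1, h2]
          _ = _ := by
              rw [lintegral_indicator (measurableSet_Ioo.prod
                Metric.isClosed_closedBall.measurableSet), lintegral_const_mul' _ _ (by finiteness)]
      have hI : IntegrableOn (fun z : ℝ × R3 => f z.1 z.2)
        (Ioo 0 T ×ˢ Metric.closedBall 0 (R + ρ)) := hfi _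
      have hH : Continuous fun y : R3 => toDist T f (shift (R • y) φ) :=
        hcont.comp (continuous_const_smul R)
      have hJ : 0 ≤ ∫ z in Ioo 0 T ×ˢ Metric.closedBall (0 : R3) (R + ρ), ‖f z.1 z.2‖ :=
        integral_nonneg fun z => norm_nonneg _
      have h2 : ∫ y in Metric.closedBall (0 : R3) 1, |toDist T f (shift (R • y) φ)| ≤
          M * ((ρ / R) ^ 3 * V) *
            ∫ z in Ioo 0 T ×ˢ Metric.closedBall 0 (R + ρ), ‖f z.1 z.2‖ := by
        simp only [← Real.norm_eq_abs]
        rw [integral_norm_eq_lintegral_enorm hH.aestronglyMeasurable,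
          integral_norm_eq_lintegral_enorm hI.aestronglyMeasurable]
        refine (ENNReal.toReal_mono (by finiteness [hI.2.ne]) h1).trans (le_of_eq ?_)
        rw [ENNReal.toReal_mul, ENNReal.toReal_mul, ENNReal.toReal_mul, ENNReal.toReal_ofReal hM,
          ENNReal.toReal_ofReal (by positivity)]
      refine h2.trans ?_
      have h3 : (ρ / R) ^ 3 ≤ ρ ^ 3 * 8 * ((R + ρ) ^ 3)⁻¹ := by
        rw [← div_eq_mul_inv, div_pow, div_le_div_iff₀ (by positivity) (by positivity)]
        have h4 : (R + ρ) ^ 3 ≤ (2 * R) ^ 3 := pow_le_pow_left₀ (by positivity) (by linarith) 3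
        calc ρ ^ 3 * (R + ρ) ^ 3 ≤ ρ ^ 3 * (2 * R) ^ 3 := by gcongr
          _ = ρ ^ 3 * 8 * R ^ 3 := by ring
      have hV0 : 0 ≤ V := ENNReal.toReal_nonneg
      calc _ ≤ M * ((ρ ^ 3 * 8 * ((R + ρ) ^ 3)⁻¹) * V) *
            ∫ z in Ioo 0 T ×ˢ Metric.closedBall 0 (R + ρ), ‖f z.1 z.2‖ := by gcongr
        _ = _ := by ring
    have h5 := (hlim.comp (Filter.tendsto_atTop_add_const_right _ ρ
      Filter.tendsto_id)).const_mul (M * ρ ^ 3 * V * 8)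
    rw [mul_zero] at h5
    refine squeeze_zero' (Filter.Eventually.of_forall fun R => integral_nonneg fun y =>
      abs_nonneg _) ?_ h5
    filter_upwards [Filter.eventually_ge_atTop ρ] with R hR using hb R hR

/-! ### A Liouville theorem for averaging distributions. -/

theorem hasDerivAt_max_zero_sq (s : ℝ) :
    HasDerivAt (fun s : ℝ => (max 0 s) ^ 2) (2 * max 0 s) s := by
  rcases lt_trichotomy s 0 with hs | rfl | hs
  · rw [max_eq_left hs.le, mul_zero]
    refine (hasDerivAt_const s (0 : ℝ)).congr_of_eventuallyEq ?_
    filter_upwards [eventually_lt_nhds hs] with r hr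
    simp [max_eq_left hr.le]
  · rw [max_self, mul_zero, hasDerivAt_iff_isLittleO_nhds_zero]
    have h1 : (fun h : ℝ => h ^ 2) =o[nhds 0] fun h => h := by
      simpa using Asymptotics.isLittleO_pow_pow (𝕜 := ℝ) (show 1 < 2 by norm_num)
    refine Asymptotics.IsBigO.trans_isLittleO ?_ h1
    refine Asymptotics.IsBigO.of_bound 1 (Filter.Eventually.of_forall fun h => ?_)
    simp only [zero_add, max_self, smul_zero, sub_zero, norm_pow, one_mul, Real.norm_eq_abs]
    have : |max 0 h| ≤ |h| := by
      rw [abs_of_nonneg (le_max_left _ _)]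
      exact max_le (abs_nonneg _) (le_abs_self _)
    simpa using pow_le_pow_left₀ (abs_nonneg _) this 2
  · rw [max_eq_right hs.le]
    have h := (hasDerivAt_id s).pow 2
    simp only [id, Nat.cast_ofNat, mul_one, pow_one, Nat.add_one_sub_one] at h
    refine HasDerivAt.congr_of_eventuallyEq (by simpa using h) ?_
    filter_upwards [eventually_gt_nhds hs] with r hr
    simp [max_eq_right hr.le]

/-- The radial cut-off `max 0 (1 - |y|²)`. -/
noncomputable def radialCutoff (y : R3) : ℝ := max 0 (1 - ‖y‖ ^ 2)

theorem continuous_radialCutoff : Continuous radialCutoff := by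
  unfold radialCutoff
  fun_prop

theorem radialCutoff_nonneg (y : R3) : 0 ≤ radialCutoff y := le_max_left _ _

theorem radialCutoff_le_one (y : R3) : radialCutoff y ≤ 1 :=
  max_le zero_le_one (by linarith [sq_nonneg ‖y‖])

theorem radialCutoff_eq_zero {y : R3} (hy : y ∉ Metric.closedBall (0 : R3) 1) :
    radialCutoff y = 0 := by
  rw [Metric.mem_closedBall, dist_zero_right, not_le] at hy
  exact max_eq_left (by nlinarith)

theorem hasCompactSupport_radialCutoff : HasCompactSupport radialCutoff :=
  HasCompactSupport.intro (isCompact_closedBall (0 : R3) 1) fun _ hy => radialCutoff_eq_zero hy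

theorem integral_radialCutoff_pos : 0 < ∫ y, radialCutoff y := by
  refine continuous_radialCutoff.integral_pos_of_hasCompactSupport_nonneg_nonzero
    hasCompactSupport_radialCutoff radialCutoff_nonneg (x := 0) ?_
  simp [radialCutoff]

/-- It exhibits the radial field `χ(y) y` as `-¼ ∇(χ²)`. A radial derivative integrated against `χ`
can thus be integrated by parts into a Laplacian, and squaring makes the cut-off `C¹`. -/
theorem hasFDerivAt_radialCutoff_sq (y : R3) : HasFDerivAt (fun y => radialCutoff y ^ 2)
    ((-4 * radialCutoff y) • innerSL ℝ y) y := by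
  have h1 : HasFDerivAt (fun y : R3 => 1 - ‖y‖ ^ 2) (-(2 • innerSL ℝ y)) y :=
    ((hasStrictFDerivAt_norm_sq y).hasFDerivAt).const_sub 1
  have h2 := (hasDerivAt_max_zero_sq (1 - ‖y‖ ^ 2)).comp_hasFDerivAt y h1
  convert! h2 using 1
  ext v
  simp [radialCutoff]
  ring

/-- The mean value property for `H(y) = h(shift y φ)`, which is harmonic. The weighted mean `m(R) =
∫ H(Ry) χ(y) dy` has derivative `(R/4) ∫ ΔH(Ry) χ(y)² dy = 0`, so it equals its value `H(0) ∫ χ` at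
`R = 0`. It also tends to `0` at infinity, hence `h(φ) = H(0) = 0`. -/
theorem Averaging.eq_zero_of_laplacian_eq_zero {T : ℝ} {h : 𝓓'(slab T, ℝ)} (hh : Averaging h)
    (hL : ∀ φ : 𝓓(slab T, ℝ), ∑ i, h (∂_{dx i} (∂_{dx i} φ)) = 0) : h = 0 := by
  ext φ
  set H : R3 → ℝ := fun y => h (shift y φ) with hH
  have hHc : Continuous H := hh.continuous φ
  have hKc : ∀ i, Continuous fun y => h (shift y (∂_{dx i} φ)) := fun i => hh.continuous _
  set H' : R3 → R3 →L[ℝ] ℝ := fun y => ∑ i, (-h (shift y (∂_{dx i} φ))) •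
    (EuclideanSpace.proj i : R3 →L[ℝ] ℝ) with hH'
  have hH'c : Continuous H' := by
    refine continuous_finsetSum _ fun i _ => ?_
    exact (hKc i).neg.smul continuous_const
  have hI : ∀ {F : R3 → ℝ}, Continuous F → Integrable fun y => F y * radialCutoff y :=
    fun hF => (hF.mul continuous_radialCutoff).integrable_of_hasCompactSupport
      hasCompactSupport_radialCutoff.mul_left
  set m : ℝ → ℝ := fun R => ∫ y, H (R • y) * radialCutoff y with hm
  have hder : ∀ R, HasDerivAt m (∫ y, H' (R • y) y * radialCutoff y) R := by
    intro R
    have hcc : Continuous fun w : ℝ × R3 => H' (w.1 • w.2) w.2 :=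
      (hH'c.comp (by fun_prop : Continuous fun w : ℝ × R3 => w.1 • w.2)).clm_apply continuous_snd
    obtain ⟨C, hC⟩ := ((isCompact_closedBall R 1).prod (isCompact_closedBall (0 : R3) 1)).exists_bound_of_continuousOn hcc.continuousOn
    have hC' : ∀ R' ∈ Metric.ball R 1, ∀ y, ‖H' (R' • y) y * radialCutoff y‖ ≤
        (Metric.closedBall (0 : R3) 1).indicator (fun _ => C) y := by
      intro R' hR' y
      by_cases hy : y ∈ Metric.closedBall (0 : R3) 1
      · rw [indicator_of_mem hy, norm_mul]
        have h1 := hC (R', y) ⟨Metric.ball_subset_closedBall hR', hy⟩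
        have h2 : ‖radialCutoff y‖ ≤ 1 := by
          rw [Real.norm_of_nonneg (radialCutoff_nonneg y)]
          exact radialCutoff_le_one y
        exact (mul_le_of_le_one_right (norm_nonneg _) h2).trans h1
      · rw [indicator_of_notMem hy, radialCutoff_eq_zero hy]
        simp
    refine (hasDerivAt_integral_of_dominated_loc_of_deriv_le (μ := volume)
      (F := fun R y => H (R • y) * radialCutoff y)
      (F' := fun R y => H' (R • y) y * radialCutoff y)
      (bound := (Metric.closedBall (0 : R3) 1).indicator fun _ => C)
      (Metric.ball_mem_nhds R one_pos) ?_ ?_ ?_ ?_ ?_ ?_).2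
    · exact Filter.Eventually.of_forall fun R' =>
        (hI (hHc.comp (continuous_const_smul R'))).aestronglyMeasurable
    · exact hI (hHc.comp (continuous_const_smul R))
    · exact (hI (hcc.comp (by fun_prop : Continuous fun y : R3 => (R, y)))).aestronglyMeasurable
    · exact Filter.Eventually.of_forall fun y R' hR' => hC' R' hR' y
    · rw [integrable_indicator_iff Metric.isClosed_closedBall.measurableSet]
      exact integrableOn_const measure_closedBall_lt_top.ne
    · refine Filter.Eventually.of_forall fun y R' _ => ?_
      have h1 : HasDerivAt (fun R' : ℝ => R' • y) y R' := by
        simpa using (hasDerivAt_id R').smul_const y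
      exact ((hh.hasFDerivAt φ (R' • y)).comp_hasDerivAt R' h1).mul_const _
  have hzero : ∀ R : ℝ, ∫ y, H' (R • y) y * radialCutoff y = 0 := by
    intro R
    -- Integration by parts in direction `e_i` against `χ²`; the factor `R` comes from
    -- differentiating `H(Ry)`.
    have hterm : ∀ i, ∫ y, h (shift (R • y) (∂_{dx i} φ)) * ((-4 * radialCutoff y) * y i) =
        -∫ y, (-(R * h (shift (R • y) (∂_{dx i} (∂_{dx i} φ))))) * radialCutoff y ^ 2 := by
      intro i
      have hK : ∀ y : R3, HasFDerivAt (fun y => h (shift (R • y) (∂_{dx i} φ)))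
          ((∑ j, (-h (shift (R • y) (∂_{dx j} (∂_{dx i} φ)))) •
            (EuclideanSpace.proj j : R3 →L[ℝ] ℝ)).comp (R • ContinuousLinearMap.id ℝ R3)) y :=
        fun y => (hh.hasFDerivAt (∂_{dx i} φ) (R • y)).comp y
          ((hasFDerivAt_id y).const_smul R)
      have hv : ∀ y : R3, ((∑ j, (-h (shift (R • y) (∂_{dx j} (∂_{dx i} φ)))) •
            (EuclideanSpace.proj j : R3 →L[ℝ] ℝ)).comp (R • ContinuousLinearMap.id ℝ R3))
            (EuclideanSpace.single i 1) = -(R * h (shift (R • y) (∂_{dx i} (∂_{dx i} φ)))) := by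
        intro y
        rw [ContinuousLinearMap.comp_apply, sum_apply, Finset.sum_eq_single i
          (fun j _ hj => by simp [hj]) (by simp)]
        simp [mul_comm]
      have hw : ∀ y : R3, ((-4 * radialCutoff y) • innerSL ℝ y) (EuclideanSpace.single i 1) =
          (-4 * radialCutoff y) * y i := by
        intro y
        simp [EuclideanSpace.inner_single_right]
      have hcs : HasCompactSupport fun y => radialCutoff y ^ 2 :=
        hasCompactSupport_radialCutoff.comp_left (g := fun r => r ^ 2) (by simp)
      have h1 := integral_bilinear_hasFDerivAt_right_eq_neg_left_of_integrable (μ := volume)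
        (f := fun y => h (shift (R • y) (∂_{dx i} φ))) (g := fun y => radialCutoff y ^ 2)
        (v := EuclideanSpace.single i 1) (B := ContinuousLinearMap.mul ℝ ℝ)
        ?_ ?_ ?_ (fun y _ => hK y) (fun y _ => hasFDerivAt_radialCutoff_sq y)
      · simpa only [hv, hw, ContinuousLinearMap.mul_apply'] using h1
      · simp only [hv, ContinuousLinearMap.mul_apply']
        refine Continuous.integrable_of_hasCompactSupport ?_ hcs.mul_left
        exact (((hh.continuous _).comp (continuous_const_smul R)).const_mul R).neg.mul
          (continuous_radialCutoff.pow 2)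
      · simp only [hw, ContinuousLinearMap.mul_apply']
        refine Continuous.integrable_of_hasCompactSupport ?_
          (hasCompactSupport_radialCutoff.mul_left (f := fun _ => (-4 : ℝ))).mul_right.mul_left
        exact ((hKc i).comp (continuous_const_smul R)).mul
          ((continuous_radialCutoff.const_mul _).mul (by fun_prop))
      · simp only [ContinuousLinearMap.mul_apply']
        refine Continuous.integrable_of_hasCompactSupport ?_ hcs.mul_left
        exact ((hKc i).comp (continuous_const_smul R)).mul (continuous_radialCutoff.pow 2)
    have hint1 : ∀ i, Integrable fun y : R3 =>
        h (shift (R • y) (∂_{dx i} φ)) * ((-4 * radialCutoff y) * y i) := by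
      intro i
      refine Continuous.integrable_of_hasCompactSupport ?_
          (hasCompactSupport_radialCutoff.mul_left (f := fun _ => (-4 : ℝ))).mul_right.mul_left
      exact ((hKc i).comp (continuous_const_smul R)).mul
          ((continuous_radialCutoff.const_mul _).mul (by fun_prop))
    have hint2 : ∀ i, Integrable fun y : R3 =>
        (-(R * h (shift (R • y) (∂_{dx i} (∂_{dx i} φ))))) * radialCutoff y ^ 2 := by
      intro i
      refine Continuous.integrable_of_hasCompactSupport ?_
        (hasCompactSupport_radialCutoff.comp_left (g := fun r => r ^ 2) (by simp)).mul_left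
      exact (((hh.continuous _).comp (continuous_const_smul R)).const_mul R).neg.mul
          (continuous_radialCutoff.pow 2)
    have e1 : ∀ y : R3, H' (R • y) y * radialCutoff y = (1 / 4) *
        ∑ i, h (shift (R • y) (∂_{dx i} φ)) * ((-4 * radialCutoff y) * y i) := by
      intro y
      simp only [hH', sum_apply, smul_apply, PiLp.proj_apply, smul_eq_mul, Finset.sum_mul,
        Finset.mul_sum]
      exact Finset.sum_congr rfl fun i _ => by ring
    have e2 : ∀ y : R3, ∑ i,
        (-(R * h (shift (R • y) (∂_{dx i} (∂_{dx i} φ))))) * radialCutoff y ^ 2 = 0 := by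
      intro y
      have := hL (shift (R • y) φ)
      simp only [lineDeriv_shift] at this
      rw [← Finset.sum_mul, Finset.sum_neg_distrib, ← Finset.mul_sum, this]
      simp
    simp_rw [e1]
    rw [integral_const_mul, integral_finsetSum _ fun i _ => hint1 i]
    simp_rw [hterm]
    rw [Finset.sum_neg_distrib, ← integral_finsetSum _ fun i _ => hint2 i]
    simp_rw [e2]
    simp
  have hconst : ∀ R, m R = H 0 * ∫ y, radialCutoff y := by
    intro R
    have h1 := is_const_of_deriv_eq_zero (f := m) (fun R => (hder R).differentiableAt)
      (fun R => by rw [(hder R).deriv, hzero R]) R 0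
    rw [h1, hm]
    simp only [zero_smul]
    exact integral_const_mul _ _
  have hle : ∀ R : ℝ, |H 0 * ∫ y, radialCutoff y| ≤
      ∫ y in Metric.closedBall (0 : R3) 1, |h (shift (R • y) φ)| := by
    intro R
    rw [← hconst R, ← integral_indicator Metric.isClosed_closedBall.measurableSet]
    change ‖∫ y, H (R • y) * radialCutoff y‖ ≤ _
    refine norm_integral_le_of_norm_le ((integrable_indicator_iff
      Metric.isClosed_closedBall.measurableSet).2 (hh.integrableOn φ R))
      (Filter.Eventually.of_forall fun y => ?_)
    by_cases hy : y ∈ Metric.closedBall (0 : R3) 1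
    · rw [indicator_of_mem hy, norm_mul, Real.norm_of_nonneg (radialCutoff_nonneg y)]
      exact mul_le_of_le_one_right (abs_nonneg _) (radialCutoff_le_one y)
    · rw [indicator_of_notMem hy, radialCutoff_eq_zero hy]
      simp
  have h0 : |H 0 * ∫ y, radialCutoff y| ≤ 0 :=
    ge_of_tendsto (hh.tendsto φ) (Filter.Eventually.of_forall hle)
  have h1 := abs_nonpos_iff.1 h0
  have h2 := (mul_eq_zero.1 h1).resolve_right integral_radialCutoff_pos.ne'
  rw [hH] at h2
  simp only [shift_zero] at h2
  exact h2

/-! ### The product rule for divergence-free fields -/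

/-- `f` is square integrable on the sets `(0,T) × K`, `K` bounded. -/
def LocalL2 (T : ℝ) (f : ℝ → R3 → ℝ) : Prop :=
  ∀ R : ℝ, MemLp (fun z : ℝ × R3 => f z.1 z.2) 2 (volume.restrict (Ioo 0 T ×ˢ Metric.closedBall 0 R))

theorem volume_slab_ball_lt_top (T R : ℝ) :
    volume (Ioo 0 T ×ˢ Metric.closedBall (0 : R3) R) < ⊤ := by
  rw [Measure.volume_eq_prod, Measure.prod_prod]
  exact ENNReal.mul_lt_top measure_Ioo_lt_top measure_closedBall_lt_top

theorem LocalL2.locallyIntegrable {T : ℝ} {f : ℝ → R3 → ℝ} (hf : LocalL2 T f) :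
    LocallyIntegrable (ext T f) := by
  refine locallyIntegrable_ext fun R => ?_
  have : IsFiniteMeasure (volume.restrict (Ioo 0 T ×ˢ Metric.closedBall (0 : R3) R)) :=
    ⟨by rw [Measure.restrict_apply_univ]; exact volume_slab_ball_lt_top T R⟩
  exact (hf R).integrable one_le_two

theorem LocalL2.locallyIntegrable_mul {T : ℝ} {f g : ℝ → R3 → ℝ} (hf : LocalL2 T f)
    (hg : LocalL2 T g) : LocallyIntegrable (ext T fun t x => f t x * g t x) :=
  locallyIntegrable_ext fun R => (hf R).integrable_mul (hg R)

/-- The restriction of `f` to `(0,T) × B(0,R)`. -/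
noncomputable def cut (T R : ℝ) (f : ℝ → R3 → ℝ) : ℝ × R3 → ℝ :=
  (Ioo 0 T ×ˢ Metric.closedBall 0 R).indicator fun z => f z.1 z.2

theorem measurableSet_slab_ball (T R : ℝ) :
    MeasurableSet (Ioo 0 T ×ˢ Metric.closedBall (0 : R3) R) :=
  measurableSet_Ioo.prod Metric.isClosed_closedBall.measurableSet

theorem LocalL2.memLp_cut {T : ℝ} {f : ℝ → R3 → ℝ} (hf : LocalL2 T f) (R : ℝ) :
    MemLp (cut T R f) 2 :=
  (memLp_indicator_iff_restrict (measurableSet_slab_ball T R)).2 (hf R)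

theorem cut_eq_ext {T R : ℝ} {f : ℝ → R3 → ℝ} {z : ℝ × R3} (hz : ‖z.2‖ ≤ R) :
    cut T R f z = ext T f z := by
  have h : z.2 ∈ Metric.closedBall (0 : R3) R := by simpa using hz
  by_cases h1 : z.1 ∈ Ioo 0 T <;> simp [cut, ext, slab, indicator, h1, h]

theorem LocalL2.memLp_test_mul {T : ℝ} {f : ℝ → R3 → ℝ} (hf : LocalL2 T f) (φ : 𝓓(slab T, ℝ)) :
    MemLp (fun z => φ z * ext T f z) 2 := by
  obtain ⟨M, ρ, -, -, hφ⟩ := exists_test_bound φ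
  have h1 : (fun z => φ z * ext T f z) = fun z => φ z * cut T ρ f z := by
    ext z
    by_cases hz : ‖z.2‖ ≤ ρ
    · rw [cut_eq_ext hz]
    · rw [(hφ z).2 (not_le.1 hz), zero_mul, zero_mul]
  rw [h1]
  exact (hf.memLp_cut ρ).of_le_mul (c := M)
    (φ.continuous.aestronglyMeasurable.mul (hf.memLp_cut ρ).1)
    (Filter.Eventually.of_forall fun z => by
      rw [norm_mul]; exact mul_le_mul_of_nonneg_right (hφ z).1 (norm_nonneg _))

/-- Translations act continuously on `L²`, and the correlation is an inner product with a translate.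
-/
theorem continuous_integral_mul_translate {A B : ℝ × R3 → ℝ} (hA : MemLp A 2) (hB : MemLp B 2) :
    Continuous fun h => ∫ z, A z * B (z + h) := by
  have : Fact ((1 : ℝ≥0∞) ≤ 2) := ⟨one_le_two⟩
  have hmp : ∀ h : ℝ × R3, MeasurePreserving (ContinuousMap.addRight h) volume volume :=
    fun h => measurePreserving_add_right volume h
  have hc : Continuous fun h : ℝ × R3 =>
      Lp.compMeasurePreserving (ContinuousMap.addRight h) (hmp h) (hB.toLp B) := by
    refine Continuous.compMeasurePreservingLp continuous_const ?_ hmp (by simp)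
    exact (ContinuousMap.curry ⟨fun w : (ℝ × R3) × (ℝ × R3) => w.2 + w.1, by fun_prop⟩).continuous
  have he : (fun h => ∫ z, A z * B (z + h)) = fun h => inner ℝ
      (Lp.compMeasurePreserving (ContinuousMap.addRight h) (hmp h) (hB.toLp B)) (hA.toLp A) := by
    ext h
    rw [L2.inner_def]
    refine integral_congr_ae ?_
    have h1 := Lp.coeFn_compMeasurePreserving (hB.toLp B) (hmp h)
    have h2 := (hmp h).quasiMeasurePreserving.ae_eq_comp hB.coeFn_toLp
    filter_upwards [h1, h2, hA.coeFn_toLp] with z h1 h2 h3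
    rw [h1, h2, h3]
    simp
  rw [he]
  exact hc.inner continuous_const

open scoped Convolution in
theorem integral_mul_integral_translate {A B ρ : ℝ × R3 → ℝ} (hA : MemLp A 2) (hB : MemLp B 2)
    (hρ : Continuous ρ) (hρ' : HasCompactSupport ρ) :
    ∫ h, ρ h * ∫ z, A z * B (z + -h) =
      ∫ z, A z * (B ⋆[ContinuousLinearMap.mul ℝ ℝ] ρ) z := by
  have hρi : Integrable ρ := hρ.integrable_of_hasCompactSupport hρ'
  have hm : AEStronglyMeasurable (fun w : (ℝ × R3) × (ℝ × R3) => A w.1 * (ρ w.2 * B (w.1 - w.2)))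
      (volume.prod volume) :=
    hA.1.comp_fst.mul (hρ.aestronglyMeasurable.convolution_integrand
      (ContinuousLinearMap.mul ℝ ℝ) hB.1)
  have hi : Integrable (fun w : (ℝ × R3) × (ℝ × R3) => A w.1 * (ρ w.2 * B (w.1 - w.2)))
      (volume.prod volume) := by
    have h1 : Integrable (fun w : (ℝ × R3) × (ℝ × R3) => A w.1 ^ 2 * |ρ w.2|)
      (volume.prod volume) := hA.integrable_sq.mul_prod hρi.abs
    have h2 : Integrable (fun w : (ℝ × R3) × (ℝ × R3) => |ρ w.2| * B (w.1 - w.2) ^ 2)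
      (volume.prod volume) :=
      hρi.abs.convolution_integrand (ContinuousLinearMap.mul ℝ ℝ) hB.integrable_sq
    refine (h1.add h2).mono' hm (Filter.Eventually.of_forall fun w => ?_)
    rw [Pi.add_apply, Real.norm_eq_abs, abs_mul, abs_mul]
    have h3 : |A w.1| * |B (w.1 - w.2)| ≤ A w.1 ^ 2 + B (w.1 - w.2) ^ 2 := by
      rw [← sq_abs (A w.1), ← sq_abs (B (w.1 - w.2))]
      nlinarith [sq_nonneg (|A w.1| - |B (w.1 - w.2)|), sq_nonneg (|A w.1|),
        sq_nonneg (|B (w.1 - w.2)|)]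
    nlinarith [mul_le_mul_of_nonneg_left h3 (abs_nonneg (ρ w.2))]
  calc _ = ∫ h, ∫ z, A z * (ρ h * B (z - h)) := by
        congr 1; ext h
        rw [← integral_const_mul]
        congr 1; ext z
        rw [← sub_eq_add_neg]; ring
    _ = ∫ z, ∫ h, A z * (ρ h * B (z - h)) := (integral_integral_swap hi).symm
    _ = _ := by
        congr 1; ext z
        rw [integral_const_mul, convolution_eq_swap]
        congr 2; ext h
        rw [ContinuousLinearMap.mul_apply', mul_comm]

/-- The test function `w ↦ ρ(z - w)`. -/
noncomputable def reflected {T ε : ℝ} {ρ : ℝ × R3 → ℝ} (hρ : ContDiff ℝ (⊤ : ℕ∞) ρ)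
    (hρs : tsupport ρ ⊆ Metric.closedBall 0 ε) {z : ℝ × R3}
    (hz : Metric.closedBall z ε ⊆ (slab T : Set (ℝ × R3))) : 𝓓(slab T, ℝ) where
  toFun w := ρ (z - w)
  contDiff' := hρ.comp (contDiff_const.sub contDiff_id)
  hasCompactSupport' := (HasCompactSupport.of_support_subset_isCompact
    (isCompact_closedBall (0 : ℝ × R3) ε) ((subset_tsupport ρ).trans hρs)).comp_homeomorph
      (Homeomorph.subLeft z)
  tsupport_subset' := by
    have h : tsupport (fun w => ρ (z - w)) = (Homeomorph.subLeft z) ⁻¹' tsupport ρ :=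
      tsupport_comp_eq_preimage ρ (Homeomorph.subLeft z)
    rw [h]
    intro w hw
    refine hz ?_
    have h1 := hρs hw
    rw [Metric.mem_closedBall, dist_zero_right] at h1
    rw [Metric.mem_closedBall, dist_comm, dist_eq_norm]
    exact h1

open scoped Convolution in
theorem convolution_cut_eq_toDist {T ε R : ℝ} {f : ℝ → R3 → ℝ} (hf : LocalL2 T f)
    {ρ : ℝ × R3 → ℝ} (hρ : ContDiff ℝ (⊤ : ℕ∞) ρ)
    (hρs : tsupport ρ ⊆ Metric.closedBall 0 ε) {z : ℝ × R3}
    (hz : Metric.closedBall z ε ⊆ (slab T : Set (ℝ × R3))) (hzR : ‖z.2‖ + ε ≤ R) :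
    (cut T R f ⋆[ContinuousLinearMap.mul ℝ ℝ] ρ) z = toDist T f (reflected hρ hρs hz) := by
  rw [convolution_def, toDist_apply hf.locallyIntegrable]
  refine integral_congr_ae (Filter.Eventually.of_forall fun w => ?_)
  change cut T R f w * ρ (z - w) = ρ (z - w) * ext T f w
  rw [mul_comm]
  by_cases hw : z - w ∈ tsupport ρ
  · rw [cut_eq_ext]
    have h1 := hρs hw
    rw [Metric.mem_closedBall, dist_zero_right] at h1
    have h2 : ‖z.2 - w.2‖ ≤ ‖z - w‖ := norm_snd_le (z - w)
    have h3 := norm_sub_norm_le w.2 z.2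
    rw [norm_sub_rev] at h3
    linarith
  · rw [image_eq_zero_of_notMem_tsupport hw, zero_mul, zero_mul]

open scoped Convolution in
-- At points whose `ε`-ball stays in the slab, the reflected mollifier is itself a test function, so
-- the weak derivative can be tested against it. The truncation at radius `R` is invisible there
-- because `‖z.2‖ + ε ≤ R`.
theorem fderiv_convolution_cut {T ε R : ℝ} {u g : ℝ → R3 → ℝ} (hu : LocalL2 T u)
    (hg : LocalL2 T g) {m : ℝ × R3} (hug : ∂_{m} (toDist T u) = toDist T g)
    {ρ : ℝ × R3 → ℝ} (hρ : ContDiff ℝ (⊤ : ℕ∞) ρ)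
    (hρs : tsupport ρ ⊆ Metric.closedBall 0 ε) {z : ℝ × R3}
    (hz : Metric.closedBall z ε ⊆ (slab T : Set (ℝ × R3))) (hzR : ‖z.2‖ + ε ≤ R) :
    fderiv ℝ (cut T R u ⋆[ContinuousLinearMap.mul ℝ ℝ] ρ) z m =
      (cut T R g ⋆[ContinuousLinearMap.mul ℝ ℝ] ρ) z := by
  have hc : HasCompactSupport ρ := HasCompactSupport.of_support_subset_isCompact
    (isCompact_closedBall (0 : ℝ × R3) ε) ((subset_tsupport ρ).trans hρs)
  have hloc : LocallyIntegrable (cut T R u) := (hu.memLp_cut R).locallyIntegrable one_le_two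
  have hρ1 : ContDiff ℝ 1 ρ := hρ.of_le (WithTop.coe_le_coe.2 le_top : ((1 : ℕ∞) : WithTop ℕ∞) ≤ _)
  rw [(hc.hasFDerivAt_convolution_right (ContinuousLinearMap.mul ℝ ℝ) hloc hρ1 z).fderiv,
    convolution_precompR_apply _ hloc (hc.fderiv ℝ) (hρ1.continuous_fderiv one_ne_zero),
    convolution_cut_eq_toDist hg hρ hρs hz hzR, ← hug, Distribution.lineDerivOp_apply_apply]
  have hd : ContDiff ℝ (⊤ : ℕ∞) fun w => fderiv ℝ ρ w m :=
    (hρ.fderiv_right (m := (⊤ : ℕ∞)) (by simp)).clm_apply contDiff_const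
  have hds : tsupport (fun w => fderiv ℝ ρ w m) ⊆ Metric.closedBall 0 ε :=
    (tsupport_fderiv_apply_subset ℝ m).trans hρs
  rw [convolution_cut_eq_toDist hu hd hds hz hzR]
  congr 1
  ext w
  change fderiv ℝ ρ (z - w) m = -(∂_{m} (reflected hρ hρs hz)) w
  rw [test_lineDeriv_apply]
  have h5 : HasFDerivAt (reflected hρ hρs hz)
      ((fderiv ℝ ρ (z - w)).comp (-ContinuousLinearMap.id ℝ (ℝ × R3))) w :=
    ((hρ.differentiable (by simp)) (z - w)).hasFDerivAt.comp w ((hasFDerivAt_id w).const_sub z)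
  rw [h5.fderiv]
  simp

open scoped Convolution in
-- The equation `∇·b = 0` is tested against `φ` times the mollified `u`, a legitimate test function,
-- and the classical product rule is applied to it.
theorem sum_integral_mollified_eq_zero {T ε R : ℝ} {b : Fin 3 → ℝ → R3 → ℝ}
    (hb : ∀ i, LocalL2 T (b i)) (hdiv : ∑ i, ∂_{dx i} (toDist T (b i)) = 0)
    {u : ℝ → R3 → ℝ} {g : Fin 3 → ℝ → R3 → ℝ} (hu : LocalL2 T u) (hg : ∀ i, LocalL2 T (g i))
    (hug : ∀ i, ∂_{dx i} (toDist T u) = toDist T (g i))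
    {ρ : ℝ × R3 → ℝ} (hρ : ContDiff ℝ (⊤ : ℕ∞) ρ)
    (hρs : tsupport ρ ⊆ Metric.closedBall 0 ε) (φ : 𝓓(slab T, ℝ))
    (hz : ∀ z ∈ tsupport φ, Metric.closedBall z ε ⊆ (slab T : Set (ℝ × R3)) ∧ ‖z.2‖ + ε ≤ R) :
    ∑ i, ((∫ z, (φ z * ext T (b i) z) * (cut T R (g i) ⋆[ContinuousLinearMap.mul ℝ ℝ] ρ) z) +
      ∫ z, ((∂_{dx i} φ) z * ext T (b i) z) *
        (cut T R u ⋆[ContinuousLinearMap.mul ℝ ℝ] ρ) z) = 0 := by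
  have hc : HasCompactSupport ρ := HasCompactSupport.of_support_subset_isCompact
    (isCompact_closedBall (0 : ℝ × R3) ε) ((subset_tsupport ρ).trans hρs)
  have hsm : ∀ {f : ℝ → R3 → ℝ}, LocalL2 T f →
      ContDiff ℝ (⊤ : ℕ∞) (cut T R f ⋆[ContinuousLinearMap.mul ℝ ℝ] ρ) := fun hf =>
    hc.contDiff_convolution_right _ ((hf.memLp_cut R).locallyIntegrable one_le_two) hρ
  set U := cut T R u ⋆[ContinuousLinearMap.mul ℝ ℝ] ρ with hU
  have hint : ∀ (i) (ψ : 𝓓(slab T, ℝ)) {V : ℝ × R3 → ℝ}, Continuous V →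
      Integrable fun z => (ψ z * ext T (b i) z) * V z := by
    intro i ψ V hV
    have h1 := (hb i).locallyIntegrable.integrable_smul_left_of_hasCompactSupport
      (ψ.continuous.mul hV) ψ.hasCompactSupport.mul_right
    refine h1.congr (Filter.Eventually.of_forall fun z => ?_)
    simp only [smul_eq_mul, Pi.mul_apply]; ring
  let ψ : 𝓓(slab T, ℝ) :=
    { toFun := fun z => φ z * U z
      contDiff' := φ.contDiff.mul (hsm hu)
      hasCompactSupport' := φ.hasCompactSupport.mul_right
      tsupport_subset' := (tsupport_mul_subset_left (f := φ) (g := U)).trans φ.tsupport_subset }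
  have hd := DFunLike.congr_fun hdiv ψ
  rw [sum_apply] at hd
  simp only [Distribution.lineDerivOp_apply_apply, map_neg] at hd
  rw [Finset.sum_neg_distrib] at hd
  have hd' : ∑ i, toDist T (b i) (∂_{dx i} ψ) = 0 := neg_eq_zero.1 hd
  rw [← hd']
  refine Finset.sum_congr rfl fun i _ => ?_
  rw [toDist_apply (hb i).locallyIntegrable, ← integral_add (hint i φ (hsm (hg i)).continuous)
    (hint i _ (hsm hu).continuous)]
  refine integral_congr_ae (Filter.Eventually.of_forall fun z => ?_)
  beta_reduce
  have h1 : (∂_{dx i} ψ) z = φ z * (cut T R (g i) ⋆[ContinuousLinearMap.mul ℝ ℝ] ρ) z +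
      U z * (∂_{dx i} φ) z := by
    rw [test_lineDeriv_apply, test_lineDeriv_apply]
    change fderiv ℝ (fun z => φ z * U z) z (dx i) = _
    rw [fderiv_fun_mul (φ.contDiff.differentiable (by simp) z)
      ((hsm hu).differentiable (by simp) z), add_apply, smul_apply, smul_apply, smul_eq_mul,
      smul_eq_mul]
    by_cases hzφ : z ∈ tsupport φ
    · rw [hU, fderiv_convolution_cut hu (hg i) (hug i) hρ hρs (hz z hzφ).1 (hz z hzφ).2]
    · rw [image_eq_zero_of_notMem_tsupport hzφ, zero_mul, zero_mul]
  rw [h1]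
  ring

open scoped Convolution in
-- `b` is never mollified or differentiated, so no commutator estimate occurs. The mollified
-- identities say that averages of the correlation function `Q` against bumps shrinking to `0` all
-- vanish. `Q` is continuous, hence `Q 0 = 0`, and this is the claim tested against `φ`.
theorem sum_lineDeriv_mul_eq {T : ℝ} {b : Fin 3 → ℝ → R3 → ℝ}
    (hb : ∀ i, LocalL2 T (b i)) (hdiv : ∑ i, ∂_{dx i} (toDist T (b i)) = 0)
    {u : ℝ → R3 → ℝ} {g : Fin 3 → ℝ → R3 → ℝ} (hu : LocalL2 T u) (hg : ∀ i, LocalL2 T (g i))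
    (hug : ∀ i, ∂_{dx i} (toDist T u) = toDist T (g i)) :
    ∑ i, ∂_{dx i} (toDist T fun t x => b i t x * u t x) =
      toDist T fun t x => ∑ i, b i t x * g i t x := by
  rw [toDist_sum Finset.univ fun i => (hb i).locallyIntegrable_mul (hg i)]
  ext φ
  rw [sum_apply, sum_apply]
  obtain ⟨ε, hε, hεs⟩ := φ.hasCompactSupport.isCompact.exists_cthickening_subset_open
    (slab T).isOpen φ.tsupport_subset
  obtain ⟨r, hr⟩ := φ.hasCompactSupport.isCompact.isBounded.subset_closedBall 0
  set R := r + ε with hR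
  have hball : ∀ z ∈ tsupport φ, ‖z.2‖ ≤ r := fun z hz => by
    have h1 := hr hz
    rw [Metric.mem_closedBall, dist_zero_right] at h1
    exact (norm_snd_le z).trans h1
  -- `Q h` is the expression to be shown zero, with `u` and its derivatives translated by `h`;
  -- mollifying them amounts to averaging `Q`.
  set Q : ℝ × R3 → ℝ := fun h => ∑ i, ((∫ z, (φ z * ext T (b i) z) * cut T R (g i) (z + h)) +
      ∫ z, ((∂_{dx i} φ) z * ext T (b i) z) * cut T R u (z + h)) with hQ
  have hQt : ∀ i, Continuous (fun h => ∫ z, (φ z * ext T (b i) z) * cut T R (g i) (z + h)) ∧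
      Continuous (fun h => ∫ z, ((∂_{dx i} φ) z * ext T (b i) z) * cut T R u (z + h)) := fun i =>
    ⟨continuous_integral_mul_translate ((hb i).memLp_test_mul φ) ((hg i).memLp_cut R),
      continuous_integral_mul_translate ((hb i).memLp_test_mul _) (hu.memLp_cut R)⟩
  have hQc : Continuous Q := continuous_finsetSum _ fun i _ => (hQt i).1.add (hQt i).2
  let β : ℕ → ContDiffBump (0 : ℝ × R3) := fun n =>
    ⟨ε / (n + 1) / 2, ε / (n + 1), by positivity, half_lt_self (by positivity)⟩
  have hβ : Filter.Tendsto (fun n => (β n).rOut) Filter.atTop (nhds 0) := by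
    have := tendsto_one_div_add_atTop_nhds_zero_nat (𝕜 := ℝ)
    simpa [β, div_eq_mul_inv] using this.const_mul ε
  have hlim := ContDiffBump.convolution_tendsto_right_of_continuous (μ := volume) hβ hQc 0
  have hz : ∀ n, ((β n).normed volume ⋆[ContinuousLinearMap.lsmul ℝ ℝ, volume] Q) 0 = 0 := by
    intro n
    set ρ := (β n).normed volume with hρ
    have hρc : Continuous ρ := (β n).continuous_normed
    have hρs : HasCompactSupport ρ := (β n).hasCompactSupport_normed
    have hts : tsupport ρ ⊆ Metric.closedBall 0 ε := by
      rw [hρ, ContDiffBump.tsupport_normed_eq]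
      refine Metric.closedBall_subset_closedBall ?_
      exact div_le_self hε.le (by linarith [n.cast_nonneg (α := ℝ)])
    rw [convolution_def]
    simp only [ContinuousLinearMap.lsmul_apply, smul_eq_mul, zero_sub, hQ, Finset.mul_sum, mul_add]
    have hneg : ∀ {c : ℝ × R3 → ℝ}, Continuous c → Integrable fun h => ρ h * c (-h) := fun hc =>
      (hρc.mul (hc.comp continuous_neg)).integrable_of_hasCompactSupport hρs.mul_right
    refine (integral_finsetSum _ fun i _ => (hneg (hQt i).1).add (hneg (hQt i).2)).trans ?_
    rw [← sum_integral_mollified_eq_zero hb hdiv hu hg hug (β n).contDiff_normed hts φ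
      (R := R) (fun z hz => ⟨(Metric.closedBall_subset_cthickening hz ε).trans hεs,
        add_le_add_left (hball z hz) ε⟩)]
    refine Finset.sum_congr rfl fun i _ => ?_
    refine (integral_add (hneg (hQt i).1) (hneg (hQt i).2)).trans ?_
    rw [integral_mul_integral_translate ((hb i).memLp_test_mul φ) ((hg i).memLp_cut R) hρc hρs,
      integral_mul_integral_translate ((hb i).memLp_test_mul _) (hu.memLp_cut R) hρc hρs]
  simp only [hz] at hlim
  have hQ0 : Q 0 = 0 := (tendsto_nhds_unique hlim tendsto_const_nhds)
  have hcut : ∀ {ψ : 𝓓(slab T, ℝ)} {a f : ℝ → R3 → ℝ}, (∀ z, z ∉ tsupport φ → ψ z = 0) →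
      ∀ z, (ψ z * ext T a z) * cut T R f (z + 0) = ψ z * ext T (fun t x => a t x * f t x) z := by
    intro ψ a f hψ z
    by_cases hz : z ∈ tsupport φ
    · rw [add_zero, cut_eq_ext (by linarith [hball z hz]), mul_assoc]
      congr 1
      by_cases h : z ∈ (slab T : Set (ℝ × R3)) <;> simp [ext, h]
    · rw [hψ z hz]; simp
  simp only [hQ] at hQ0
  rw [Finset.sum_congr rfl fun i _ => congrArg₂ (· + ·)
    (integral_congr_ae (Filter.Eventually.of_forall
      (hcut (ψ := φ) (a := b i) (f := g i) fun z hz => image_eq_zero_of_notMem_tsupport hz)))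
    (integral_congr_ae (Filter.Eventually.of_forall
      (hcut (ψ := ∂_{dx i} φ) (a := b i) (f := u) fun z hz => ?_)))] at hQ0
  · rw [Finset.sum_add_distrib] at hQ0
    simp only [Distribution.lineDerivOp_apply_apply, map_neg]
    simp_rw [toDist_apply ((hb _).locallyIntegrable_mul (hg _)),
      toDist_apply ((hb _).locallyIntegrable_mul hu)]
    rw [Finset.sum_neg_distrib]
    linarith
  · rw [test_lineDeriv_apply]
    exact image_eq_zero_of_notMem_tsupport (f := fun x => fderiv ℝ φ x (dx i))
      fun h => hz (tsupport_fderiv_apply_subset ℝ _ h)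

/-! ### Riesz transforms at fixed times -/

theorem hasCompactSupport_slice {T : ℝ} (t : ℝ) (φ : 𝓓(slab T, ℝ)) :
    HasCompactSupport fun x : R3 => φ (t, x) :=
  HasCompactSupport.intro (φ.hasCompactSupport.isCompact.image continuous_snd) fun x hx =>
    image_eq_zero_of_notMem_tsupport fun h => hx ⟨(t, x), h, rfl⟩

/-- The slice `φ(t, ·)` of a test function. -/
noncomputable def slice {T : ℝ} (t : ℝ) (φ : 𝓓(slab T, ℝ)) : 𝓢(R3, ℝ) :=
  (hasCompactSupport_slice t φ).toSchwartzMap (φ.contDiff.comp (contDiff_prodMk_right t))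

theorem slice_apply {T : ℝ} (t : ℝ) (φ : 𝓓(slab T, ℝ)) (x : R3) : slice t φ x = φ (t, x) := rfl

theorem lineDeriv_slice {T : ℝ} (t : ℝ) (φ : 𝓓(slab T, ℝ)) (i : Fin 3) :
    ∂_{e i} (slice t φ) = slice t (∂_{dx i} φ) := by
  ext x
  rw [slice_apply, test_lineDeriv_apply, SchwartzMap.lineDerivOp_apply_eq_fderiv]
  have h : HasFDerivAt (slice t φ) ((fderiv ℝ φ (t, x)).comp (ContinuousLinearMap.inr ℝ ℝ R3)) x :=
    ((φ.contDiff.differentiable (by simp)) (t, x)).hasFDerivAt.comp x (hasFDerivAt_prodMk_right t x)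
  rw [h.fderiv]
  rfl

theorem toDist_eq_integral_slice {T : ℝ} {f : ℝ → R3 → ℝ} (hf : LocallyIntegrable (ext T f))
    (φ : 𝓓(slab T, ℝ)) :
    toDist T f φ = ∫ t in Ioo 0 T, ∫ x, f t x * slice t φ x := by
  have h1 := integrable_test_mul hf φ
  have e : (fun z => φ z * ext T f z) =
      (slab T : Set (ℝ × R3)).indicator fun z => φ z * f z.1 z.2 := by
    ext z
    by_cases hz : z ∈ (slab T : Set (ℝ × R3)) <;> simp [ext, hz]
  rw [e, integrable_indicator_iff (measurableSet_slab T), IntegrableOn, restrict_slab] at h1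
  rw [toDist_apply hf, e, integral_indicator (measurableSet_slab T), restrict_slab,
    integral_prod _ h1]
  simp only [slice_apply, mul_comm]

theorem laplacian_toDist_riesz {p : ℝ≥0∞} [Fact (1 ≤ p)] {δ T : ℝ} {i j : Fin 3}
    {A : Lp ℝ p (weightMeasure δ) →L[ℝ] Lp ℝ p (weightMeasure δ)}
    (hA : ∀ (f : Lp ℝ p (weightMeasure δ)) (φ : 𝓢(R3, ℝ)),
      ∫ x, A f x * lap φ x = -∫ x, f x * ∂_{e i} (∂_{e j} φ) x)
    {f P : ℝ → R3 → ℝ} (hf : LocallyIntegrable (ext T f)) (hP : LocallyIntegrable (ext T P))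
    (hfP : ∀ᵐ t ∂(volume.restrict (Ioo 0 T)), ∃ h : MemLp (f t) p (weightMeasure δ),
      P t =ᵐ[weightMeasure δ] A (h.toLp _)) (φ : 𝓓(slab T, ℝ)) :
    toDist T P (∑ k, ∂_{dx k} (∂_{dx k} φ)) = -toDist T f (∂_{dx i} (∂_{dx j} φ)) := by
  rw [toDist_eq_integral_slice hP, toDist_eq_integral_slice hf, ← integral_neg]
  refine integral_congr_ae ?_
  filter_upwards [hfP] with t ⟨h, ht⟩
  have h1 := hA (h.toLp _) (slice t φ)
  have e1 : slice t (∑ k, ∂_{dx k} (∂_{dx k} φ)) = lap (slice t φ) := by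
    rw [lap]
    ext x
    simp only [lineDeriv_slice, slice_apply, sum_apply]
  rw [e1, ← lineDeriv_slice, ← lineDeriv_slice]
  have hae : ∀ {s : R3 → Prop}, (∀ᵐ x ∂weightMeasure δ, s x) → ∀ᵐ x, s x := fun h => by
    rwa [ae_weightMeasure] at h
  calc _ = ∫ x, A (h.toLp _) x * lap (slice t φ) x := by
        refine integral_congr_ae ?_
        filter_upwards [hae ht] with x hx using by rw [hx]
    _ = _ := h1
    _ = _ := by
        congr 1
        refine integral_congr_ae ?_
        filter_upwards [hae h.coeFn_toLp] with x hx using by rw [hx]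

/-! ### The pressure gradient -/

theorem MemLL.integrableOn {r p : ℝ≥0∞} (hr : 1 ≤ r) (hp1 : 1 ≤ p) (hp : p ≠ ⊤) {δ T : ℝ}
    (hδ : 0 ≤ δ) {f : ℝ → R3 → ℝ} (hf : MemLL r p δ T f) (R : ℝ) :
    IntegrableOn (fun z : ℝ × R3 => f z.1 z.2) (Ioo 0 T ×ˢ Metric.closedBall 0 R) :=
  memLp_one_iff_integrable.1 (hf.memLp one_ne_zero hr hp1 hp hδ R)

theorem MemLL.averaging_toDist {r p : ℝ≥0∞} (hr : 1 ≤ r) (hp1 : 1 ≤ p) (hp : p ≠ ⊤) {δ T : ℝ}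
    (hδ : 0 ≤ δ) (hδp : δ < 3) {f : ℝ → R3 → ℝ} (hf : MemLL r p δ T f) :
    Averaging (toDist T f) :=
  WeightedNS.averaging_toDist (locallyIntegrable_ext (hf.integrableOn hr hp1 hp hδ))
    (hf.integrableOn hr hp1 hp hδ) (hf.tendsto_average hr hp1 hp hδ hδp)

theorem DivFree.sum_apply_eq_zero {T : ℝ} {u : ℝ → R3 → R3} (hu : DivFree T u)
    (χ : 𝓓(slab T, ℝ)) : ∑ k, toDist T (fun t x => u t x k) (∂_{dx k} χ) = 0 := by
  have h := DFunLike.congr_fun hu χ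
  rw [sum_apply] at h
  simp only [Distribution.lineDerivOp_apply_apply, map_neg] at h
  rw [Finset.sum_neg_distrib] at h
  exact neg_eq_zero.1 h

/-- The equation for `∇q` once the transport term is written in divergence form. -/
theorem AdvectionDiffusion.lineDeriv_pressure {T : ℝ} {b u : ℝ → R3 → R3}
    {G F : ℝ → R3 → Fin 3 → Fin 3 → ℝ} {q : 𝓓'(slab T, ℝ)}
    (heq : AdvectionDiffusion T b u G F q) (hbdiv : DivFree T b) (hG : IsWeakGradient T u G)
    (hb : ∀ i, LocalL2 T fun t x => b t x i) (hu : ∀ i, LocalL2 T fun t x => u t x i)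
    (hGL : ∀ i j, LocalL2 T fun t x => G t x i j) (k : Fin 3) :
    ∂_{dx k} q = ∑ i, ∂_{dx i} (∂_{dx i} (toDist T fun t x => u t x k))
      - ∑ i, ∂_{dx i} (toDist T fun t x => b t x i * u t x k)
      + ∑ i, ∂_{dx i} (toDist T fun t x => F t x i k)
      - ∂_{dt} (toDist T fun t x => u t x k) := by
  rw [heq k, sum_lineDeriv_mul_eq (b := fun i t x => b t x i) (u := fun t x => u t x k)
    (g := fun i t x => G t x i k) hb hbdiv (hu k) (fun i => hGL i k) fun i => hG i k]
  abel

/-- This is the divergence of the equation in weak form. After commuting derivatives, the `Δu` and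
`∂_t u` terms become `∇·u` tested against `∂_i ∂_i ψ` and `∂_t ψ`, and vanish. -/
theorem AdvectionDiffusion.laplacian_pressure {T : ℝ} {b u : ℝ → R3 → R3}
    {G F : ℝ → R3 → Fin 3 → Fin 3 → ℝ} {q : 𝓓'(slab T, ℝ)}
    (heq : AdvectionDiffusion T b u G F q) (hbdiv : DivFree T b) (hudiv : DivFree T u)
    (hG : IsWeakGradient T u G)
    (hb : ∀ i, LocalL2 T fun t x => b t x i) (hu : ∀ i, LocalL2 T fun t x => u t x i)
    (hGL : ∀ i j, LocalL2 T fun t x => G t x i j) (ψ : 𝓓(slab T, ℝ)) :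
    q (∑ k, ∂_{dx k} (∂_{dx k} ψ)) =
      ∑ i, ∑ j, (toDist T (fun t x => F t x i j) (∂_{dx i} (∂_{dx j} ψ)) -
        toDist T (fun t x => b t x i * u t x j) (∂_{dx i} (∂_{dx j} ψ))) := by
  have h1 : ∀ k, q (∂_{dx k} (∂_{dx k} ψ)) =
      -∑ i, toDist T (fun t x => u t x k) (∂_{dx k} (∂_{dx i} (∂_{dx i} ψ)))
      - ∑ i, toDist T (fun t x => b t x i * u t x k) (∂_{dx i} (∂_{dx k} ψ))
      + ∑ i, toDist T (fun t x => F t x i k) (∂_{dx i} (∂_{dx k} ψ))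
      - toDist T (fun t x => u t x k) (∂_{dx k} (∂_{dt} ψ)) := by
    intro k
    have h2 := DFunLike.congr_fun (heq.lineDeriv_pressure hbdiv hG hb hu hGL k) (∂_{dx k} ψ)
    simp only [sub_apply, add_apply, sum_apply, Distribution.lineDerivOp_apply_apply, map_neg,
      neg_neg, Finset.sum_neg_distrib] at h2
    have h3 : ∀ i, ∂_{dx k} (∂_{dx i} (∂_{dx i} ψ)) = ∂_{dx i} (∂_{dx i} (∂_{dx k} ψ)) := fun i => by
      rw [test_lineDeriv_comm, test_lineDeriv_comm ψ (dx k) (dx i)]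
    simp only [h3]
    rw [test_lineDeriv_comm ψ (dx k) dt]
    linarith
  rw [map_sum]
  simp_rw [h1]
  simp only [Finset.sum_sub_distrib, Finset.sum_add_distrib, Finset.sum_neg_distrib]
  have h4 : ∑ k, ∑ i, toDist T (fun t x => u t x k) (∂_{dx k} (∂_{dx i} (∂_{dx i} ψ))) = 0 := by
    rw [Finset.sum_comm]
    exact Finset.sum_eq_zero fun i _ => hudiv.sum_apply_eq_zero _
  rw [h4, hudiv.sum_apply_eq_zero,
    Finset.sum_comm (f := fun k i => toDist T (fun t x => b t x i * u t x k) (∂_{dx i} (∂_{dx k} ψ))),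
    Finset.sum_comm (f := fun k i => toDist T (fun t x => F t x i k) (∂_{dx i} (∂_{dx k} ψ)))]
  ring

theorem MemLL.localL2 {r p : ℝ≥0∞} (hr : 2 ≤ r) (hp2 : 2 ≤ p) (hp : p ≠ ⊤) {δ T : ℝ}
    (hδ : 0 ≤ δ) {f : ℝ → R3 → ℝ} (hf : MemLL r p δ T f) : LocalL2 T f :=
  hf.memLp two_ne_zero hr hp2 hp hδ

/-- `q` and the candidate pressure agree on Laplacians of test functions, so the difference of their
`k`-th derivatives is harmonic in `x`. Both derivatives are averaging, and Liouville applies. -/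
theorem lineDeriv_pressure_eq {γ T : ℝ} (hγ : 0 < γ) (hγ' : γ < 5 / 2)
    {F : ℝ → R3 → Fin 3 → Fin 3 → ℝ} (hF : ∀ i j, MemLL 2 2 γ T fun t x => F t x i j)
    {b : ℝ → R3 → R3} (hb : MemLL 3 3 (3 * γ / 2) T b) (hbdiv : DivFree T b)
    {u : ℝ → R3 → R3} (hu : MemLL ⊤ 2 γ T u)
    {G : ℝ → R3 → Fin 3 → Fin 3 → ℝ} (hG : IsWeakGradient T u G)
    (hGmem : ∀ i j, MemLL 2 2 γ T fun t x => G t x i j) {q : 𝓓'(slab T, ℝ)}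
    (heq : AdvectionDiffusion T b u G F q) (hudiv : DivFree T u)
    {P Q : Fin 3 → Fin 3 → ℝ → R3 → ℝ}
    (hP : ∀ i j, MemLL 3 (6 / 5) (6 * γ / 5) T (P i j)) (hQ : ∀ i j, MemLL 2 2 γ T (Q i j))
    (hPL : ∀ i j (φ : 𝓓(slab T, ℝ)), toDist T (P i j) (∑ k, ∂_{dx k} (∂_{dx k} φ)) =
      -toDist T (fun t x => b t x i * u t x j) (∂_{dx i} (∂_{dx j} φ)))
    (hQL : ∀ i j (φ : 𝓓(slab T, ℝ)), toDist T (Q i j) (∑ k, ∂_{dx k} (∂_{dx k} φ)) =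
      -toDist T (fun t x => F t x i j) (∂_{dx i} (∂_{dx j} φ))) (k : Fin 3) :
    ∂_{dx k} q = ∂_{dx k} (toDist T fun t x => ∑ i, ∑ j, (P i j t x - Q i j t x)) := by
  have h65 : (1 : ℝ≥0∞) ≤ 6 / 5 := Fact.out
  have h65' : (6 / 5 : ℝ≥0∞) ≠ ⊤ := by finiteness
  have h23 : (2 : ℝ≥0∞) ≤ 3 := by norm_num
  have h13 : (1 : ℝ≥0∞) ≤ 3 := by norm_num
  have h12 : (1 : ℝ≥0∞) ≤ 2 := one_le_two
  have hbi : ∀ i, MemLL 3 3 (3 * γ / 2) T fun t x => b t x i := hb.coord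
  have hui : ∀ i, MemLL ⊤ 2 γ T fun t x => u t x i := hu.coord
  have hbL : ∀ i, LocalL2 T fun t x => b t x i := fun i =>
    (hbi i).localL2 h23 h23 (by simp) (by positivity)
  have huL : ∀ i, LocalL2 T fun t x => u t x i := fun i =>
    (hui i).localL2 le_top le_rfl (by simp) hγ.le
  have hGL : ∀ i j, LocalL2 T fun t x => G t x i j := fun i j =>
    (hGmem i j).localL2 le_rfl le_rfl (by simp) hγ.le
  have hPi : ∀ i j, LocallyIntegrable (ext T (P i j)) := fun i j =>
    locallyIntegrable_ext ((hP i j).integrableOn h13 h65 h65' (by positivity))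
  have hQi : ∀ i j, LocallyIntegrable (ext T (Q i j)) := fun i j =>
    ((hQ i j).localL2 le_rfl le_rfl (by simp) hγ.le).locallyIntegrable
  have hPQi : ∀ i j, LocallyIntegrable (ext T fun t x => P i j t x - Q i j t x) := fun i j => by
    rw [ext_sub]; exact (hPi i j).sub (hQi i j)
  have hp : (toDist T fun t x => ∑ i, ∑ j, (P i j t x - Q i j t x)) =
      ∑ i, ∑ j, (toDist T (P i j) - toDist T (Q i j)) := by
    rw [toDist_sum _ fun i => locallyIntegrable_ext_sum _ (hPQi i)]
    refine Finset.sum_congr rfl fun i _ => ?_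
    rw [toDist_sum _ (hPQi i)]
    exact Finset.sum_congr rfl fun j _ => toDist_sub (hPi i j) (hQi i j)
  have hlap : ∀ ψ : 𝓓(slab T, ℝ), q (∑ k, ∂_{dx k} (∂_{dx k} ψ)) =
      (toDist T fun t x => ∑ i, ∑ j, (P i j t x - Q i j t x)) (∑ k, ∂_{dx k} (∂_{dx k} ψ)) := by
    intro ψ
    rw [heq.laplacian_pressure hbdiv hudiv hG hbL huL hGL, hp]
    simp only [sum_apply, sub_apply]
    refine Finset.sum_congr rfl fun i _ => Finset.sum_congr rfl fun j _ => ?_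
    rw [hPL, hQL]
    ring
  have hδ : 6 * γ / 5 < 3 := by linarith
  have hγ3 : γ < 3 := by linarith
  have hua : Averaging (toDist T fun t x => u t x k) :=
    (hui k).averaging_toDist le_top h12 (by simp) hγ.le hγ3
  -- No growth condition is assumed on `q`. The equation supplies one for `∂_k q`, as every other
  -- term is a derivative of a function with vanishing averages; for `b_i u_k` this needs `6γ/5 <
  -- 3`.
  have hq : Averaging (∂_{dx k} q) := by
    rw [heq.lineDeriv_pressure hbdiv hG hbL huL hGL]
    refine (((Averaging.sum _ fun i => (hua.lineDeriv _).lineDeriv _).sub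
      (Averaging.sum _ fun i => Averaging.lineDeriv ?_ _)).add
      (Averaging.sum _ fun i => Averaging.lineDeriv ?_ _)).sub (hua.lineDeriv _)
    · exact ((hbi i).mul (hui k)).averaging_toDist h13 h65 h65' (by positivity) hδ
    · exact (hF i k).averaging_toDist h12 h12 (by simp) hγ.le hγ3
  have hpa : Averaging (toDist T fun t x => ∑ i, ∑ j, (P i j t x - Q i j t x)) := by
    rw [hp]
    exact Averaging.sum _ fun i => Averaging.sum _ fun j =>
      ((hP i j).averaging_toDist h13 h65 h65' (by positivity) hδ).sub
        ((hQ i j).averaging_toDist h12 h12 (by simp) hγ.le hγ3)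
  generalize (toDist T fun t x => ∑ i, ∑ j, (P i j t x - Q i j t x)) = p at hlap hpa ⊢
  refine sub_eq_zero.1 ((hq.sub (hpa.lineDeriv _)).eq_zero_of_laplacian_eq_zero fun φ => ?_)
  have h1 := hlap (∂_{dx k} φ)
  have h2 : ∀ i, ∂_{dx k} (∂_{dx i} (∂_{dx i} φ)) = ∂_{dx i} (∂_{dx i} (∂_{dx k} φ)) := fun i => by
    rw [test_lineDeriv_comm, test_lineDeriv_comm φ (dx k) (dx i)]
  simp only [sub_apply, Distribution.lineDerivOp_apply_apply, map_neg, h2,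
    Finset.sum_sub_distrib, Finset.sum_neg_distrib]
  simp only [map_sum] at h1
  rw [h1]
  ring

end WeightedNS

/-! ### Assembly of the theorem. -/

theorem mainTheorem7 (γ T : ℝ) (hγ : 0 < γ) (hγ' : γ < 5 / 2) (hT : 0 < T)
    (F : ℝ → WeightedNS.R3 → Fin 3 → Fin 3 → ℝ)
    (hF : ∀ i j, WeightedNS.MemLL 2 2 γ T fun t x => F t x i j)
    (b : ℝ → WeightedNS.R3 → WeightedNS.R3)
    (hb : WeightedNS.MemLL 3 3 (3 * γ / 2) T b) (hbdiv : WeightedNS.DivFree T b)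
    (u : ℝ → WeightedNS.R3 → WeightedNS.R3) (hu : WeightedNS.MemLL ⊤ 2 γ T u)
    (G : ℝ → WeightedNS.R3 → Fin 3 → Fin 3 → ℝ) (hG : WeightedNS.IsWeakGradient T u G)
    (hGmem : ∀ i j, WeightedNS.MemLL 2 2 γ T fun t x => G t x i j)
    (q : 𝓓'(WeightedNS.slab T, ℝ))
    (heq : WeightedNS.AdvectionDiffusion T b u G F q) (hudiv : WeightedNS.DivFree T u) :
    ∃ (R : Fin 3 → Lp ℝ (6 / 5) (WeightedNS.weightMeasure (6 * γ / 5)) →L[ℝ]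
          Lp ℝ (6 / 5) (WeightedNS.weightMeasure (6 * γ / 5)))
      (S : Fin 3 → Lp ℝ 2 (WeightedNS.weightMeasure γ) →L[ℝ] Lp ℝ 2 (WeightedNS.weightMeasure γ))
      -- `P i j` is `R_i R_j (b_i u_j)` and `Q i j` is `R_i R_j F_{i,j}`
      (P Q : Fin 3 → Fin 3 → ℝ → WeightedNS.R3 → ℝ),
      (∀ j, WeightedNS.IsRieszTransform j (R j)) ∧
      (∀ j, WeightedNS.IsRieszTransform j (S j)) ∧
      (∀ i j, ∀ᵐ t ∂(volume.restrict (Ioo 0 T)),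
        ∃ h : MemLp (fun x => b t x i * u t x j) (6 / 5) (WeightedNS.weightMeasure (6 * γ / 5)),
          P i j t =ᵐ[WeightedNS.weightMeasure (6 * γ / 5)] R i (R j (h.toLp _))) ∧
      (∀ i j, ∀ᵐ t ∂(volume.restrict (Ioo 0 T)),
        ∃ h : MemLp (fun x => F t x i j) 2 (WeightedNS.weightMeasure γ),
          Q i j t =ᵐ[WeightedNS.weightMeasure γ] S i (S j (h.toLp _))) ∧
      (∀ i j, WeightedNS.MemLL 3 (6 / 5) (6 * γ / 5) T (P i j)) ∧
      (∀ i j, WeightedNS.MemLL 2 2 γ T (Q i j)) ∧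
      WeightedNS.MemLL 3 (6 / 5) (6 * γ / 5) T (fun t x => ∑ i, ∑ j, P i j t x) ∧
      WeightedNS.MemLL 2 2 γ T (fun t x => ∑ i, ∑ j, Q i j t x) ∧
      ∀ k, ∂_{WeightedNS.dx k} q =
        ∂_{WeightedNS.dx k}
          (WeightedNS.toDist T fun t x => ∑ i, ∑ j, (P i j t x - Q i j t x)) := by
  obtain ⟨S, hS, hS'⟩ := WeightedNS.exists_riesz_two hγ hγ'
  obtain ⟨R, hR, hR'⟩ := WeightedNS.exists_riesz_six_fifths hγ hγ'
  have h65 : (6 / 5 : ℝ≥0∞) ≠ ⊤ := by finiteness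
  have h65' : (1 : ℝ≥0∞) ≤ 6 / 5 := Fact.out
  have hbu : ∀ i j, WeightedNS.MemLL 3 (6 / 5) (6 * γ / 5) T fun t x => b t x i * u t x j :=
    fun i j => (hb.coord i).mul (hu.coord j)
  -- `R_i R_j` is treated as a single bounded operator, so only one jointly measurable
  -- representative has to be chosen.
  choose P hP hP' using fun i j =>
    (hbu i j).exists_clm_apply (by simp) h65 ((R i).comp (R j))
  choose Q hQ hQ' using fun i j =>
    (hF i j).exists_clm_apply (by simp) (by simp) ((S i).comp (S j))
  refine ⟨R, S, P, Q, hR, hS, hP', hQ', hP, hQ,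
    WeightedNS.MemLL.sum (by norm_num) h65' h65 _ fun i =>
      WeightedNS.MemLL.sum (by norm_num) h65' h65 _ fun j => hP i j,
    WeightedNS.MemLL.sum one_le_two one_le_two (by simp) _ fun i =>
      WeightedNS.MemLL.sum one_le_two one_le_two (by simp) _ fun j => hQ i j,
    WeightedNS.lineDeriv_pressure_eq hγ hγ' hF hb hbdiv hu hG hGmem heq hudiv hP hQ
      (fun i j => ?_) fun i j => ?_⟩
  · exact WeightedNS.laplacian_toDist_riesz (fun f φ => hR' i j f φ)
      (WeightedNS.locallyIntegrable_ext
        ((hbu i j).integrableOn (by norm_num) h65' h65 (by positivity)))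
      (WeightedNS.locallyIntegrable_ext
        ((hP i j).integrableOn (by norm_num) h65' h65 (by positivity))) (hP' i j)
  · exact WeightedNS.laplacian_toDist_riesz (fun f φ => hS' i j f φ)
      (WeightedNS.locallyIntegrable_ext
        ((hF i j).integrableOn one_le_two one_le_two (by simp) hγ.le))
      (WeightedNS.locallyIntegrable_ext
        ((hQ i j).integrableOn one_le_two one_le_two (by simp) hγ.le)) (hQ' i j)
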